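/- **Setting.** A pinched ribbon graph is a ribbon graph $G$ (possibly non-orientable, possibly disconnected) with finitely many half-ribbons attached to its vertices; $G$ is considered up to isomorphism, and the position of the half-ribbons on the circle of their vertex is immaterial. For an edge $e$: $G-e$ is deletion, $G\vee e$ is the cut ($e$ is removed and a half-ribbon is left at each of its two ends), $G/e$ is contraction; $e$ is a *bridge* if its removal disconnects a component, and *regular* if it is neither a loop nor a bridge. Write $|\mathfrak f^0|$, $k(G)$, $r(G)$, $n(G)$ for the numbers of half-ribbons and components, the rank and the nullity. For a set $A$ of edges (all vertices being kept, the edges outside $A$ being cut) let $F_{\rm int}(A)$ be the number of closed faces, $C_\partial(A)$ the number of components of the boundary graph (so $F_{\rm int}(A)+C_\partial(A)$ is the number of boundary circles of the surface formed by the vertices and the edges in $A$), $f(A)$ the number of half-ribbons, and $t(A)=0$ or $1$ according to whether this surface is orientable or not. Put $$\mathcal R'(G;X,Y,Z,W,T)=\sum_{A}(X-1)^{r(G)-r(A)}(Y-1)^{n(A)}Z^{k(A)-F_{\rm int}(A)-C_\partial(A)+n(A)}W^{t(A)}T^{f(A)},$$ and let $R(G;X,Y,Z,W)$ be the same sum without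 the factor $T^{f(A)}$ (the Bollobás–Riordan polynomial of the underlying ribbon graph). Bouquets (one-vertex graphs) are identified with signed chord diagrams with half-chords, i.e. cyclic words in which each chord occurs twice, a chord being negative if it is twisted. For words $a,b,c,d$ and a chord $e$ occurring in none of them, the diagrams $D_1=(a\,e\,b\,c\,e\,d)$ and $D_2=(b\,e\,a\,d\,e\,c)$, $e$ positive, are *related by a rotation about $e$*; $D_3=(a\,e\,b\,c\,\bar e\,d)$ and $D_4=(b\,e\,a\,c^{-1}\,\bar e\,d^{-1})$, $e$ negative, are *related by a twist about $e$*, where $c^{-1},d^{-1}$ are the reversed words and the sign of each chord having exactly one end in $c\cup d$ is changed. $R$-equivalence $\sim$ is the equivalence relation generated by rotations and twists. For $2j+k\le i$, $D_{ijkl}$ is the diagram with $i-2j-k$ isolated positive chords, $j$ pairs of intersecting positive chords, $k$ isolated negative chords and $l$ half-chords, side by side. Let $\mathcal M$ be a set of pinched ribbon graphs that is minor closed (closed under deletion and cut of edges, contraction of non-loop edges, and deletion of vertices) and closed under chord operations: whenever $D\in\mathcal M$ and $D\sim D_{ijkl}$ with $k\le2$, there is a finite sequence $D=D^{(1)},\dots,D^{(n)}=D_{ijkl}$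 in $\mathcal M$ in which any two consecutive diagrams are related by a single rotation or twist. Suppose $D_{1000},D_{1010},D_{2100}\in\mathcal M$. Let $\mathfrak R$ be a commutative ring with unity, $F:\mathcal M\to\mathfrak R$ a map, $s=F(D_{2100})$, $q=F(D_{1000})$, $r=F(D_{1010})$, and let $\alpha,x,u,v\in\mathfrak R$ with $\alpha$ a unit and $v=v^2$. Suppose that, for members of $\mathcal M$, $F(G\sqcup H)=F(G)F(H)$ if $G$ and $H$ are disjoint unions of bouquets, and $\alpha F(G\cdot H)=F(G)F(H)$ for every one-point-joint $G\cdot H$ of two bouquets $G$, $H$. **(1)** Suppose also $D_{0001}\in\mathcal M$; let $s_1=F(D_{0001})$ and $\beta=(x-1)(\alpha^{-1}s_1)^2+1$. Suppose that: * if $D,\tilde D\in\mathcal M$ are related by a rotation or a twist about $e$, with segments $a,b,c,d$ as above, then $F(D)-\mu F(D\vee e)=F(\tilde D)-\mu F(\tilde D\vee e)$, where $\mu=1$ if there is a chord from $a\cup b$ to $c\cup d$ and $\mu=\beta$ otherwise; * $F(G)=F(G\vee e)+F(G/e)$ if $e$ is regular, $F(G)=\beta F(G/e)$ if $e$ is a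 bridge; * for some $t\in\mathfrak R$, $F(E)=\alpha^nt^m$ for every edgeless $E\in\mathcal M$ with $n$ vertices and $m$ half-ribbons; * $(q-\alpha^{-1}s_1^2)^2u^2=\alpha\,[\,s-2\alpha^{-2}(q-\alpha^{-1}s_1^2)s_1^2-\alpha^{-3}s_1^4\,]$ and $(q-\alpha^{-1}s_1^2)uv=r-\alpha^{-1}s_1^2$. Then for all $G\in\mathcal M$ $$F(G)=\alpha^{k(G)}\mathcal R'\big(G;\,x,\ \alpha^{-1}(q-\alpha^{-1}s_1^2+\alpha),\ u,\ v,\ \alpha^{-1}s_1\big).$$ If moreover $q-\alpha^{-1}s_1^2$ and $r-\alpha^{-1}s_1^2$ are units, then $v=1$, so that this formula holds with $v$ replaced by $1$. **(2)** Let $\sigma,\tau$ be units of $\mathfrak R$ and $T\in\mathfrak R$. Suppose that: * if $D,\tilde D\in\mathcal M$ are related by a rotation or a twist about $e$, with segments $a,b,c,d$ as above, then $\sigma F(D)-\mu\tau F(D-e)=\sigma F(\tilde D)-\mu\tau F(\tilde D-e)$, where $\mu=\sigma$ if there is a chord from $a\cup b$ to $c\cup d$ and $\mu=x$ otherwise;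 * $F(G)=\tau F(G-e)+\sigma F(G/e)$ if $e$ is regular, $F(G)=xF(G/e)$ if $e$ is a bridge; * $F(E)=\alpha^nT^m$ for every edgeless $E\in\mathcal M$ with $n$ vertices and $m$ half-ribbons; * $(q-\alpha\tau)^2u^2=\alpha(s-2\tau q+\alpha\tau^2)$ and $(q-\alpha\tau)uv=r-\alpha\tau$. Then for all $G\in\mathcal M$ and every unit $S$ of $\mathfrak R$ (for instance $S=T$, if $T$ is a unit) $$\sigma^{-r(G)}\tau^{-n(G)}F(G)=T^{|\mathfrak f^0|}\alpha^{k(G)}R(G;\sigma^{-1}x,\alpha^{-1}\tau^{-1}q,u,v)$$ $$=T^{|\mathfrak f^0|}S^{-(|\mathfrak f^0|+2n(G))}\alpha^{k(G)}\mathcal R'\big(G;\sigma^{-1}[(x-\sigma)S^{-2}+\sigma],\ S^2\alpha^{-1}\tau^{-1}q-S^2+1,\ u,\ v,\ S\big).$$ If moreover $q-\alpha\tau$ and $r-\alpha\tau$ are units, then $v=1$, so that the first formula holds with $v$ replaced by $1$. -/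

import Mathlib

/-- A mark on the boundary circle of a vertex disc, read in the direction of traversal of the circle:
`none` is a half-ribbon; `some (e, true)` (resp. `some (e, false)`) is one of the two ends of the
ribbon edge labelled `e`, drawn as an arrow that points with (resp. against) the traversal. -/
abbrev Mark : Type := Option (ℕ × Bool)

/-- The labels of the edge ends met on a list of circles. -/
def edgeLabels (L : List (List Mark)) : List ℕ := L.flatten.filterMap (Option.map Prod.fst)

/-- A ribbon graph with half-ribbons, given by an arrow presentation: one circle (a cyclic word,
cut open somewhere) for each vertex disc, each edge label occurring exactly twice. The ribbon of `e`
is glued along the two arrows `e` so that both agree with one orientation of the boundary of the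
ribbon. -/
structure HERG where
  circles : List (List Mark)
  two : ∀ e ∈ edgeLabels circles, (edgeLabels circles).count e = 2

/-- Change of a mark when its circle is traversed in the opposite direction. -/
def Mark.flip : Mark → Mark := Option.map fun p => (p.1, !p.2)

/-- A word read backwards. -/
def flipWord (c : List Mark) : List Mark := (c.map Mark.flip).reverse

/-- Reverse both arrows of the edge `e`. -/
def Mark.turn (e : ℕ) : Mark → Mark := Option.map fun p => if p.1 = e then (p.1, !p.2) else p

/-- Rename the edges. -/
def Mark.relabel (f : ℕ → ℕ) : Mark → Mark := Option.map fun p => (f p.1, p.2)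

/-- The moves between arrow presentations of isomorphic ribbon graphs, together with the move
`slide` of a half-ribbon to another place of the circle it is attached to. -/
inductive HERGMove : List (List Mark) → List (List Mark) → Prop
  | perm {L L' : List (List Mark)} (h : L.Perm L') : HERGMove L L'
  | rotate (a b : List Mark) (L : List (List Mark)) : HERGMove ((a ++ b) :: L) ((b ++ a) :: L)
  | reverse (c : List Mark) (L : List (List Mark)) : HERGMove (c :: L) (flipWord c :: L)
  | turn (e : ℕ) (L : List (List Mark)) : HERGMove L (L.map (List.map (Mark.turn e)))
  | relabel (f : Equiv.Perm ℕ) (L : List (List Mark)) :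
      HERGMove L (L.map (List.map (Mark.relabel f)))
  | slide (a b : List Mark) (L : List (List Mark)) :
      HERGMove ((a ++ none :: b) :: L) ((none :: (a ++ b)) :: L)

/-- Pinched ribbon graphs: ribbon graphs with half-ribbons up to isomorphism, the position of
the half-ribbons on the circle of their vertex being immaterial. -/
def PinchedGraph : Type := Quot fun G H : HERG => HERGMove G.circles H.circles

namespace HERG

/-- The pinched ribbon graph presented by `G`. -/
def cls (G : HERG) : PinchedGraph := Quot.mk _ G

/-- The edge set. -/
def edges (G : HERG) : Finset ℕ := (edgeLabels G.circles).toFinset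

/-- The number of vertices. -/
def numVert (G : HERG) : ℕ := G.circles.length

/-- The number of half-ribbons. -/
def numHR (G : HERG) : ℕ := G.circles.flatten.count none

/-! ### Invariants of spanning subgraphs

The cutting spanning subgraph with edge set `A` has all vertices and half-ribbons of `G`, the edges in
`A`, and two further half-ribbons in place of each edge outside `A`. -/

/-- `m` is the mark number `j` on circle number `i`. -/
def MarkAt (G : HERG) (i j : ℕ) (m : Mark) : Prop :=
  ∃ w : List Mark, G.circles[i]? = some w ∧ w[j]? = some m

/-- The number of connected components. -/
noncomputable def comps (G : HERG) (A : Finset ℕ) : ℕ :=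
  Nat.card (Quot fun u v : Fin G.circles.length =>
    ∃ e ∈ A, (∃ d, some (e, d) ∈ G.circles[u]) ∧ ∃ d, some (e, d) ∈ G.circles[v])

/-- The rank. -/
noncomputable def rk (G : HERG) (A : Finset ℕ) : ℕ := G.numVert - G.comps A

/-- The nullity. -/
noncomputable def nullity (G : HERG) (A : Finset ℕ) : ℕ := A.card - G.rk A

/-- Orientability: one can choose a direction for every circle in such a way that the two arrows of
every edge in `A` both agree or both disagree with the chosen directions. -/
def Orientable (G : HERG) (A : Finset ℕ) : Prop :=
  ∃ o : ℕ → Bool, ∀ e ∈ A, ∀ i j d i' j' d', G.MarkAt i j (some (e, d)) →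
    G.MarkAt i' j' (some (e, d')) → (d ^^ o i) = (d' ^^ o i')

open Classical in
/-- `0` if orientable, `1` otherwise. -/
noncomputable def nonor (G : HERG) (A : Finset ℕ) : ℕ := if G.Orientable A then 0 else 1

/-- The arcs of the vertex circles between consecutive marks: `(i, j)` is the piece of circle number
`i` just before mark number `j`. On a circle with `n` marks the pieces `0` and `n` are glued. -/
def Gap (G : HERG) : Type := {p : ℕ × ℕ // ∃ c, G.circles[p.1]? = some c ∧ p.2 ≤ c.length}

/-- The arc at the tip of the arrow that is mark number `j` on circle `i`, of direction `d`. -/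
def tip (i j : ℕ) (d : Bool) : ℕ × ℕ := if d then (i, j + 1) else (i, j)

/-- The arc at the tail of that arrow. -/
def tail (i j : ℕ) (d : Bool) : ℕ × ℕ := if d then (i, j) else (i, j + 1)

/-- In the subgraph `A`, the mark is a half-ribbon (of `G`, or coming from a cut edge). -/
def IsFree (A : Finset ℕ) (m : Mark) : Prop := ∀ e d, m = some (e, d) → e ∉ A

/-- Two arcs follow each other on the boundary of the pinched subgraph `A`: through the base point of
a circle, around a half-ribbon, or along one of the two sides of a ribbon in `A`. -/
inductive BdryStep (G : HERG) (A : Finset ℕ) : G.Gap → G.Gap → Prop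
  | close (p q : G.Gap) (c : List Mark) (hc : G.circles[p.1.1]? = some c)
      (hp : p.1.2 = 0) (hq : q.1 = (p.1.1, c.length)) : BdryStep G A p q
  | free (p q : G.Gap) (m : Mark) (hm : G.MarkAt p.1.1 p.1.2 m) (hfree : IsFree A m)
      (hq : q.1 = (p.1.1, p.1.2 + 1)) : BdryStep G A p q
  | side (p q : G.Gap) (e : ℕ) (he : e ∈ A) (i j : ℕ) (d : Bool) (i' j' : ℕ) (d' : Bool)
      (hne : (i, j) ≠ (i', j')) (h : G.MarkAt i j (some (e, d)))
      (h' : G.MarkAt i' j' (some (e, d'))) (hp : p.1 = tip i j d) (hq : q.1 = tail i' j' d') :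
      BdryStep G A p q

/-- The boundary circles of the pinched subgraph `A`, i.e. of the surface formed by its vertex discs
and ribbon edges. -/
def BdryCircle (G : HERG) (A : Finset ℕ) : Type := Quot (G.BdryStep A)

/-- The boundary circle passes through some half-ribbon. -/
def BdryCircle.IsOpen {G : HERG} {A : Finset ℕ} (f : G.BdryCircle A) : Prop :=
  ∃ p : G.Gap, Quot.mk _ p = f ∧ ∃ m, G.MarkAt p.1.1 p.1.2 m ∧ IsFree A m

/-- The number of boundary circles of the surface. -/
noncomputable def numBdry (G : HERG) (A : Finset ℕ) : ℕ := Nat.card (G.BdryCircle A)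

/-- The number of closed (internal) faces. -/
noncomputable def numFint (G : HERG) (A : Finset ℕ) : ℕ :=
  Nat.card {f : G.BdryCircle A // ¬ f.IsOpen}

/-- The number of connected components of the boundary graph (whose vertices are the half-ribbons
and whose edges are the open faces). -/
noncomputable def numBdryComps (G : HERG) (A : Finset ℕ) : ℕ :=
  Nat.card {f : G.BdryCircle A // f.IsOpen}

/-- The number of half-ribbons of the subgraph `A`. -/
def numFree (G : HERG) (A : Finset ℕ) : ℕ := G.numHR + 2 * (G.edges \ A).card

/-! ### The polynomials -/

/-- The polynomial `R'`: the specialization `S = Z⁻¹` of the Bollobás–Riordan polynomial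
`∑ (X-1)^(r(G)-r(A)) (Y-1)^n(A) Z^(k(A)-F_int(A)+n(A)) S^(C_∂(A)) W^t(A) T^f(A)`
of ribbon graphs with half-ribbons. -/
noncomputable def polyR' {R : Type*} [CommRing R] (G : HERG) (X Y Z W T : R) : R :=
  ∑ A ∈ G.edges.powerset,
    (X - 1) ^ (G.rk G.edges - G.rk A) * (Y - 1) ^ G.nullity A *
      Z ^ (G.comps A + G.nullity A - (G.numFint A + G.numBdryComps A)) *
      W ^ G.nonor A * T ^ G.numFree A

/-- The Bollobás–Riordan polynomial of the underlying ribbon graph (half-ribbons forgotten). -/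
noncomputable def polyBR {R : Type*} [CommRing R] (G : HERG) (X Y Z W : R) : R :=
  ∑ A ∈ G.edges.powerset,
    (X - 1) ^ (G.rk G.edges - G.rk A) * (Y - 1) ^ G.nullity A *
      Z ^ (G.comps A + G.nullity A - G.numBdry A) * W ^ G.nonor A

/-! ### Operations -/

theorem two_of_filter {L L' : List (List Mark)} {e : ℕ}
    (h : ∀ f ∈ edgeLabels L, (edgeLabels L).count f = 2)
    (h' : edgeLabels L' = (edgeLabels L).filter (fun f => f ≠ e)) :
    ∀ f ∈ edgeLabels L', (edgeLabels L').count f = 2 := by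
  intro f hf
  rw [h'] at hf ⊢
  obtain ⟨hf, hfe⟩ := List.mem_filter.mp hf
  exact (List.count_filter (l := edgeLabels L) hfe).trans (h f hf)

/-- Deletion of the edge `e`. -/
def del (G : HERG) (e : ℕ) : HERG where
  circles := G.circles.map (List.filter fun m => m.map Prod.fst ≠ some e)
  two := two_of_filter (e := e) G.two (by
    unfold edgeLabels
    induction G.circles with
    | nil => rfl
    | cons c L ih =>
      simp only [List.map_cons, List.flatten_cons, List.filterMap_append, List.filter_append, ih]
      congr 1
      induction c with
      | nil => rfl
      | cons m c ih => rcases m with _ | ⟨f, d⟩ <;> grind)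

/-- Cut of the edge `e`: both of its ends become half-ribbons. -/
def cut (G : HERG) (e : ℕ) : HERG where
  circles := G.circles.map (List.map fun m => if m.map Prod.fst = some e then none else m)
  two := two_of_filter (e := e) G.two (by
    unfold edgeLabels
    induction G.circles with
    | nil => rfl
    | cons c L ih =>
      simp only [List.map_cons, List.flatten_cons, List.filterMap_append, List.filter_append, ih]
      congr 1
      induction c with
      | nil => rfl
      | cons m c ih => rcases m with _ | ⟨f, d⟩ <;> grind)

/-- `G'` is the contraction `G/e` of the non-loop edge `e`. Every non-loop edge has this form in a
suitable presentation of the same ribbon graph. -/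
def IsContraction (G : HERG) (e : ℕ) (G' : HERG) : Prop :=
  ∃ d a b L, G.circles = (some (e, d) :: a) :: (some (e, d) :: b) :: L ∧
    G'.circles = (a ++ b) :: L

/-- `G'` arises from `G` by deleting a vertex without incident edges, with its half-ribbons. -/
def IsVertexDeletion (G G' : HERG) : Prop :=
  ∃ c, (∀ m ∈ c, m = none) ∧ G.circles = c :: G'.circles

/-- Both ends of `e` are on the same vertex. -/
def IsLoop (G : HERG) (e : ℕ) : Prop := ∃ c ∈ G.circles, (edgeLabels [c]).count e = 2

/-- Removing `e` disconnects a component. -/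
def IsBridge (G : HERG) (e : ℕ) : Prop :=
  e ∈ G.edges ∧ G.comps G.edges < G.comps (G.edges.erase e)

/-- Neither a loop nor a bridge. -/
def IsRegular (G : HERG) (e : ℕ) : Prop := e ∈ G.edges ∧ ¬ G.IsLoop e ∧ ¬ G.IsBridge e

/-- A disjoint union of bouquets (one-vertex ribbon graphs). -/
def IsBouquetUnion (G : HERG) : Prop := ∀ e ∈ G.edges, G.IsLoop e

/-- `K` is the disjoint union of `G` and `H`. -/
def IsUnion (G H K : HERG) : Prop := K.circles = G.circles ++ H.circles

/-- `K` is a one-point-joint of the bouquets `G` and `H`. -/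
def IsJoint (G H K : HERG) : Prop :=
  ∃ a b, G.circles = [a] ∧ H.circles = [b] ∧ K.circles = [a ++ b]

/-! ### Chord diagrams, i.e. bouquets -/

/-- `D₁` and `D₂` are related by a rotation about the chord `e`: they arise by contracting either of two
untwisted edges joining two vertices, one of which carries the remaining segments `a`, `b` and the
other one `c`, `d`. -/
def IsRotation (D₁ D₂ : HERG) (e : ℕ) (a b c d : List Mark) : Prop :=
  ∃ s : Bool,
    D₁.circles = [a ++ [some (e, s)] ++ b ++ c ++ [some (e, s)] ++ d] ∧
    D₂.circles = [b ++ [some (e, s)] ++ a ++ d ++ [some (e, s)] ++ c]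

/-- `D₁` and `D₂` are related by a twist about the chord `e`: the same with one of the two contracted
edges twisted. -/
def IsTwist (D₁ D₂ : HERG) (e : ℕ) (a b c d : List Mark) : Prop :=
  ∃ s : Bool,
    D₁.circles = [a ++ [some (e, s)] ++ b ++ c ++ [some (e, !s)] ++ d] ∧
    D₂.circles = [b ++ [some (e, s)] ++ a ++ flipWord c ++ [some (e, !s)] ++ flipWord d]

/-- There is a chord from `a ∪ b` to `c ∪ d`. -/
def Linked (a b c d : List Mark) : Prop := ∃ f, f ∈ edgeLabels [a, b] ∧ f ∈ edgeLabels [c, d]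

/-- The word of the canonical diagram `D_{ijkl}`: side by side, `i - 2j - k` isolated positive chords,
`j` pairs of intersecting positive chords, `k` isolated negative chords and `l` half-chords. -/
def canonWord (i j k l : ℕ) : List Mark :=
  ((List.range (i - 2 * j - k)).flatMap fun m => [some (m, true), some (m, true)]) ++
  ((List.range j).flatMap fun m =>
    [some (i + 2 * m, true), some (i + 2 * m + 1, true),
      some (i + 2 * m, true), some (i + 2 * m + 1, true)]) ++
  ((List.range k).flatMap fun m =>
    [some (i + 2 * j + m, true), some (i + 2 * j + m, false)]) ++
  List.replicate l none

theorem canonWord_two (i j k l : ℕ) : ∀ e ∈ edgeLabels [canonWord i j k l],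
    (edgeLabels [canonWord i j k l]).count e = 2 := by
  have h1 : ∀ n, List.filterMap (Option.map Prod.fst) ((List.range n).flatMap fun m => [some (m, true), some (m, true)]) = (List.range n).flatMap fun m => [m,m] := by
    intro n; simp [List.filterMap_flatMap]
  have h2 : ∀ n, List.filterMap (Option.map Prod.fst) ((List.range n).flatMap fun m => [some (i + 2 * m, true), some (i + 2 * m + 1, true),
      some (i + 2 * m, true), some (i + 2 * m + 1, true)]) = (List.range n).flatMap fun m => [i+2*m,i+2*m+1,i+2*m,i+2*m+1] := by
    intro n; simp [List.filterMap_flatMap]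
  have h3 : ∀ n, List.filterMap (Option.map Prod.fst) ((List.range n).flatMap fun m => [some (i + 2 * j + m, true), some (i + 2 * j + m, false)]) = (List.range n).flatMap fun m => [i + 2 * j + m,i + 2 * j + m] := by
    intro n; simp [List.filterMap_flatMap]
  have c1 : ∀ n e, ((List.range n).flatMap fun m => [m,m]).count e = if e < n then 2 else 0 := by
    intro n e
    induction n with
    | zero => simp
    | succ n ih => 
      simp only [List.range_succ, List.flatMap_append, List.count_append, ih]
      simp [List.count_cons]; grind
  have c2 : ∀ n e, ((List.range n).flatMap fun m => [i+2*m,i+2*m+1,i+2*m,i+2*m+1]).count e = if i ≤ e ∧ e < i + 2*n then 2 else 0 := by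
    intro n e
    induction n with
    | zero => simp
    | succ n ih => 
      simp only [List.range_succ, List.flatMap_append, List.count_append, ih]
      simp [List.count_cons]; grind
  have c3 : ∀ n e, ((List.range n).flatMap fun m => [i + 2 * j + m,i + 2 * j + m]).count e = if i+2*j ≤ e ∧ e < i+2*j + n then 2 else 0 := by
    intro n e
    induction n with
    | zero => simp
    | succ n ih => 
      simp only [List.range_succ, List.flatMap_append, List.count_append, ih]
      simp [List.count_cons]; grind
  have h4 : (List.replicate l (none : Mark)).filterMap (Option.map Prod.fst) = [] := by
    induction l with
    | zero => rfl
    | succ l ih => rw [List.replicate_succ]; exact ih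
  intro e he
  rw [← List.count_pos_iff] at he
  unfold edgeLabels canonWord at *
  simp only [List.flatten_cons, List.flatten_nil, List.append_nil, List.filterMap_append, h1, h2,
    h3, h4, List.count_append, c1, c2, c3] at *
  grind

/-- The canonical diagram `D_{ijkl}` (meaningful for `2j + k ≤ i`). -/
def canon (i j k l : ℕ) : HERG := ⟨[canonWord i j k l], canonWord_two i j k l⟩

end HERG

/-- Two classes of chord diagrams are related by a single rotation or twist. -/
def ChordStep (x y : PinchedGraph) : Prop :=
  ∃ D₁ D₂ : HERG, ∃ e a b c d, D₁.cls = x ∧ D₂.cls = y ∧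
    (D₁.IsRotation D₂ e a b c d ∨ D₁.IsTwist D₂ e a b c d)

/-- `R`-equivalence: related by a sequence of rotations and twists. -/
def REquivalent : PinchedGraph → PinchedGraph → Prop := Relation.EqvGen ChordStep

/-- Minor closed sets of pinched ribbon graphs: closed under deletion and cut of edges, contraction of
non-loop edges and deletion of vertices. -/
structure MinorClosed (M : Set PinchedGraph) : Prop where
  del : ∀ (G : HERG) (e : ℕ), G.cls ∈ M → e ∈ G.edges → (G.del e).cls ∈ M
  cut : ∀ (G : HERG) (e : ℕ), G.cls ∈ M → e ∈ G.edges → (G.cut e).cls ∈ M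
  contract : ∀ (G : HERG) (e : ℕ) (G' : HERG), G.cls ∈ M → G.IsContraction e G' → G'.cls ∈ M
  vertex : ∀ G G' : HERG, G.cls ∈ M → G.IsVertexDeletion G' → G'.cls ∈ M

/-- Closed under chord operations: whenever `D ∈ M` is `R`-equivalent to a canonical diagram, one can get
from `D` to it inside `M` by single rotations and twists. -/
def ChordClosed (M : Set PinchedGraph) : Prop :=
  ∀ D ∈ M, ∀ i j k l : ℕ, 2 * j + k ≤ i → k ≤ 2 → REquivalent D (HERG.canon i j k l).cls →
    Relation.ReflTransGen (fun x y => x ∈ M ∧ y ∈ M ∧ ChordStep x y) D (HERG.canon i j k l).cls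

/-! ### Labels of words and their behaviour under the moves. -/

/-- The labels met on a single word. -/
def labels (w : List Mark) : List ℕ := w.filterMap (Option.map Prod.fst)

@[simp] theorem labels_nil : labels [] = [] := rfl

@[simp] theorem labels_cons_none (w : List Mark) : labels (none :: w) = labels w := rfl

@[simp] theorem labels_cons_some (p : ℕ × Bool) (w : List Mark) :
    labels (some p :: w) = p.1 :: labels w := rfl

@[simp] theorem labels_append (a b : List Mark) : labels (a ++ b) = labels a ++ labels b :=
  List.filterMap_append

@[simp] theorem edgeLabels_nil : edgeLabels [] = [] := rfl

@[simp] theorem edgeLabels_cons (c : List Mark) (L : List (List Mark)) :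
    edgeLabels (c :: L) = labels c ++ edgeLabels L := by
  simp [edgeLabels, labels]

@[simp] theorem edgeLabels_append (L L' : List (List Mark)) :
    edgeLabels (L ++ L') = edgeLabels L ++ edgeLabels L' := by
  simp [edgeLabels]

theorem mem_labels {w : List Mark} {e : ℕ} : e ∈ labels w ↔ ∃ d, some (e, d) ∈ w := by
  simp only [labels, List.mem_filterMap, Option.map_eq_some_iff]
  grind

theorem mem_edgeLabels {L : List (List Mark)} {e : ℕ} :
    e ∈ edgeLabels L ↔ ∃ c ∈ L, e ∈ labels c := by
  simp only [edgeLabels, labels, List.mem_filterMap, List.mem_flatten]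
  grind

theorem edgeLabels_perm {L L' : List (List Mark)} (h : L.Perm L') :
    (edgeLabels L).Perm (edgeLabels L') :=
  h.flatten.filterMap _

@[simp] theorem relabel_none (f : ℕ → ℕ) : Mark.relabel f none = none := rfl

@[simp] theorem relabel_some (f : ℕ → ℕ) (e : ℕ) (d : Bool) :
    Mark.relabel f (some (e, d)) = some (f e, d) := rfl

@[simp] theorem turn_none (e : ℕ) : Mark.turn e none = none := rfl

@[simp] theorem turn_some (e f : ℕ) (d : Bool) :
    Mark.turn e (some (f, d)) = some (f, if f = e then !d else d) := by
  by_cases h : f = e <;> simp [Mark.turn, h]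

@[simp] theorem labels_map_relabel (f : ℕ → ℕ) (w : List Mark) :
    labels (w.map (Mark.relabel f)) = (labels w).map f := by
  induction w with
  | nil => rfl
  | cons m w ih => rcases m with _ | ⟨e, d⟩ <;> simp [ih]

@[simp] theorem labels_map_turn (e : ℕ) (w : List Mark) :
    labels (w.map (Mark.turn e)) = labels w := by
  induction w with
  | nil => rfl
  | cons m w ih =>
    rcases m with _ | ⟨f, d⟩ <;> simp [ih]

@[simp] theorem labels_flipWord (w : List Mark) : labels (flipWord w) = (labels w).reverse := by
  induction w with
  | nil => rfl
  | cons m w ih =>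
    have : flipWord (m :: w) = flipWord w ++ [m.flip] := by simp [flipWord]
    rw [this, labels_append, ih]
    rcases m with _ | p <;> simp [Mark.flip]

@[simp] theorem flipWord_nil : flipWord [] = [] := rfl

@[simp] theorem flipWord_append (a b : List Mark) :
    flipWord (a ++ b) = flipWord b ++ flipWord a := by
  simp [flipWord]

@[simp] theorem flipWord_cons (m : Mark) (a : List Mark) :
    flipWord (m :: a) = flipWord a ++ [m.flip] := by
  simp [flipWord]

@[simp] theorem flip_some (e : ℕ) (d : Bool) : Mark.flip (some (e, d)) = some (e, !d) := rfl

@[simp] theorem flip_none : Mark.flip none = none := rfl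

@[simp] theorem flipWord_flipWord (a : List Mark) : flipWord (flipWord a) = a := by
  induction a with
  | nil => rfl
  | cons m a ih => rcases m with _ | ⟨e, d⟩ <;> simp [ih]

theorem edgeLabels_map_turn (e : ℕ) (L : List (List Mark)) :
    edgeLabels (L.map (List.map (Mark.turn e))) = edgeLabels L := by
  induction L with
  | nil => rfl
  | cons c L ih => simp [ih]

theorem edgeLabels_map_relabel (f : ℕ → ℕ) (L : List (List Mark)) :
    edgeLabels (L.map (List.map (Mark.relabel f))) = (edgeLabels L).map f := by
  induction L with
  | nil => rfl
  | cons c L ih => simp [ih]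

/-- Every label occurs twice. -/
def Twice (l : List ℕ) : Prop := ∀ e ∈ l, l.count e = 2

theorem Twice.of_perm {l l' : List ℕ} (h : Twice l) (hp : l.Perm l') : Twice l' :=
  fun e he => by rw [← hp.count_eq]; exact h e (hp.mem_iff.2 he)

theorem Twice.map {l : List ℕ} (h : Twice l) (f : Equiv.Perm ℕ) : Twice (l.map f) := by
  intro e he
  obtain ⟨a, ha, rfl⟩ := List.mem_map.1 he
  rw [List.count_map_of_injective _ _ f.injective]
  exact h a ha

theorem Twice.right {l l' : List ℕ} (h : Twice (l ++ l')) (hl : Twice l) : Twice l' := by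
  intro e he
  have h1 := h e (by simp [he])
  have h2 := List.count_pos_iff.2 he
  rw [List.count_append] at h1
  by_cases hel : e ∈ l
  · have := hl e hel; omega
  · rw [List.count_eq_zero.2 hel] at h1; omega

theorem Twice.disjoint {l l' : List ℕ} (h : Twice (l ++ l')) (hl : Twice l) : ∀ e ∈ l, e ∉ l' := by
  intro e he he'
  have h1 := h e (by simp [he])
  have h2 := List.count_pos_iff.2 he'
  rw [List.count_append, hl e he] at h1
  omega

theorem HERG.twice (G : HERG) : Twice (edgeLabels G.circles) := G.two

theorem HERGMove.edgeLabels_perm {L L' : List (List Mark)} (h : HERGMove L L') :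
    ∃ f : Equiv.Perm ℕ, ((edgeLabels L).map f).Perm (edgeLabels L') := by
  cases h with
  | perm h => exact ⟨1, by simpa using _root_.edgeLabels_perm h⟩
  | rotate a b L =>
    refine ⟨1, ?_⟩
    simp only [Equiv.Perm.coe_one, List.map_id, edgeLabels_cons, labels_append]
    exact List.perm_append_comm.append_right _
  | reverse c L =>
    refine ⟨1, ?_⟩
    simp only [Equiv.Perm.coe_one, List.map_id, edgeLabels_cons, labels_flipWord]
    exact (List.reverse_perm _).symm.append_right _
  | turn e L => exact ⟨1, by simp [edgeLabels_map_turn]⟩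
  | relabel f L => exact ⟨f, by simp [edgeLabels_map_relabel]⟩
  | slide a b L => exact ⟨1, by simp⟩

theorem HERGMove.twice {L L' : List (List Mark)} (h : HERGMove L L') (hL : Twice (edgeLabels L)) :
    Twice (edgeLabels L') := by
  obtain ⟨f, hf⟩ := h.edgeLabels_perm
  exact (hL.map f).of_perm hf

theorem HERG.cls_eq {G H : HERG} (h : HERGMove G.circles H.circles) : G.cls = H.cls :=
  Quot.sound h

theorem HERG.ext_circles {G H : HERG} (h : G.circles = H.circles) : G = H := by
  cases G; cases H; cases h; rfl

/-! ### Words up to rotations and twists -/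

/-- Elementary transformations of words, read on a circle: change of base point, rotation and twist
about a chord, moving a half-chord and reversing both arrows of a chord. -/
inductive WordStep : List Mark → List Mark → Prop
  | cyc (a b) : WordStep (a ++ b) (b ++ a)
  | rot (e s a b c d) : WordStep (a ++ [some (e, s)] ++ b ++ c ++ [some (e, s)] ++ d)
      (b ++ [some (e, s)] ++ a ++ d ++ [some (e, s)] ++ c)
  | twist (e s a b c d) : WordStep (a ++ [some (e, s)] ++ b ++ c ++ [some (e, !s)] ++ d)
      (b ++ [some (e, s)] ++ a ++ flipWord c ++ [some (e, !s)] ++ flipWord d)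
  | slide (a b) : WordStep (a ++ none :: b) (none :: (a ++ b))
  | turn (e s s' a b c) : WordStep (a ++ some (e, s) :: b ++ some (e, s') :: c)
      (a ++ some (e, !s) :: b ++ some (e, !s') :: c)

/-- The equivalence relation on words generated by the elementary transformations. -/
def WordEq : List Mark → List Mark → Prop := Relation.EqvGen WordStep

theorem WordStep.labels_perm {w w' : List Mark} (h : WordStep w w') :
    (labels w).Perm (labels w') := by
  rw [List.perm_iff_count]
  intro x
  cases h <;> simp [List.count_cons] <;> omega

theorem WordEq.labels_perm {w w' : List Mark} (h : WordEq w w') :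
    (labels w).Perm (labels w') := by
  induction h with
  | rel _ _ h => exact h.labels_perm
  | refl => exact .refl _
  | symm _ _ _ ih => exact ih.symm
  | trans _ _ _ _ _ ih ih' => exact ih.trans ih'

/-- The bouquet with a given word. -/
def bouquet (w : List Mark) (h : Twice (labels w)) : HERG := ⟨[w], by simpa [Twice] using h⟩

theorem turn_eq_self {e : ℕ} {w : List Mark} (h : e ∉ labels w) : w.map (Mark.turn e) = w := by
  induction w with
  | nil => rfl
  | cons m w ih =>
    rcases m with _ | ⟨f, d⟩
    · simp only [labels_cons_none] at h
      simp [ih h]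
    · simp only [labels_cons_some, List.mem_cons, not_or] at h
      simp [ih h.2, Ne.symm h.1]

/-- Changing the base point, sliding a half-chord and reversing both arrows of a chord are
isomorphisms, so only rotations and twists give genuine chord steps. -/
theorem WordStep.rEquivalent {w w' : List Mark} (h : WordStep w w') (hw : Twice (labels w))
    (hw' : Twice (labels w')) : REquivalent (bouquet w hw).cls (bouquet w' hw').cls := by
  cases h with
  | cyc a b =>
    rw [HERG.cls_eq (G := bouquet (a ++ b) hw) (H := bouquet (b ++ a) hw') (.rotate a b [])]
    exact .refl _
  | rot e s a b c d =>
    exact .rel _ _ ⟨_, _, e, a, b, c, d, rfl, rfl, .inl ⟨s, rfl, rfl⟩⟩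
  | twist e s a b c d =>
    exact .rel _ _ ⟨_, _, e, a, b, c, d, rfl, rfl, .inr ⟨s, rfl, rfl⟩⟩
  | slide a b =>
    rw [HERG.cls_eq (G := bouquet _ hw) (H := bouquet _ hw') (.slide a b [])]
    exact .refl _
  | turn e s s' a b c =>
    have h2 := hw e (by simp)
    simp only [labels_append, labels_cons_some, List.count_append, List.count_cons_self] at h2
    have ha : e ∉ labels a := by rw [← List.count_eq_zero]; omega
    have hb : e ∉ labels b := by rw [← List.count_eq_zero]; omega
    have hc : e ∉ labels c := by rw [← List.count_eq_zero]; omega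
    rw [HERG.cls_eq (G := bouquet _ hw) (H := bouquet _ hw')]
    · exact .refl _
    · have := HERGMove.turn e [a ++ some (e, s) :: b ++ some (e, s') :: c]
      simpa [turn_eq_self, ha, hb, hc, bouquet] using this

theorem WordEq.rEquivalent {w w' : List Mark} (h : WordEq w w') (hw : Twice (labels w)) :
    REquivalent (bouquet w hw).cls (bouquet w' (hw.of_perm (WordEq.labels_perm h))).cls := by
  induction h with
  | rel _ _ h => exact h.rEquivalent _ _
  | refl => exact .refl _
  | symm _ _ h ih => exact .symm _ _ (ih (hw.of_perm (WordEq.labels_perm h).symm))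
  | trans _ _ _ h _ ih ih' => exact .trans _ _ _ (ih hw) (ih' (hw.of_perm (WordEq.labels_perm h)))

namespace WordEq

theorem refl (w : List Mark) : WordEq w w := Relation.EqvGen.refl w

theorem symm {w w' : List Mark} (h : WordEq w w') : WordEq w' w := Relation.EqvGen.symm _ _ h

theorem trans {w w' w'' : List Mark} (h : WordEq w w') (h' : WordEq w' w'') : WordEq w w'' :=
  Relation.EqvGen.trans _ _ _ h h'

theorem cyc (a b : List Mark) : WordEq (a ++ b) (b ++ a) := .rel _ _ (.cyc a b)

/-- The rotation read from the first end of `e`: the two arcs cut off by the chord are shifted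
cyclically. Choosing segments empty shifts one arc alone. -/
theorem rot (e : ℕ) (s : Bool) (a b c d : List Mark) :
    WordEq (some (e, s) :: b ++ c ++ some (e, s) :: (d ++ a))
      (some (e, s) :: c ++ b ++ some (e, s) :: (a ++ d)) := by
  have h : WordEq _ _ := .rel _ _ (.rot e s a b c d)
  have h1 := cyc (some (e, s) :: b ++ c ++ some (e, s) :: d) a
  have h2 := cyc (b ++ some (e, s) :: (a ++ d)) (some (e, s) :: c)
  simp only [List.append_assoc, List.cons_append, List.nil_append] at h h1 h2 ⊢
  exact (h1.trans h).trans h2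

theorem slide (a b : List Mark) : WordEq (a ++ none :: b) (none :: (a ++ b)) :=
  .rel _ _ (.slide a b)

theorem turn (e : ℕ) (s s' : Bool) (a b c : List Mark) :
    WordEq (a ++ some (e, s) :: b ++ some (e, s') :: c)
      (a ++ some (e, !s) :: b ++ some (e, !s') :: c) := .rel _ _ (.turn e s s' a b c)

/-- A negative chord can be isolated. -/
theorem isolate (e : ℕ) (s : Bool) (p q : List Mark) :
    WordEq (some (e, s) :: p ++ some (e, !s) :: q)
      (some (e, s) :: some (e, !s) :: (flipWord q ++ p)) := by
  have h : WordEq _ _ := .rel _ _ (.twist e s [] p [] q)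
  have h2 := cyc p (some (e, s) :: some (e, !s) :: flipWord q)
  simp only [List.append_assoc, List.cons_append, List.nil_append, flipWord_nil] at h h2 ⊢
  exact h.trans h2

/-- The twist with the other pair of segments empty reverses the other arc. Playing this against
`isolate` makes an isolated negative chord slidable. -/
theorem isolate' (e : ℕ) (s : Bool) (p q : List Mark) :
    WordEq (some (e, s) :: p ++ some (e, !s) :: q)
      (some (e, s) :: some (e, !s) :: (q ++ flipWord p)) := by
  have h : WordEq _ _ := .rel _ _ (.twist e s q [] p [])
  have h1 := cyc (some (e, s) :: p ++ [some (e, !s)]) q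
  have h2 := cyc (some (e, s) :: q ++ flipWord p) [some (e, !s)]
  have h3 := turn e (!s) s [] [] (q ++ flipWord p)
  simp only [List.append_assoc, List.cons_append, List.nil_append, flipWord_nil, Bool.not_not,
    List.append_nil] at *
  exact ((h1.trans h).trans h2).trans h3

/-- `p` can be moved along the rest of the circle. -/
def _root_.Slidable (p : List Mark) : Prop :=
  ∀ a b, WordEq (p ++ (a ++ b)) (p ++ (b ++ a))

theorem slidable_pos (e : ℕ) (s : Bool) : Slidable [some (e, s), some (e, s)] := by
  intro a b
  have h := rot e s b [] [] a
  simpa only [List.cons_append, List.nil_append] using h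

theorem slidable_neg (e : ℕ) (s : Bool) : Slidable [some (e, s), some (e, !s)] := by
  -- Two ways of isolating the same chord reverse `a` and `b` in place. A second use, on the whole
  -- rest at once, undoes both reversals and exchanges the two words.
  have key (a b) : WordEq (some (e, s) :: some (e, !s) :: (a ++ b))
      (some (e, s) :: some (e, !s) :: (flipWord a ++ flipWord b)) := by
    have h := (isolate e s b (flipWord a)).symm.trans (isolate' e s b (flipWord a))
    rwa [flipWord_flipWord] at h
  intro a b
  have h := key (flipWord a ++ flipWord b) []
  rw [List.append_nil] at h
  simpa using (key a b).trans h

/-- Two positive chords that meet can be brought together. -/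
theorem link (e f : ℕ) (s t : Bool) (p q : List Mark) :
    WordEq (some (e, s) :: some (f, t) :: p ++ some (e, s) :: some (f, t) :: q)
      (some (e, s) :: some (f, t) :: some (e, s) :: some (f, t) :: (q ++ p)) := by
  have h1 := cyc [some (e, s)] (some (f, t) :: p ++ some (e, s) :: some (f, t) :: q)
  have h2 := rot f t [] p [some (e, s)] (q ++ [some (e, s)])
  have h3 := cyc (some (f, t) :: some (e, s) :: p ++ some (f, t) :: q) [some (e, s)]
  have h4 := rot e s (some (f, t) :: q) [some (f, t)] [] p
  simp only [List.append_assoc, List.cons_append, List.nil_append, List.append_nil] at *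
  exact ((h1.trans h2).trans h3).trans h4

theorem slidable_handle (e f : ℕ) (s t : Bool) :
    Slidable [some (e, s), some (f, t), some (e, s), some (f, t)] := by
  intro a b
  have h1 := rot e s b [some (f, t)] [] (some (f, t) :: a)
  have h2 := cyc [some (e, s)] (some (f, t) :: some (e, s) :: b ++ some (f, t) :: a)
  have h3 := rot f t [some (e, s)] [some (e, s)] b a
  have h4 := cyc (some (f, t) :: b ++ [some (e, s), some (f, t)]) (some (e, s) :: a)
  have h5 := rot e s [] a (some (f, t) :: b) [some (f, t)]
  have h6 := link e f s t (b ++ a) []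
  simp only [List.append_assoc, List.cons_append, List.nil_append, List.append_nil] at *
  exact ((((h1.trans h2).trans h3).trans h4).trans h5).trans h6

end WordEq

namespace WordEq

/-- Equivalences persist next to a slidable word. -/
theorem append_left {p w w' : List Mark} (hp : Slidable p) (h : WordEq w w') :
    WordEq (p ++ w) (p ++ w') := by
  induction h with
  | refl => exact .refl _
  | symm _ _ _ ih => exact ih.symm
  | trans _ _ _ _ _ ih ih' => exact ih.trans ih'
  | rel _ _ h =>
    cases h with
    | cyc a b => exact hp a b
    -- `p` is absorbed into the segment `a`. The rotation leaves it in the middle; a change of base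
    -- point puts it first, and sliding moves the marks that had preceded it back to the front of
    -- the rest.
    | rot e s a b c d =>
      have h1 : WordEq _ _ := .rel _ _ (.rot e s (p ++ a) b c d)
      have h2 := cyc (b ++ [some (e, s)]) (p ++ (a ++ (d ++ some (e, s) :: c)))
      have h3 := hp (a ++ (d ++ some (e, s) :: c)) (b ++ [some (e, s)])
      simp only [List.append_assoc, List.cons_append, List.nil_append] at *
      exact (h1.trans h2).trans h3
    | twist e s a b c d =>
      have h1 : WordEq _ _ := .rel _ _ (.twist e s (p ++ a) b c d)
      have h2 := cyc (b ++ [some (e, s)])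
        (p ++ (a ++ (flipWord c ++ some (e, !s) :: flipWord d)))
      have h3 := hp (a ++ (flipWord c ++ some (e, !s) :: flipWord d)) (b ++ [some (e, s)])
      simp only [List.append_assoc, List.cons_append, List.nil_append] at *
      exact (h1.trans h2).trans h3
    | slide a b =>
      have h1 := slide (p ++ a) b
      have h2 := (slide p (a ++ b)).symm
      simp only [List.append_assoc] at *
      exact h1.trans h2
    | turn e s s' a b c =>
      have h1 := turn e s s' (p ++ a) b c
      simp only [List.append_assoc] at *
      exact h1

/-- Half-chords can be collected. -/
theorem slide_all (a b : List Mark) (n : ℕ) :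
    WordEq (a ++ List.replicate n none ++ b) (List.replicate n none ++ (a ++ b)) := by
  induction n generalizing a with
  | zero => simpa using refl _
  | succ n ih =>
    have h := slide a (List.replicate n none ++ b)
    have h2 := ih (none :: a)
    have h3 := (slide (List.replicate n none) (a ++ b))
    simp only [List.replicate_succ, List.append_assoc, List.cons_append] at *
    exact (h.trans h2).trans h3

end WordEq

/-! ### Splitting off pieces, and the normal form of a word. -/

theorem eq_replicate_none {w : List Mark} (h : labels w = []) :
    w = List.replicate w.length none := by
  rw [List.eq_replicate_iff]
  refine ⟨rfl, fun m hm => ?_⟩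
  rcases m with _ | ⟨e, d⟩
  · rfl
  · have := mem_labels.2 ⟨d, hm⟩
    simp [h] at this

/-- The words with one chord, or with two positive chords that meet. -/
inductive IsPiece : List Mark → Prop
  | pos (e) : IsPiece [some (e, true), some (e, true)]
  | neg (e) : IsPiece [some (e, true), some (e, false)]
  | handle (e f) (h : e ≠ f) :
      IsPiece [some (e, true), some (f, true), some (e, true), some (f, true)]

theorem IsPiece.slidable {p : List Mark} (h : IsPiece p) : Slidable p := by
  cases h with
  | pos e => exact WordEq.slidable_pos e true
  | neg e => exact WordEq.slidable_neg e true
  | handle e f => exact WordEq.slidable_handle e f true true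

theorem IsPiece.twice {p : List Mark} (h : IsPiece p) : Twice (labels p) := by
  cases h with
  | pos e => intro f hf; simp at hf; simp [hf]
  | neg e => intro f hf; simp at hf; simp [hf]
  | handle e f h =>
    intro g hg
    simp only [labels_cons_some, labels_nil, List.mem_cons, List.not_mem_nil, or_false] at hg
    have : g = e ∨ g = f := by tauto
    rcases this with rfl | rfl <;> simp [h, h.symm]

/-- The two arrows of an isolated chord can be reversed. -/
theorem WordEq.turn_pair (e : ℕ) (s d d' : Bool) (w : List Mark) :
    WordEq (some (e, d) :: some (e, d ^^ s) :: w) (some (e, d') :: some (e, d' ^^ s) :: w) := by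
  rcases Bool.eq_or_eq_not d' d with rfl | rfl
  · exact refl _
  · simpa using turn e d (d ^^ s) [] [] w

theorem WordEq.turn_handle (e f : ℕ) (s t : Bool) (w : List Mark) :
    WordEq (some (e, s) :: some (f, t) :: some (e, s) :: some (f, t) :: w)
      (some (e, true) :: some (f, true) :: some (e, true) :: some (f, true) :: w) := by
  have h1 := turn e s s [] [some (f, t)] (some (f, t) :: w)
  have h2 (s) := turn f t t [some (e, s)] [some (e, s)] w
  simp only [List.cons_append, List.nil_append] at h1 h2
  cases s <;> cases t
  · exact h1.trans (h2 true)
  · exact h1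
  · exact h2 true
  · exact refl _

theorem exists_split {w : List Mark} {e : ℕ} (h : e ∈ labels w) :
    ∃ s x y, w = x ++ some (e, s) :: y := by
  obtain ⟨d, hd⟩ := mem_labels.1 h
  obtain ⟨x, y, rfl⟩ := List.append_of_mem hd
  exact ⟨d, x, y, rfl⟩

theorem exists_split_two {w : List Mark} {e : ℕ} (h : (labels w).count e = 2) :
    ∃ s s' x y z, w = x ++ some (e, s) :: (y ++ some (e, s') :: z) := by
  induction w with
  | nil => simp at h
  | cons m w ih =>
    rcases m with _ | ⟨f, d⟩
    · obtain ⟨s, s', x, y, z, rfl⟩ := ih (by simpa using h)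
      exact ⟨s, s', none :: x, y, z, rfl⟩
    · by_cases hf : f = e
      · subst hf
        obtain ⟨s', y, z, rfl⟩ := exists_split (w := w) (e := f) (by
          rw [← List.count_pos_iff]; simp at h; omega)
        exact ⟨d, s', [], y, z, rfl⟩
      · obtain ⟨s, s', x, y, z, rfl⟩ := ih (by simpa [List.count_cons, hf] using h)
        exact ⟨s, s', some (f, d) :: x, y, z, rfl⟩

theorem WordEq.extract_neg (e : ℕ) (s : Bool) (x y z : List Mark) :
    ∃ w, WordEq (x ++ some (e, s) :: (y ++ some (e, !s) :: z)) ([some (e, true), some (e, false)] ++ w) := by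
  have h1 := cyc x (some (e, s) :: (y ++ some (e, !s) :: z))
  have h2 := isolate e s y (z ++ x)
  simp only [List.append_assoc, List.cons_append, List.nil_append] at *
  have h3 := turn_pair e true s true (flipWord x ++ flipWord z ++ y)
  simp only [flipWord_append, List.append_assoc, Bool.xor_true, Bool.not_true] at h2 h3
  exact ⟨_, (h1.trans h2).trans h3⟩

theorem WordEq.extract_handle (e f : ℕ) (s t : Bool) (x y z u v : List Mark) :
    ∃ w, WordEq (x ++ some (e, s) :: (y ++ some (f, t) :: (z ++ some (e, s) ::
        (u ++ some (f, t) :: v))))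
      ([some (e, true), some (f, true), some (e, true), some (f, true)] ++ w) := by
  have h1 := cyc x (some (e, s) :: (y ++ some (f, t) :: (z ++ some (e, s) ::
        (u ++ some (f, t) :: v))))
  have h2 := rot e s (some (f, t) :: (v ++ x)) y (some (f, t) :: z) u
  have h3 := link e f s t (z ++ y) (v ++ x ++ u)
  simp only [List.append_assoc, List.cons_append, List.nil_append] at *
  exact ⟨_, ((h1.trans h2).trans h3).trans (turn_handle e f s t _)⟩

/-- A negative chord can be isolated at once. A positive chord with only half-chords under it is a
piece. Otherwise a chord `f` has an end under it: if both ends lie there, recurse on the shorter arc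
of `f`; if only one does, `e` and `f` intersect, and either `f` is negative or the two form a
handle. -/
theorem exists_isPiece (n : ℕ) : ∀ (e : ℕ) (s s' : Bool) (x y z : List Mark), y.length ≤ n →
    Twice (labels (x ++ some (e, s) :: (y ++ some (e, s') :: z))) →
    ∃ p w, IsPiece p ∧ WordEq (x ++ some (e, s) :: (y ++ some (e, s') :: z)) (p ++ w) := by
  induction n using Nat.strong_induction_on with
  | _ n ih =>
  intro e s s' x y z hy h2
  have hs : s' = s ∨ s' = !s := by cases s <;> cases s' <;> simp
  rcases hs with rfl | rfl
  swap
  · obtain ⟨w, hw⟩ := WordEq.extract_neg e s x y z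
    exact ⟨_, w, .neg e, hw⟩
  by_cases hl : labels y = []
  · rw [eq_replicate_none hl]
    have h1 := WordEq.cyc x (some (e, s') :: (List.replicate y.length none ++ some (e, s') :: z))
    have h3 := WordEq.slide_all [some (e, s')] (some (e, s') :: (z ++ x)) y.length
    have h4 := WordEq.cyc (List.replicate y.length none) (some (e, s') :: some (e, s') :: (z ++ x))
    have h5 := WordEq.turn_pair e false s' true (z ++ (x ++ List.replicate y.length none))
    simp only [List.append_assoc, List.cons_append, List.nil_append, Bool.xor_false] at *
    exact ⟨_, _, .pos e, ((h1.trans h3).trans h4).trans h5⟩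
  · obtain ⟨f, hf⟩ := List.exists_mem_of_ne_nil _ hl
    have hcf := h2 f (by simp [hf])
    have hce := h2 e (by simp)
    simp only [labels_append, labels_cons_some, List.count_append, List.count_cons] at hcf hce
    have hef : e ≠ f := by
      rintro rfl
      have := List.count_pos_iff.2 hf
      simp at hce
      omega
    simp only [beq_iff_eq, hef, if_false] at hcf
    by_cases hfy : (labels y).count f = 2
    · obtain ⟨t, t', y1, y2, y3, rfl⟩ := exists_split_two hfy
      have := ih y2.length (by simp at hy; omega) f t t' (x ++ some (e, s') :: y1) y2
        (y3 ++ some (e, s') :: z) le_rfl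
      simp only [List.append_assoc, List.cons_append] at *
      exact this h2
    · obtain ⟨t, y1, y2, rfl⟩ := exists_split hf
      have := List.count_pos_iff.2 hf
      have hxz : f ∈ labels x ∨ f ∈ labels z := by
        rw [← List.count_pos_iff, ← List.count_pos_iff]; omega
      rcases hxz with hx | hz
      · obtain ⟨t', x1, x2, rfl⟩ := exists_split hx
        have ht : t = t' ∨ t = !t' := by cases t <;> cases t' <;> simp
        rcases ht with rfl | rfl
        · obtain ⟨w, hw⟩ := WordEq.extract_handle f e t s' x1 x2 y1 y2 z
          simp only [List.append_assoc, List.cons_append, List.nil_append] at *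
          exact ⟨_, w, .handle f e hef.symm, hw⟩
        · obtain ⟨w, hw⟩ := WordEq.extract_neg f t' x1 (x2 ++ some (e, s') :: y1) (y2 ++ some (e, s') :: z)
          simp only [List.append_assoc, List.cons_append, List.nil_append] at *
          exact ⟨_, w, .neg f, hw⟩
      · obtain ⟨t', z1, z2, rfl⟩ := exists_split hz
        have ht : t' = t ∨ t' = !t := by cases t <;> cases t' <;> simp
        rcases ht with rfl | rfl
        · obtain ⟨w, hw⟩ := WordEq.extract_handle e f s' t' x y1 y2 z1 z2
          simp only [List.append_assoc, List.cons_append, List.nil_append] at *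
          exact ⟨_, w, .handle e f hef, hw⟩
        · obtain ⟨w, hw⟩ := WordEq.extract_neg f t (x ++ some (e, s') :: y1) (y2 ++ some (e, s') :: z1) z2
          simp only [List.append_assoc, List.cons_append, List.nil_append] at *
          exact ⟨_, w, .neg f, hw⟩

/-- A pair of intersecting positive chords next to a negative one can be traded for two negative
chords. -/
theorem WordEq.trade (e f g : ℕ) (w : List Mark) :
    WordEq ([some (e, true), some (e, false), some (f, true), some (f, false), some (g, true),
        some (g, false)] ++ w)
      ([some (e, true), some (f, true), some (e, true), some (f, true), some (g, true),
        some (g, false)] ++ w) := by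
  have h0 := turn_handle e f false false (some (g, true) :: some (g, false) :: w)
  have h1 := cyc [some (e, false), some (f, false), some (e, false), some (f, false)]
    (some (g, true) :: some (g, false) :: w)
  -- Undoing the isolation of `g` with one end of `f` under it makes `f` negative. Isolating `f`
  -- reverses one end of `e`, making `e` negative too; isolating `e` and then `g` separates the
  -- three negative chords.
  have h2 := isolate' g true [some (f, true)] (w ++ [some (e, false), some (f, false),
    some (e, false)])
  have h3 := cyc [some (g, true)]
    (some (f, true) :: some (g, false) :: (w ++ [some (e, false), some (f, false), some (e, false)]))
  have h4 := isolate f true (some (g, false) :: (w ++ [some (e, false)]))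
    [some (e, false), some (g, true)]
  have h5 := cyc [some (f, true), some (f, false), some (g, false)]
    (some (e, true) :: some (g, false) :: (w ++ [some (e, false)]))
  have h6 := isolate e true (some (g, false) :: w) [some (f, true), some (f, false), some (g, false)]
  have h7 := cyc [some (e, true), some (e, false)]
    (some (g, true) :: some (f, true) :: some (f, false) :: some (g, false) :: w)
  have h8 := isolate' g true [some (f, true), some (f, false)] (w ++ [some (e, true),
    some (e, false)])
  have h9 := cyc (some (g, true) :: some (g, false) :: w)
    [some (e, true), some (e, false), some (f, true), some (f, false)]
  simp only [List.append_assoc, List.cons_append, List.nil_append, flipWord_cons,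
    flipWord_nil, flip_some, Bool.not_true, Bool.not_false] at *
  exact (((((((((h0.symm.trans h1).trans h2.symm).trans h3).trans h4).trans h5).trans h6).trans
    h7).trans h8).trans h9).symm

/-- Sums of positive chords, of pairs of intersecting positive chords, of negative chords and of
half-chords. -/
def sumWord (p : List ℕ) (h : List (ℕ × ℕ)) (n : List ℕ) (l : ℕ) : List Mark :=
  p.flatMap (fun a => [some (a, true), some (a, true)]) ++
  h.flatMap (fun a => [some (a.1, true), some (a.2, true), some (a.1, true), some (a.2, true)]) ++
  n.flatMap (fun a => [some (a, true), some (a, false)]) ++ List.replicate l none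

/-- A piece is moved to the front and the rest is normalized beside it, which is legitimate because
pieces are slidable. The bound two on negative chords comes from `WordEq.trade`. -/
theorem exists_wordEq_sumWord (N : ℕ) : ∀ w : List Mark, (labels w).length ≤ N → Twice (labels w) →
    ∃ p h n l, n.length ≤ 2 ∧ WordEq w (sumWord p h n l) := by
  induction N using Nat.strong_induction_on with
  | _ N ih =>
  intro w hN hw
  by_cases hl : labels w = []
  · refine ⟨[], [], [], w.length, by simp, ?_⟩
    rw [eq_replicate_none hl]
    simpa [sumWord] using WordEq.refl _
  obtain ⟨e, he⟩ := List.exists_mem_of_ne_nil _ hl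
  obtain ⟨s, s', x, y, z, hwe⟩ := exists_split_two (hw e he)
  obtain ⟨q, w', hq, hqw⟩ := exists_isPiece _ e s s' x y z le_rfl (hwe ▸ hw)
  rw [← hwe] at hqw
  have hp := WordEq.labels_perm hqw
  rw [labels_append] at hp
  have hw' := hw.of_perm hp
  have hlen := hp.length_eq
  rw [List.length_append] at hlen
  have hq0 : 0 < (labels q).length := by cases hq <;> simp
  obtain ⟨p, h, n, l, hn, hpw⟩ := ih (labels w').length (by omega) w' le_rfl (hw'.right hq.twice)
  have key := hqw.trans (hpw.append_left hq.slidable)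
  have move (X Y : List Mark) : WordEq (q ++ (X ++ Y)) (X ++ q ++ Y) := by
    have h1 := hq.slidable X Y
    have h2 := WordEq.cyc (q ++ Y) X
    simp only [List.append_assoc] at *
    exact h1.trans h2
  have hsl := hq.slidable
  cases hq with
  | pos e => exact ⟨e :: p, h, n, l, hn, by simpa [sumWord] using key⟩
  | handle e f hef =>
    refine ⟨p, (e, f) :: h, n, l, hn, key.trans ?_⟩
    have := move (sumWord p [] [] 0) (sumWord [] h n l)
    simpa [sumWord] using this
  | neg e =>
    by_cases hn2 : n.length ≤ 1
    · refine ⟨p, h, e :: n, l, by simp; omega, key.trans ?_⟩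
      have := move (sumWord p h [] 0) (sumWord [] [] n l)
      simpa [sumWord] using this
    -- With a third negative chord, two of the three become an intersecting positive pair and a
    -- single negative chord is left.
    · obtain ⟨f, g, rfl⟩ := List.length_eq_two.1 (by omega : n.length = 2)
      refine ⟨p, h ++ [(e, f)], [g], l, by simp, key.trans ?_⟩
      have h1 := hsl (sumWord p h [] 0) (sumWord [] [] [f, g] l)
      have h2 := WordEq.trade e f g (List.replicate l none ++ sumWord p h [] 0)
      have h3 := WordEq.cyc (sumWord [] [(e, f)] [g] l) (sumWord p h [] 0)
      simp only [sumWord, List.append_assoc, List.cons_append, List.nil_append, List.append_nil,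
        List.flatMap_cons, List.flatMap_nil, List.flatMap_append, List.replicate_zero] at *
      exact (h1.trans h2).trans h3

/-! ### Renaming edges to reach the canonical diagrams. -/

/-- The labels of the chords of a sum. -/
def sumLabels (p : List ℕ) (h : List (ℕ × ℕ)) (n : List ℕ) : List ℕ :=
  p ++ h.flatMap (fun a => [a.1, a.2]) ++ n

theorem count_labels_sumWord (p : List ℕ) (h : List (ℕ × ℕ)) (n : List ℕ) (l e : ℕ) :
    (labels (sumWord p h n l)).count e = 2 * (sumLabels p h n).count e := by
  have h1 : labels (List.replicate l none) = [] := by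
    induction l with
    | zero => rfl
    | succ l ih => simpa [List.replicate_succ] using ih
  have h2 : (labels (p.flatMap (fun a => [some (a, true), some (a, true)]))).count e =
      2 * p.count e := by
    induction p with
    | nil => rfl
    | cons a p ih => simp only [List.flatMap_cons, labels_append, List.count_append, ih,
        labels_cons_some, labels_nil, List.count_cons, List.count_nil]; omega
  have h3 : (labels (h.flatMap (fun a => [some (a.1, true), some (a.2, true), some (a.1, true),
      some (a.2, true)]))).count e = 2 * (h.flatMap (fun a => [a.1, a.2])).count e := by
    induction h with
    | nil => rfl
    | cons a p ih => simp only [List.flatMap_cons, labels_append, List.count_append, ih,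
        labels_cons_some, labels_nil, List.count_cons, List.count_nil]; omega
  have h4 : (labels (n.flatMap (fun a => [some (a, true), some (a, false)]))).count e =
      2 * n.count e := by
    induction n with
    | nil => rfl
    | cons a p ih => simp only [List.flatMap_cons, labels_append, List.count_append, ih,
        labels_cons_some, labels_nil, List.count_cons, List.count_nil]; omega
  simp only [sumWord, sumLabels, labels_append, List.count_append, h1, h2, h3, h4, List.count_nil]
  omega

theorem nodup_sumLabels {p : List ℕ} {h : List (ℕ × ℕ)} {n : List ℕ} {l : ℕ}
    (ht : Twice (labels (sumWord p h n l))) : (sumLabels p h n).Nodup := by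
  rw [List.nodup_iff_count_le_one]
  intro e
  by_cases he : e ∈ labels (sumWord p h n l)
  · have := ht e he
    rw [count_labels_sumWord] at this
    omega
  · have := List.count_eq_zero.2 he
    rw [count_labels_sumWord] at this
    omega

theorem sumWord_relabel (f : ℕ → ℕ) (p : List ℕ) (h : List (ℕ × ℕ)) (n : List ℕ) (l : ℕ) :
    (sumWord p h n l).map (Mark.relabel f) =
      sumWord (p.map f) (h.map (Prod.map f f)) (n.map f) l := by
  simp [sumWord, List.map_flatMap, List.flatMap_map]

/-- The permutation found for the tails is corrected by one transposition, which fixes all values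
already placed. -/
theorem exists_perm_map_eq {l l' : List ℕ} (h : l.Nodup) (h' : l'.Nodup)
    (hl : l.length = l'.length) : ∃ f : Equiv.Perm ℕ, l.map f = l' := by
  induction l generalizing l' with
  | nil => exact ⟨1, by simpa using hl.symm⟩
  | cons a l ih =>
    rcases l' with _ | ⟨b, l'⟩
    · simp at hl
    rw [List.nodup_cons] at h h'
    obtain ⟨f, rfl⟩ := ih h.2 h'.2 (by simpa using hl)
    refine ⟨Equiv.swap (f a) b * f, ?_⟩
    simp only [List.map_cons, Equiv.Perm.mul_apply, Equiv.swap_apply_left, List.cons.injEq, true_and]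
    refine List.map_congr_left fun x hx => Equiv.swap_apply_of_ne_of_ne ?_ ?_
    · exact f.injective.ne (ne_of_mem_of_not_mem hx h.1)
    · exact ne_of_mem_of_not_mem (List.mem_map_of_mem hx) h'.1

theorem length_flatMap_pair (h : List (ℕ × ℕ)) :
    (h.flatMap fun a => [a.1, a.2]).length = 2 * h.length := by
  induction h with
  | nil => rfl
  | cons a h ih => simp [ih]; omega

theorem flatMap_pair_injective {h h' : List (ℕ × ℕ)}
    (H : (h.flatMap fun a => [a.1, a.2]) = h'.flatMap fun a => [a.1, a.2]) : h = h' := by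
  induction h generalizing h' with
  | nil => rcases h' with _ | ⟨b, h'⟩ <;> simp_all
  | cons a h ih =>
    rcases h' with _ | ⟨b, h'⟩
    · simp at H
    · simp only [List.flatMap_cons, List.cons_append, List.nil_append, List.cons.injEq] at H
      rw [ih H.2.2, Prod.ext H.1 H.2.1]

theorem canonWord_eq_sumWord (i j k l : ℕ) :
    HERG.canonWord i j k l = sumWord (List.range (i - 2 * j - k))
      ((List.range j).map fun m => (i + 2 * m, i + 2 * m + 1))
      ((List.range k).map fun m => i + 2 * j + m) l := by
  simp [HERG.canonWord, sumWord, List.flatMap_map]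

/-- Every chord diagram is equivalent to a canonical one. -/
theorem exists_rEquivalent_canon (w : List Mark) (hw : Twice (labels w)) :
    ∃ i j k l, 2 * j + k ≤ i ∧ k ≤ 2 ∧
      REquivalent (bouquet w hw).cls (HERG.canon i j k l).cls := by
  obtain ⟨p, h, n, l, hn, hE⟩ := exists_wordEq_sumWord _ w le_rfl hw
  refine ⟨p.length + 2 * h.length + n.length, h.length, n.length, l, by omega, hn, ?_⟩
  have h1 := hE.rEquivalent hw
  have ht := hw.of_perm (WordEq.labels_perm hE)
  have hc : Twice (labels (HERG.canonWord (p.length + 2 * h.length + n.length) h.length n.length l)) := by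
    simpa [Twice] using HERG.canonWord_two (p.length + 2 * h.length + n.length) h.length n.length l
  have hc' := hc
  rw [canonWord_eq_sumWord] at hc'
  -- Each chord is listed once in `sumLabels`, so sums with equally many pieces of each kind differ
  -- by a renaming.
  obtain ⟨f, hf⟩ := exists_perm_map_eq (nodup_sumLabels ht) (nodup_sumLabels hc') (by
    simp only [sumLabels, List.length_append, length_flatMap_pair, List.length_map,
      List.length_range]; omega)
  have hcls : (bouquet _ ht).cls = (HERG.canon (p.length + 2 * h.length + n.length) h.length n.length l).cls := by
    apply HERG.cls_eq
    have := HERGMove.relabel f [sumWord p h n l]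
    simp only [List.map_cons, List.map_nil, sumWord_relabel] at this
    have e1 : sumLabels (p.map f) (h.map (Prod.map f f)) (n.map f) = (sumLabels p h n).map f := by
      simp [sumLabels, List.map_flatMap, List.flatMap_map]
    rw [hf] at e1
    obtain ⟨e2, e3⟩ := List.append_inj' e1 (by simp)
    obtain ⟨e4, e5⟩ := List.append_inj' e2 (by simp only [length_flatMap_pair, List.length_map,
      List.length_range])
    rw [flatMap_pair_injective e5, e3, e4] at this
    simpa only [HERG.canon, canonWord_eq_sumWord, bouquet] using this
  rw [← hcls]
  exact h1

/-! ### State sums -/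

/-- Two by two matrices. -/
abbrev Mat : Type := Matrix (Fin 2) (Fin 2) ℚ

/-- The reflections that test whether a matrix is scalar. -/
def reflection : Fin 2 → Mat := ![!![0, 1; 1, 0], !![1, 0; 0, -1]]

/-- Local weights of a state sum over the edges of arrow presentations. -/
structure StateModel where
  Φ : Type
  fintype : Fintype Φ
  inhabited : Inhabited Φ
  w : Φ → ℚ
  P : Φ → Mat
  η : Φ → ℚ
  -- The matrices that words can take. The trace identities below hold for all matrices in the
  -- boundary model but are only required of diagonal ones in the sign models.
  S : Submonoid Mat
  K : Mat
  K' : Mat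
  sgn : Fin 2 → Φ → ℚ
  K_mul : K * K' = 1
  mul_K : K' * K = 1
  sum_w : ∑ x, w x = 1
  eta_mul : ∀ x, η x * η x = 1
  mem : ∀ x, P x ∈ S
  smul_mem : ∀ x, η x • P x ∈ S
  -- The anti-automorphism `a ↦ K * aᵀ * K'` represents reading a word backwards.
  star_P : ∀ x, K * (P x).transpose * K' = η x • P x
  contract : ∀ a ∈ S, ∀ b ∈ S, ∑ x, w x * ((P x * a).trace * (P x * b).trace) = (a * b).trace
  rot : ∀ a ∈ S, ∀ b ∈ S, ∀ c ∈ S, ∀ d ∈ S, ∑ x, w x * (a * P x * b * c * P x * d).trace =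
    ∑ x, w x * (b * P x * a * d * P x * c).trace
  twist : ∀ a ∈ S, ∀ b ∈ S, ∀ c ∈ S, ∀ d ∈ S,
    ∑ x, w x * η x * (a * P x * b * c * P x * d).trace =
    ∑ x, w x * η x *
      (b * P x * a * (K * c.transpose * K') * P x * (K * d.transpose * K')).trace
  -- Labels commute with the reflections up to sign, and the signs cancel when both ends of every
  -- edge lie in the same part; this makes closed words scalar.
  comm : ∀ i x, reflection i * P x = sgn i x • (P x * reflection i)
  sgn_mul : ∀ i x, sgn i x * sgn i x = 1

namespace StateModel

attribute [instance] fintype inhabited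

variable (m : StateModel)

/-- Extension of a labelling by a default value. -/
def extend (A : Finset ℕ) (φ : A → m.Φ) : ℕ → m.Φ := fun n => if h : n ∈ A then φ ⟨n, h⟩ else default

/-- Weighted sum over the labellings of `A`. -/
def avg (A : Finset ℕ) (f : (ℕ → m.Φ) → ℚ) : ℚ :=
  ∑ φ : A → m.Φ, (∏ e, m.w (φ e)) * f (m.extend A φ)

theorem avg_empty (f : (ℕ → m.Φ) → ℚ) : m.avg ∅ f = f default := by
  simp only [avg, Finset.univ_eq_empty, Finset.prod_empty, one_mul, Finset.univ_unique,
    Finset.sum_singleton]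
  congr 1

theorem avg_insert {A : Finset ℕ} {a : ℕ} (ha : a ∉ A) (f : (ℕ → m.Φ) → ℚ) :
    m.avg (insert a A) f = ∑ x, m.w x * m.avg A fun φ => f (Function.update φ a x) := by
  simp only [avg, Finset.mul_sum]
  rw [← Fintype.sum_prod_type']
  refine Fintype.sum_bijective (fun φ => (φ ⟨a, by simp⟩, fun e => φ ⟨e, by simp [e.2]⟩)) ?_ _ _ ?_
  · refine ⟨fun φ ψ h => ?_, fun ⟨x, ψ⟩ => ⟨fun e => if h : e.1 ∈ A then ψ ⟨e, h⟩ else x, ?_⟩⟩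
    · simp only [Prod.mk.injEq] at h
      ext ⟨e, he⟩
      rcases Finset.mem_insert.1 he with rfl | he'
      · exact h.1
      · exact congrFun h.2 ⟨e, he'⟩
    · simp [ha]
  · intro φ
    dsimp only
    rw [← mul_assoc]
    congr 1
    · rw [Finset.univ_eq_attach, Finset.univ_eq_attach, Finset.attach_insert,
        Finset.prod_insert (by simp [ha])]
      congr 1
      exact Finset.prod_image fun x _ y _ h => Subtype.ext (Subtype.mk.inj h)
    · refine congrArg f (funext fun n => ?_)
      by_cases hn : n = a
      · subst hn; simp [extend]
      · by_cases hA : n ∈ A <;> simp [extend, hn, hA]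

theorem avg_congr {A : Finset ℕ} {f g : (ℕ → m.Φ) → ℚ} (h : ∀ φ, f φ = g φ) :
    m.avg A f = m.avg A g := by
  rw [show f = g from funext h]

theorem avg_mul_left (A : Finset ℕ) (c : ℚ) (f : (ℕ → m.Φ) → ℚ) :
    m.avg A (fun φ => c * f φ) = c * m.avg A f := by
  simp only [avg, Finset.mul_sum]
  exact Finset.sum_congr rfl fun _ _ => by ring

theorem avg_sum (A : Finset ℕ) {ι : Type*} [Fintype ι] (f : ι → (ℕ → m.Φ) → ℚ) :
    m.avg A (fun φ => ∑ i, f i φ) = ∑ i, m.avg A (f i) := by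
  simp only [avg, Finset.mul_sum]
  exact Finset.sum_comm

/-- `f` depends only on the labels of the members of `A`. -/
def DependsOnly (A : Finset ℕ) (f : (ℕ → m.Φ) → ℚ) : Prop :=
  ∀ φ ψ : ℕ → m.Φ, (∀ e ∈ A, φ e = ψ e) → f φ = f ψ

theorem avg_union_mul {A B : Finset ℕ} (hAB : Disjoint A B) {f g : (ℕ → m.Φ) → ℚ}
    (hf : m.DependsOnly A f) (hg : m.DependsOnly B g) :
    m.avg (A ∪ B) (fun φ => f φ * g φ) = m.avg A f * m.avg B g := by
  induction A using Finset.induction_on generalizing f with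
  | empty =>
    rw [Finset.empty_union, avg_empty, ← avg_mul_left]
    exact m.avg_congr fun φ => by rw [hf φ default (by simp)]
  | insert a A ha ih =>
    rw [Finset.disjoint_insert_left] at hAB
    rw [Finset.insert_union, avg_insert, avg_insert _ ha, Finset.sum_mul]
    swap
    · simp [ha, hAB.1]
    refine Finset.sum_congr rfl fun x _ => ?_
    rw [mul_assoc, ← ih hAB.2]
    · congr 1
      refine m.avg_congr fun φ => ?_
      rw [hg (Function.update φ a x) φ fun e he =>
        Function.update_of_ne (ne_of_mem_of_not_mem he hAB.1) _ _]
    · intro φ ψ h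
      refine hf _ _ fun e he => ?_
      by_cases hea : e = a
      · simp [hea]
      · simp [hea, h e ((Finset.mem_insert.1 he).resolve_left hea)]

theorem avg_one (A : Finset ℕ) : m.avg A (fun _ => 1) = 1 := by
  induction A using Finset.induction_on with
  | empty => rw [avg_empty]
  | insert a A ha ih => simp [avg_insert _ ha, ih, m.sum_w]

/-- Superfluous labels contribute a factor one because the weights sum to one. -/
theorem avg_eq_of_subset {A B : Finset ℕ} (h : B ⊆ A) {f : (ℕ → m.Φ) → ℚ}
    (hf : m.DependsOnly B f) : m.avg A f = m.avg B f := by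
  have := m.avg_union_mul (A := B) (B := A \ B) Finset.disjoint_sdiff hf (g := fun _ => 1)
    (fun _ _ _ => rfl)
  rw [Finset.union_sdiff_of_subset h, avg_one] at this
  simpa using this

theorem avg_map (A : Finset ℕ) (s : Equiv.Perm ℕ) (f : (ℕ → m.Φ) → ℚ) :
    m.avg (A.map s.toEmbedding) f = m.avg A (fun φ => f (φ ∘ s.symm)) := by
  induction A using Finset.induction_on generalizing f with
  | empty => simp only [Finset.map_empty, avg_empty]; rfl
  | insert a A ha ih =>
    rw [Finset.map_insert, avg_insert _ (by simpa using ha), avg_insert _ ha]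
    refine Finset.sum_congr rfl fun x _ => ?_
    rw [ih]
    congr 1
    refine m.avg_congr fun φ => ?_
    congr 1
    ext n
    by_cases hn : n = s a
    · simp [hn]
    · have : s.symm n ≠ a := fun h => hn (by simp [← h])
      simp [hn, this]

/-- The matrix of a mark. -/
def mark (A : Finset ℕ) (φ : ℕ → m.Φ) : Mark → Mat
  | none => 1
  | some (e, d) => if e ∈ A then (if d then m.P (φ e) else m.η (φ e) • m.P (φ e)) else 1

/-- The matrix of a word. -/
def word (A : Finset ℕ) (φ : ℕ → m.Φ) (c : List Mark) : Mat := (c.map (m.mark A φ)).prod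

/-- The weight of a labelling. -/
def circ (A : Finset ℕ) (φ : ℕ → m.Φ) (L : List (List Mark)) : ℚ :=
  (L.map fun c => (m.word A φ c).trace).prod

/-- The state sum. -/
def Z (A : Finset ℕ) (L : List (List Mark)) : ℚ := m.avg A fun φ => m.circ A φ L

/-! ### State sums under moves, contraction, chord operations and joining. -/

variable {m} {A : Finset ℕ} {φ : ℕ → m.Φ}

@[simp] theorem mark_none : m.mark A φ none = 1 := rfl

@[simp] theorem word_nil : m.word A φ [] = 1 := rfl

@[simp] theorem word_cons (k : Mark) (c : List Mark) :
    m.word A φ (k :: c) = m.mark A φ k * m.word A φ c := by simp [word]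

@[simp] theorem word_append (a b : List Mark) :
    m.word A φ (a ++ b) = m.word A φ a * m.word A φ b := by simp [word]

@[simp] theorem circ_nil : m.circ A φ [] = 1 := rfl

@[simp] theorem circ_cons (c : List Mark) (L : List (List Mark)) :
    m.circ A φ (c :: L) = (m.word A φ c).trace * m.circ A φ L := by simp [circ]

@[simp] theorem circ_append (L L' : List (List Mark)) :
    m.circ A φ (L ++ L') = m.circ A φ L * m.circ A φ L' := by simp [circ]

theorem mark_mem (k : Mark) : m.mark A φ k ∈ m.S := by
  rcases k with _ | ⟨e, d⟩
  · exact one_mem _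
  · simp only [mark]
    split_ifs
    · exact m.mem _
    · exact m.smul_mem _
    · exact one_mem _

theorem word_mem (c : List Mark) : m.word A φ c ∈ m.S := by
  refine Submonoid.list_prod_mem _ fun x hx => ?_
  obtain ⟨k, -, rfl⟩ := List.mem_map.1 hx
  exact mark_mem k

theorem word_congr {B : Finset ℕ} {ψ : ℕ → m.Φ} {c : List Mark}
    (h : ∀ e ∈ labels c, (e ∈ A ↔ e ∈ B) ∧ (e ∈ A → φ e = ψ e)) :
    m.word A φ c = m.word B ψ c := by
  unfold word
  congr 1
  refine List.map_congr_left fun k hk => ?_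
  rcases k with _ | ⟨e, d⟩
  · rfl
  · obtain ⟨h1, h2⟩ := h e (mem_labels.2 ⟨d, hk⟩)
    by_cases hA : e ∈ A
    · simp [mark, hA, h1.1 hA, h2 hA]
    · have hB : e ∉ B := fun h => hA (h1.2 h)
      simp [mark, hA, hB]

theorem circ_congr {B : Finset ℕ} {ψ : ℕ → m.Φ} {L : List (List Mark)}
    (h : ∀ e ∈ edgeLabels L, (e ∈ A ↔ e ∈ B) ∧ (e ∈ A → φ e = ψ e)) :
    m.circ A φ L = m.circ B ψ L := by
  unfold circ
  congr 1
  refine List.map_congr_left fun c hc => ?_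
  rw [word_congr fun e he => h e (mem_edgeLabels.2 ⟨c, hc, he⟩)]

theorem dependsOnly_circ (A : Finset ℕ) (L : List (List Mark)) :
    m.DependsOnly (A ∩ (edgeLabels L).toFinset) fun φ => m.circ A φ L := by
  intro φ ψ h
  exact circ_congr fun e he => ⟨Iff.rfl, fun hA => h e (by simp [hA, he])⟩

/-- Only the edges that are present matter. -/
theorem Z_congr {A B : Finset ℕ} {L : List (List Mark)} (h : ∀ e ∈ edgeLabels L, e ∈ A ↔ e ∈ B) :
    m.Z A L = m.Z B L := by
  have hAB : A ∩ (edgeLabels L).toFinset = B ∩ (edgeLabels L).toFinset := by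
    ext e
    simp only [Finset.mem_inter, List.mem_toFinset]
    exact and_congr_left (h e)
  unfold Z
  rw [m.avg_eq_of_subset Finset.inter_subset_left (dependsOnly_circ A L),
    m.avg_eq_of_subset Finset.inter_subset_left (dependsOnly_circ B L), hAB]
  exact m.avg_congr fun φ => circ_congr fun e he => ⟨h e he, fun _ => rfl⟩

theorem Z_append {L L' : List (List Mark)} (h : ∀ e ∈ edgeLabels L, e ∉ edgeLabels L') :
    m.Z A (L ++ L') = m.Z A L * m.Z A L' := by
  unfold Z
  rw [m.avg_eq_of_subset Finset.inter_subset_left (dependsOnly_circ A L),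
    m.avg_eq_of_subset Finset.inter_subset_left (dependsOnly_circ A L'),
    m.avg_eq_of_subset Finset.inter_subset_left (dependsOnly_circ A (L ++ L')),
    ← m.avg_union_mul _ (dependsOnly_circ A L) (dependsOnly_circ A L')]
  · rw [← Finset.inter_union_distrib_left, ← List.toFinset_append, ← edgeLabels_append]
    exact m.avg_congr fun φ => circ_append _ _
  · rw [Finset.disjoint_left]
    intro e he he'
    simp only [Finset.mem_inter, List.mem_toFinset] at he he'
    exact h e he.2 he'.2

theorem Z_perm {L L' : List (List Mark)} (h : L.Perm L') : m.Z A L = m.Z A L' :=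
  m.avg_congr fun _ => (h.map _).prod_eq

theorem Z_rotate (a b : List Mark) (L : List (List Mark)) :
    m.Z A ((a ++ b) :: L) = m.Z A ((b ++ a) :: L) :=
  m.avg_congr fun _ => by rw [circ_cons, circ_cons, word_append, word_append, Matrix.trace_mul_comm]

theorem Z_slide (a b : List Mark) (L : List (List Mark)) :
    m.Z A ((a ++ none :: b) :: L) = m.Z A ((none :: (a ++ b)) :: L) :=
  m.avg_congr fun _ => by simp

theorem mark_flip (k : Mark) : m.mark A φ k.flip = m.K * (m.mark A φ k).transpose * m.K' := by
  rcases k with _ | ⟨e, d⟩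
  · simp [mark, Mark.flip, m.K_mul]
  · by_cases h : e ∈ A
    · cases d
      · simp [mark, flip_some, h, m.star_P, smul_smul, m.eta_mul]
      · simp [mark, flip_some, h, m.star_P]
    · simp [mark, flip_some, h, m.K_mul]

/-- Reversal is an anti-automorphism on words and so is `a ↦ K * aᵀ * K'`; the two agree on single
marks. As the latter preserves traces, circles may be reversed. -/
theorem word_flipWord (c : List Mark) :
    m.word A φ (flipWord c) = m.K * (m.word A φ c).transpose * m.K' := by
  induction c with
  | nil => simp [m.K_mul]
  | cons k c ih =>
    have h : m.K' * (m.K * ((m.mark A φ k).transpose * m.K')) = (m.mark A φ k).transpose * m.K' := by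
      rw [← mul_assoc, m.mul_K, one_mul]
    simp only [flipWord_cons, word_append, word_cons, word_nil, mul_one, ih, mark_flip,
      Matrix.transpose_mul, mul_assoc, h]

theorem trace_star (a : Mat) : (m.K * a.transpose * m.K').trace = a.trace := by
  rw [Matrix.trace_mul_comm, ← mul_assoc, m.mul_K, one_mul, Matrix.trace_transpose]

theorem Z_reverse (c : List Mark) (L : List (List Mark)) :
    m.Z A (c :: L) = m.Z A (flipWord c :: L) :=
  m.avg_congr fun _ => by rw [circ_cons, circ_cons, word_flipWord, trace_star]

theorem word_turn (e : ℕ) (c : List Mark) : m.word A φ (c.map (Mark.turn e)) =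
    (if e ∈ A then m.η (φ e) else 1) ^ (labels c).count e • m.word A φ c := by
  induction c with
  | nil => simp
  | cons k c ih =>
    rcases k with _ | ⟨f, d⟩
    · simp [ih]
    · have h := m.eta_mul (φ e)
      by_cases hf : f = e
      · subst hf
        by_cases hA : f ∈ A
        · cases d
          · simp only [List.map_cons, turn_some, word_cons, ih, mark, hA, if_true, labels_cons_some,
              List.count_cons_self, Bool.not_false, Matrix.smul_mul, smul_smul,
              Matrix.mul_smul, Bool.false_eq_true, if_false, pow_succ, mul_assoc, h, mul_one]
          · simp [ih, mark, hA, pow_succ, smul_smul]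
        · simp [ih, mark, hA]
      · rw [List.map_cons, word_cons, ih, turn_some, if_neg hf, word_cons, labels_cons_some,
          List.count_cons_of_ne hf, Matrix.mul_smul]

theorem Z_turn (e : ℕ) {L : List (List Mark)} (h : Twice (edgeLabels L)) :
    m.Z A (L.map (List.map (Mark.turn e))) = m.Z A L := by
  refine m.avg_congr fun φ => ?_
  have key : ∀ L : List (List Mark), m.circ A φ (L.map (List.map (Mark.turn e))) =
      (if e ∈ A then m.η (φ e) else 1) ^ (edgeLabels L).count e * m.circ A φ L := by
    intro L
    induction L with
    | nil => simp
    | cons c L ih =>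
      rw [List.map_cons, circ_cons, circ_cons, ih, word_turn, Matrix.trace_smul, smul_eq_mul,
        edgeLabels_cons, List.count_append, pow_add]
      ring
  rw [key]
  by_cases he : e ∈ edgeLabels L
  · rw [h e he, sq]
    split_ifs
    · rw [m.eta_mul, one_mul]
    · simp
  · rw [List.count_eq_zero.2 he, pow_zero, one_mul]

theorem Z_relabel (s : Equiv.Perm ℕ) (L : List (List Mark)) :
    m.Z (A.map s.toEmbedding) (L.map (List.map (Mark.relabel s))) = m.Z A L := by
  unfold Z
  rw [avg_map]
  refine m.avg_congr fun φ => ?_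
  simp only [circ, List.map_map]
  congr 1
  refine List.map_congr_left fun c _ => ?_
  simp only [Function.comp_apply, word, List.map_map]
  congr 2
  refine List.map_congr_left fun k _ => ?_
  rcases k with _ | ⟨e, d⟩
  · rfl
  · simp [mark]

theorem word_insert_update {e : ℕ} (x : m.Φ) {c : List Mark} (h : e ∉ labels c) :
    m.word (insert e A) (Function.update φ e x) c = m.word A φ c := by
  refine word_congr fun f hf => ?_
  have : f ≠ e := ne_of_mem_of_not_mem hf h
  simp [this]

theorem circ_insert_update {e : ℕ} (x : m.Φ) {L : List (List Mark)} (h : e ∉ edgeLabels L) :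
    m.circ (insert e A) (Function.update φ e x) L = m.circ A φ L := by
  refine circ_congr fun f hf => ?_
  have : f ≠ e := ne_of_mem_of_not_mem hf h
  simp [this]

theorem mark_insert_update (e : ℕ) (d : Bool) (x : m.Φ) :
    m.mark (insert e A) (Function.update φ e x) (some (e, d)) =
      if d then m.P x else m.η x • m.P x := by
  simp [mark]

/-- Only two traces contain the label of `e`, and summing over it merges them by the axiom
`contract`. If both arrows are backward, the two factors `η` cancel. -/
theorem Z_contract {e : ℕ} (he : e ∉ A) (d : Bool) {a b : List Mark} {L : List (List Mark)}
    (ha : e ∉ labels a) (hb : e ∉ labels b) (hL : e ∉ edgeLabels L) :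
    m.Z (insert e A) ((some (e, d) :: a) :: (some (e, d) :: b) :: L) = m.Z A ((a ++ b) :: L) := by
  unfold Z
  simp only [avg_insert _ he, ← avg_mul_left, ← avg_sum]
  refine m.avg_congr fun φ => ?_
  simp only [circ_cons, word_cons, mark_insert_update, word_insert_update _ ha,
    word_insert_update _ hb, circ_insert_update _ hL, word_append]
  rw [← m.contract _ (word_mem a) _ (word_mem b), Finset.sum_mul]
  refine Finset.sum_congr rfl fun x _ => ?_
  cases d
  · simp only [Bool.false_eq_true, if_false, Matrix.smul_mul, Matrix.trace_smul, smul_eq_mul]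
    linear_combination (m.w x * (m.P x * m.word A φ a).trace * (m.P x * m.word A φ b).trace *
      m.circ A φ L) * m.eta_mul x
  · simp only [if_true]; ring

theorem Z_rotation {e : ℕ} (he : e ∉ A) (s : Bool) {a b c d : List Mark}
    (ha : e ∉ labels a) (hb : e ∉ labels b) (hc : e ∉ labels c) (hd : e ∉ labels d) :
    m.Z (insert e A) [a ++ [some (e, s)] ++ b ++ c ++ [some (e, s)] ++ d] =
      m.Z (insert e A) [b ++ [some (e, s)] ++ a ++ d ++ [some (e, s)] ++ c] := by
  unfold Z
  simp only [avg_insert _ he, ← avg_mul_left, ← avg_sum]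
  refine m.avg_congr fun φ => ?_
  simp only [circ_cons, word_cons, mark_insert_update, word_insert_update _ ha,
    word_insert_update _ hb, word_insert_update _ hc, word_insert_update _ hd, word_append,
    word_nil, circ_nil, mul_one]
  have h := m.rot _ (word_mem (A := A) (φ := φ) a) _ (word_mem (A := A) (φ := φ) b) _
    (word_mem (A := A) (φ := φ) c) _ (word_mem (A := A) (φ := φ) d)
  cases s
  · simpa [Matrix.smul_mul, Matrix.mul_smul, smul_smul, m.eta_mul] using h
  · exact h

/-- Exactly one of the two opposite arrows carries the factor `η`, as in the axiom `twist`. -/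
theorem Z_twist {e : ℕ} (he : e ∉ A) (s : Bool) {a b c d : List Mark}
    (ha : e ∉ labels a) (hb : e ∉ labels b) (hc : e ∉ labels c) (hd : e ∉ labels d) :
    m.Z (insert e A) [a ++ [some (e, s)] ++ b ++ c ++ [some (e, !s)] ++ d] =
      m.Z (insert e A) [b ++ [some (e, s)] ++ a ++ flipWord c ++ [some (e, !s)] ++ flipWord d] := by
  have hc' : e ∉ labels (flipWord c) := by simpa using hc
  have hd' : e ∉ labels (flipWord d) := by simpa using hd
  unfold Z
  simp only [avg_insert _ he, ← avg_mul_left, ← avg_sum]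
  refine m.avg_congr fun φ => ?_
  simp only [circ_cons, word_cons, mark_insert_update, word_insert_update _ ha,
    word_insert_update _ hb, word_insert_update _ hc, word_insert_update _ hd,
    word_insert_update _ hc', word_insert_update _ hd', word_append, word_nil, circ_nil, mul_one]
  have h := m.twist _ (word_mem (A := A) (φ := φ) a) _ (word_mem (A := A) (φ := φ) b) _
    (word_mem (A := A) (φ := φ) c) _ (word_mem (A := A) (φ := φ) d)
  simp only [word_flipWord]
  cases s <;> simpa [Matrix.smul_mul, Matrix.mul_smul, mul_assoc] using h

/-! Closed words are scalar. -/

variable (m A φ) in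
/-- The sign by which a word with the given labels commutes with a reflection. -/
def sign (i : Fin 2) (l : List ℕ) : ℚ :=
  (l.map fun e => if e ∈ A then m.sgn i (φ e) else 1).prod

theorem sign_append (i : Fin 2) (l l' : List ℕ) :
    m.sign A φ i (l ++ l') = m.sign A φ i l * m.sign A φ i l' := by simp [sign]

theorem sign_eq_one (i : Fin 2) {l : List ℕ} (h : ∀ e ∈ A, Even (l.count e)) :
    m.sign A φ i l = 1 := by
  rw [sign, Finset.prod_list_map_count]
  refine Finset.prod_eq_one fun e _ => ?_
  split_ifs with he
  · obtain ⟨k, hk⟩ := h e he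
    rw [hk, pow_add, ← mul_pow, m.sgn_mul, one_pow]
  · simp

theorem word_comm (i : Fin 2) (c : List Mark) : reflection i * m.word A φ c =
    m.sign A φ i (labels c) • (m.word A φ c * reflection i) := by
  induction c with
  | nil => simp [sign]
  | cons k c ih =>
    rcases k with _ | ⟨e, d⟩
    · simpa using ih
    · have hs : m.sign A φ i (e :: labels c) =
          (if e ∈ A then m.sgn i (φ e) else 1) * m.sign A φ i (labels c) := by simp [sign]
      have hk : reflection i * m.mark A φ (some (e, d)) =
          (if e ∈ A then m.sgn i (φ e) else 1) • (m.mark A φ (some (e, d)) * reflection i) := by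
        by_cases he : e ∈ A
        · cases d <;> simp [mark, he, m.comm, smul_comm (m.η (φ e))]
        · simp [mark, he]
      rw [word_cons, labels_cons_some, hs, ← mul_assoc, hk, Matrix.smul_mul, mul_assoc, ih,
        Matrix.mul_smul, smul_smul, mul_assoc]

theorem reflection_mul_self (i : Fin 2) : reflection i * reflection i = 1 := by
  fin_cases i <;> ext j k <;> fin_cases j <;> fin_cases k <;> simp [reflection]

/-- Conjugation by a reflection preserves the trace but also multiplies it by the sign. -/
theorem sign_of_trace_ne_zero (i : Fin 2) {c : List Mark} (h : (m.word A φ c).trace ≠ 0) :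
    m.sign A φ i (labels c) = 1 := by
  have h1 : (reflection i * m.word A φ c * reflection i).trace = (m.word A φ c).trace := by
    rw [Matrix.trace_mul_comm, ← mul_assoc, reflection_mul_self, one_mul]
  rw [word_comm, Matrix.smul_mul, mul_assoc, reflection_mul_self, mul_one, Matrix.trace_smul,
    smul_eq_mul] at h1
  exact mul_right_cancel₀ h (by rw [h1, one_mul])

theorem sign_of_circ_ne_zero (i : Fin 2) {L : List (List Mark)} (h : m.circ A φ L ≠ 0) :
    m.sign A φ i (edgeLabels L) = 1 := by
  induction L with
  | nil => simp [sign]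
  | cons c L ih =>
    rw [circ_cons] at h
    rw [edgeLabels_cons, sign_append, sign_of_trace_ne_zero i (left_ne_zero_of_mul h),
      ih (right_ne_zero_of_mul h), one_mul]

/-- The two reflections generate the full matrix algebra, whose centre consists of the scalars. -/
theorem eq_smul_one {a : Mat} (h : ∀ i, reflection i * a = a * reflection i) : a = a 0 0 • 1 := by
  have h0 := congrFun₂ (h 0) 0 1
  have h1 := congrFun₂ (h 1) 0 1
  have h2 := congrFun₂ (h 1) 1 0
  simp [reflection, Matrix.mul_apply, Fin.sum_univ_two] at h0 h1 h2
  ext j k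
  fin_cases j <;> fin_cases k <;> simp <;> linarith

theorem word_eq_smul_one {c : List Mark} (h : ∀ i, m.sign A φ i (labels c) = 1) :
    ∃ r : ℚ, m.word A φ c = r • 1 :=
  ⟨_, eq_smul_one fun i => by rw [word_comm, h, one_smul]⟩

/-- Joining two circles that lie in different components halves the state sum. -/
theorem Z_join {a b : List Mark} {L L₁ L₂ : List (List Mark)} (hL : L.Perm (L₁ ++ L₂))
    (h : ∀ e ∈ A, Even ((edgeLabels (a :: L₁)).count e)) :
    m.Z A (a :: b :: L) = 2 * m.Z A ((a ++ b) :: L) := by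
  rw [Z_perm (((hL.cons b).cons a)), Z_perm (hL.cons (a ++ b))]
  unfold Z
  rw [← avg_mul_left]
  refine m.avg_congr fun φ => ?_
  simp only [circ_cons, circ_append, word_append]
  -- If the circles of `L₁` have nonzero traces, their signs are one. The total sign of `a :: L₁` is
  -- one by parity, so `a` has sign one as well and is a scalar `r`. Then `tr (r • 1) * tr b = 2 *
  -- tr (r • b)`.
  by_cases h0 : m.circ A φ L₁ = 0
  · simp [h0]
  · have h1 (i) : m.sign A φ i (labels a) = 1 := by
      have := sign_eq_one (m := m) (φ := φ) i h
      rwa [edgeLabels_cons, sign_append, sign_of_circ_ne_zero i h0, mul_one] at this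
    obtain ⟨r, hr⟩ := word_eq_smul_one h1
    rw [hr]
    simp
    ring

end StateModel

/-! ### The three models. -/

/-- The Pauli matrices over the rationals. -/
def pauli : Fin 4 → Mat := ![1, !![0, 1; 1, 0], !![1, 0; 0, -1], !![0, 1; -1, 0]]

/-- The completeness relation of the Pauli basis. The last weight is negative because the rational
fourth matrix squares to `-1`. -/
theorem sum_pauli_mul (b : Mat) :
    ∑ x, (![1/2, 1/2, 1/2, -1/2] : Fin 4 → ℚ) x • (pauli x * b * pauli x) = b.trace • 1 := by
  ext i j
  fin_cases i <;> fin_cases j <;>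
    simp [Fin.sum_univ_four, pauli, Matrix.vecMul, dotProduct, Matrix.mul_apply, Fin.sum_univ_two,
      Matrix.trace] <;> ring

/-- With the sign `η` the completeness relation yields the transpose: a half twist of the ribbon
reverses the enclosed word. -/
theorem sum_pauli_twist (b : Mat) :
    ∑ x, ((![1/2, 1/2, 1/2, -1/2] : Fin 4 → ℚ) x * (![1, 1, 1, -1] : Fin 4 → ℚ) x) •
      (pauli x * b * pauli x) = b.transpose := by
  ext i j
  fin_cases i <;> fin_cases j <;>
    simp [Fin.sum_univ_four, pauli, Matrix.vecMul, dotProduct, Matrix.mul_apply,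
      Fin.sum_univ_two] <;> ring

/-- The model whose state sum counts boundary circles. -/
def boundaryModel : StateModel where
  Φ := Fin 4
  fintype := inferInstance
  inhabited := inferInstance
  w := ![1/2, 1/2, 1/2, -1/2]
  P := pauli
  η := ![1, 1, 1, -1]
  S := ⊤
  K := 1
  K' := 1
  sgn := ![![1, 1, -1, -1], ![1, -1, 1, -1]]
  K_mul := mul_one _
  mul_K := mul_one _
  sum_w := by simp [Fin.sum_univ_four]; norm_num
  eta_mul x := by fin_cases x <;> simp
  mem _ := trivial
  smul_mem _ := trivial
  star_P x := by
    ext i j; fin_cases x <;> fin_cases i <;> fin_cases j <;> simp [pauli]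
  contract a _ b _ := by
    simp [Fin.sum_univ_four, pauli, Matrix.mul_apply, Fin.sum_univ_two, Matrix.trace]; ring
  rot a _ b _ c _ d _ := by
    have key (a b c d : Mat) : ∑ x, (![1/2, 1/2, 1/2, -1/2] : Fin 4 → ℚ) x *
        (a * pauli x * b * c * pauli x * d).trace = (b * c).trace * (d * a).trace := by
      have h := congrArg (fun t => (a * t * d).trace) (sum_pauli_mul (b * c))
      simp only [Matrix.mul_sum, Matrix.sum_mul, Matrix.trace_sum, Matrix.mul_smul, Matrix.smul_mul,
        Matrix.trace_smul, smul_eq_mul, mul_one] at h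
      rw [Matrix.trace_mul_comm d a, ← h]
      simp only [mul_assoc]
    rw [key, key, Matrix.trace_mul_comm d a, Matrix.trace_mul_comm b c, mul_comm]
  twist a _ b _ c _ d _ := by
    have key (a b c d : Mat) : ∑ x, (![1/2, 1/2, 1/2, -1/2] : Fin 4 → ℚ) x *
        (![1, 1, 1, -1] : Fin 4 → ℚ) x * (a * pauli x * b * c * pauli x * d).trace =
          (a * (b * c).transpose * d).trace := by
      have h := congrArg (fun t => (a * t * d).trace) (sum_pauli_twist (b * c))
      simp only [Matrix.mul_sum, Matrix.sum_mul, Matrix.trace_sum, Matrix.mul_smul, Matrix.smul_mul,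
        Matrix.trace_smul, smul_eq_mul] at h
      rw [← h]
      simp only [mul_assoc]
    simp only [one_mul, mul_one]
    rw [key, key, ← Matrix.trace_transpose]
    simp only [Matrix.transpose_mul, Matrix.transpose_transpose]
    rw [Matrix.trace_mul_comm, ← mul_assoc]
  comm i x := by
    ext j k; fin_cases i <;> fin_cases x <;> fin_cases j <;> fin_cases k <;>
      simp [reflection, pauli, Matrix.mul_apply, Fin.sum_univ_two]
  sgn_mul i x := by fin_cases i <;> fin_cases x <;> simp

/-- The diagonal matrices. -/
def diagonalSubmonoid : Submonoid Mat where
  carrier := {a | ∃ v, a = Matrix.diagonal v}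
  one_mem' := ⟨1, by simp⟩
  mul_mem' := by
    rintro _ _ ⟨v, rfl⟩ ⟨w, rfl⟩
    exact ⟨_, Matrix.diagonal_mul_diagonal _ _⟩

/-- The sign matrices. -/
def signMatrix : Fin 2 → Mat := fun x => Matrix.diagonal ![1, ![1, -1] x]

/-- The exchange of the two coordinates, or the identity. -/
def exchange (b : Bool) : Mat := if b then !![0, 1; 1, 0] else 1

theorem exchange_mul_self (b : Bool) : exchange b * exchange b = 1 := by
  cases b
  · simp [exchange]
  · ext i j; fin_cases i <;> fin_cases j <;> simp [exchange]

theorem exchange_star (b : Bool) (v : Fin 2 → ℚ) :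
    exchange b * (Matrix.diagonal v).transpose * exchange b =
      Matrix.diagonal (if b then ![v 1, v 0] else v) := by
  cases b
  · simp [exchange]
  · ext i j; fin_cases i <;> fin_cases j <;> simp [exchange, Matrix.vecMul, dotProduct,
      Fin.sum_univ_two]

/-- The models whose state sums count components (`b = false`) and orientations (`b = true`). -/
def signModel (b : Bool) : StateModel where
  Φ := Fin 2
  fintype := inferInstance
  inhabited := inferInstance
  w := ![1/2, 1/2]
  P := signMatrix
  η := ![1, if b then -1 else 1]
  S := diagonalSubmonoid
  -- Exchanging the coordinates negates `diag (1, -1)`, which is the value `-1` of `η` for `b =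
  -- true`: reversing a circle swaps its two orientations.
  K := exchange b
  K' := exchange b
  sgn := ![![1, -1], ![1, 1]]
  K_mul := exchange_mul_self b
  mul_K := exchange_mul_self b
  sum_w := by simp [Fin.sum_univ_two]; norm_num
  eta_mul x := by fin_cases x <;> cases b <;> simp
  mem x := ⟨_, rfl⟩
  smul_mem x := ⟨_, (Matrix.diagonal_smul _ _).symm⟩
  star_P x := by
    rw [signMatrix, exchange_star, ← Matrix.diagonal_smul]
    congr 1
    ext i
    fin_cases x <;> fin_cases i <;> cases b <;> simp
  contract := by
    rintro _ ⟨v, rfl⟩ _ ⟨w, rfl⟩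
    simp [Fin.sum_univ_two, signMatrix, Matrix.diagonal_mul_diagonal, Matrix.trace_diagonal]
    ring
  rot := by
    rintro _ ⟨v, rfl⟩ _ ⟨w, rfl⟩ _ ⟨y, rfl⟩ _ ⟨z, rfl⟩
    simp [Fin.sum_univ_two, signMatrix, Matrix.diagonal_mul_diagonal, Matrix.trace_diagonal]
    ring
  twist := by
    rintro _ ⟨v, rfl⟩ _ ⟨w, rfl⟩ _ ⟨y, rfl⟩ _ ⟨z, rfl⟩
    simp only [exchange_star]
    cases b
    all_goals
      simp [Fin.sum_univ_two, signMatrix, Matrix.diagonal_mul_diagonal, Matrix.trace_diagonal]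
      try ring
  comm i x := by
    ext j k; fin_cases i <;> fin_cases x <;> fin_cases j <;> fin_cases k <;>
      simp [reflection, signMatrix]
  sgn_mul i x := by fin_cases i <;> fin_cases x <;> simp

/-! ### State sums count colourings -/

/-- The intermediate indices of the product are the colours `g` of the arcs before, between and
after the marks. -/
theorem list_prod_apply {α : Type*} (M : α → Mat) (l : List α) (x y : Fin 2) :
    (l.map M).prod x y = ∑ g : Fin (l.length + 1) → Fin 2,
      if g 0 = x ∧ g (Fin.last _) = y then
        ∏ j : Fin l.length, M l[j.1] (g j.castSucc) (g j.succ) else 0 := by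
  induction l generalizing x y with
  | nil =>
    refine Eq.trans ?_ (Equiv.sum_comp (Equiv.funUnique (Fin 1) (Fin 2)).symm _)
    by_cases h : x = y
    · subst h; simp
    · simp only [List.map_nil, List.prod_nil, Matrix.one_apply, h, if_false]
      exact (Finset.sum_eq_zero fun z _ => if_neg fun hz => h (hz.1.symm.trans hz.2)).symm
  | cons k l ih =>
    rw [List.map_cons, List.prod_cons, Matrix.mul_apply]
    simp only [ih, Finset.mul_sum]
    rw [Finset.sum_comm]
    refine Eq.trans ?_ (Equiv.sum_comp (Fin.consEquiv fun _ : Fin (l.length + 1 + 1) => Fin 2) _)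
    rw [Fintype.sum_prod_type_right]
    refine Finset.sum_congr rfl fun g _ => ?_
    rw [Finset.sum_eq_single_of_mem (g 0) (Finset.mem_univ _),
      Finset.sum_eq_single_of_mem x (Finset.mem_univ _)]
    · by_cases h : g (Fin.last _) = y
      · simp [Fin.consEquiv, Fin.prod_univ_succ, h, ← Fin.succ_last]
      · simp [Fin.consEquiv, h, ← Fin.succ_last]
    · intro z _ hz
      simp [Fin.consEquiv, hz]
    · intro z _ hz
      simp [Ne.symm hz]

theorem trace_list_prod {α : Type*} (M : α → Mat) (l : List α) :
    (l.map M).prod.trace = ∑ g : Fin (l.length + 1) → Fin 2,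
      if g 0 = g (Fin.last _) then
        ∏ j : Fin l.length, M l[j.1] (g j.castSucc) (g j.succ) else 0 := by
  simp only [Matrix.trace, Matrix.diag, list_prod_apply]
  rw [Finset.sum_comm]
  refine Finset.sum_congr rfl fun g _ => ?_
  rw [Finset.sum_eq_single_of_mem (g 0) (Finset.mem_univ _)]
  · simp [eq_comm]
  · intro z _ hz
    simp [Ne.symm hz]

/-- The positions of the marks of an arrow presentation. -/
abbrev Pos (L : List (List Mark)) : Type := (i : Fin L.length) × Fin L[i.1].length

/-- The mark at a position. -/
def Pos.mark {L : List (List Mark)} (p : Pos L) : Mark := L[p.1.1][p.2.1]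

/-- The edge of `A` at a position. -/
def Pos.lab {L : List (List Mark)} (A : Finset ℕ) (p : Pos L) : Option ℕ :=
  (p.mark.map Prod.fst).filter (· ∈ A)

/-- Colourings of the arcs between the marks. -/
abbrev ArcColouring (L : List (List Mark)) : Type :=
  (i : Fin L.length) → Fin (L[i.1].length + 1) → Fin 2

namespace StateModel

variable {m : StateModel} {A : Finset ℕ}

variable (m) in
/-- The matrix of an arrow of the given direction, labelled `x`. -/
def val (x : m.Φ) (d : Bool) : Mat := if d then m.P x else m.η x • m.P x

theorem avg_zero (A : Finset ℕ) : m.avg A (fun _ => 0) = 0 := by simp [avg]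

theorem avg_prod (A : Finset ℕ) (k : ℕ → m.Φ → ℚ) :
    m.avg A (fun φ => ∏ e ∈ A, k e (φ e)) = ∏ e ∈ A, ∑ x, m.w x * k e x := by
  induction A using Finset.induction_on with
  | empty => simp [avg_empty]
  | insert a A ha ih =>
    rw [avg_insert _ ha, Finset.prod_insert ha, ← ih, Finset.sum_mul]
    refine Finset.sum_congr rfl fun x _ => ?_
    rw [mul_assoc, ← avg_mul_left (c := k a x)]
    congr 1
    refine m.avg_congr fun φ => ?_
    rw [Finset.prod_insert ha, Function.update_self]
    congr 1
    refine Finset.prod_congr rfl fun e he => ?_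
    rw [Function.update_of_ne (ne_of_mem_of_not_mem he ha)]

theorem mark_of_lab_eq_none {L : List (List Mark)} {p : Pos L} (h : p.lab A = none) {φ : ℕ → m.Φ} :
    m.mark A φ p.mark = 1 := by
  unfold Pos.lab at h
  rcases hp : p.mark with _ | ⟨e, d⟩
  · rfl
  · rw [hp] at h
    have : e ∉ A := by simpa [Option.filter_eq_none_iff] using h
    simp [mark, this]

theorem mark_of_lab_eq_some {L : List (List Mark)} {p : Pos L} {e : ℕ} (h : p.lab A = some e)
    {φ : ℕ → m.Φ} : m.mark A φ p.mark = m.val (φ e) (p.mark.elim true Prod.snd) := by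
  unfold Pos.lab at h
  rw [Option.filter_eq_some_iff] at h
  rcases hp : p.mark with _ | ⟨f, d⟩
  · simp [hp] at h
  · rw [hp] at h
    obtain ⟨h1, h2⟩ := h
    obtain rfl : f = e := by simpa using h1
    have h2 := of_decide_eq_true h2
    simp only [mark, val, if_pos h2, Option.elim_some]
    rfl

variable (m) in
/-- The contribution of the ends of the edge `e`, labelled `x`, to a colouring. -/
def endWeight (A : Finset ℕ) {L : List (List Mark)} (g : ArcColouring L) (e : ℕ) (x : m.Φ) : ℚ :=
  ∏ p : Pos L with p.lab A = some e,
    m.val x (p.mark.elim true Prod.snd) (g p.1 p.2.castSucc) (g p.1 p.2.succ)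

/-- Traces are expanded into colourings of arcs, closed up at the base points. Marks outside `A` are
identity matrices and force equal colours on both sides; for a fixed colouring the sum over labels
factors over the edges. -/
theorem Z_eq_sum (L : List (List Mark)) :
    m.Z A L = ∑ g : ArcColouring L,
      if (∀ i, g i 0 = g i (Fin.last _)) ∧
        ∀ p : Pos L, p.lab A = none → g p.1 p.2.castSucc = g p.1 p.2.succ
      then ∏ e ∈ A, ∑ x, m.w x * m.endWeight A g e x else 0 := by
  have h1 (φ : ℕ → m.Φ) : m.circ A φ L = ∑ g : ArcColouring L,
      if ∀ i, g i 0 = g i (Fin.last _) then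
        ∏ p : Pos L, m.mark A φ p.mark (g p.1 p.2.castSucc) (g p.1 p.2.succ) else 0 := by
    unfold circ
    rw [← Fin.prod_univ_fun_getElem]
    simp only [word, trace_list_prod]
    rw [Finset.prod_univ_sum, Fintype.piFinset_univ]
    refine Finset.sum_congr rfl fun g _ => ?_
    rw [Fintype.prod_ite_zero, Fintype.prod_sigma]
    by_cases hg : ∀ i, g i 0 = g i (Fin.last _)
    · rw [if_pos hg, if_pos hg]; rfl
    · rw [if_neg hg, if_neg hg]
  have h2 (φ : ℕ → m.Φ) (g : ArcColouring L) :
      ∏ p : Pos L, m.mark A φ p.mark (g p.1 p.2.castSucc) (g p.1 p.2.succ) =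
      (if ∀ p : Pos L, p.lab A = none → g p.1 p.2.castSucc = g p.1 p.2.succ then 1 else 0) *
      ∏ e ∈ A, m.endWeight A g e (φ e) := by
    rw [← Finset.prod_fiberwise_of_maps_to (s := Finset.univ) (t := A.insertNone)
      (g := fun p : Pos L => p.lab A), Finset.prod_insertNone]
    · congr 1
      · rw [Finset.prod_congr rfl (g := fun p : Pos L =>
          if g p.1 p.2.castSucc = g p.1 p.2.succ then 1 else 0)]
        · rw [Finset.prod_boole]
          simp
        · intro p hp
          rw [mark_of_lab_eq_none (Finset.mem_filter.1 hp).2, Matrix.one_apply]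
      · refine Finset.prod_congr rfl fun e he => Finset.prod_congr rfl fun p hp => ?_
        rw [mark_of_lab_eq_some (Finset.mem_filter.1 hp).2]
    · intro p _
      rw [Finset.mem_insertNone]
      intro e he
      simp only [Pos.lab, Option.filter_eq_some_iff, Option.mem_def] at he
      simpa using he.2
  unfold Z
  simp only [h1, h2]
  rw [avg_sum]
  refine Finset.sum_congr rfl fun g _ => ?_
  by_cases hg : ∀ i, g i 0 = g i (Fin.last _)
  · by_cases hf : ∀ p : Pos L, p.lab A = none → g p.1 p.2.castSucc = g p.1 p.2.succ
    · simp only [if_pos hg, if_pos hf, one_mul, if_pos (And.intro hg hf)]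
      exact avg_prod A fun e x => m.endWeight A g e x
    · simp only [if_pos hg, if_neg hf, zero_mul, if_neg fun h => hf (And.right h), avg_zero]
  · simp only [if_neg hg, if_neg fun h => hg (And.left h), avg_zero]

end StateModel

theorem card_pos_lab {A : Finset ℕ} {L : List (List Mark)} {e : ℕ} (he : e ∈ A) :
    (Finset.univ.filter fun p : Pos L => p.lab A = some e).card = (edgeLabels L).count e := by
  have h1 : (edgeLabels L).count e = (L.map fun c => (labels c).count e).sum := by
    induction L with
    | nil => rfl
    | cons c L ih => simp [ih]
  have h2 (c : List Mark) : (labels c).count e =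
      (c.map fun k => if k.map Prod.fst = some e then 1 else 0).sum := by
    induction c with
    | nil => rfl
    | cons k c ih =>
      rcases k with _ | ⟨f, d⟩
      · simp [ih]
      · by_cases h : f = e <;> simp [ih, h, add_comm]
  rw [h1, Finset.card_filter, Fintype.sum_sigma, ← Fin.sum_univ_fun_getElem]
  refine Finset.sum_congr rfl fun i _ => ?_
  rw [h2, ← Fin.sum_univ_fun_getElem]
  refine Finset.sum_congr rfl fun j _ => ?_
  simp only [Pos.lab, Pos.mark, Option.filter_eq_some_iff]
  by_cases h : Option.map Prod.fst L[i.1][j.1] = some e <;> simp [h, he]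

/-- The direction of the arrow at a position. -/
def Pos.dir {L : List (List Mark)} (p : Pos L) : Bool := p.mark.elim true Prod.snd

theorem Pos.lab_eq_some {L : List (List Mark)} {A : Finset ℕ} {p : Pos L} {e : ℕ} :
    p.lab A = some e ↔ e ∈ A ∧ p.mark = some (e, p.dir) := by
  unfold Pos.lab Pos.dir
  rw [Option.filter_eq_some_iff]
  rcases p.mark with _ | ⟨f, d⟩
  · simp
  · simp only [Option.map_some, Option.some.injEq, decide_eq_true_eq, Option.elim_some,
      Prod.mk.injEq, and_true]
    exact and_comm

theorem Pos.lab_eq_none {L : List (List Mark)} {A : Finset ℕ} {p : Pos L} :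
    p.lab A = none ↔ HERG.IsFree A p.mark := by
  unfold Pos.lab HERG.IsFree
  rw [Option.filter_eq_none_iff]
  rcases p.mark with _ | ⟨f, d⟩ <;> simp

namespace StateModel

variable {m : StateModel} {A : Finset ℕ}

theorem exists_pair {L : List (List Mark)} (hL : Twice (edgeLabels L)) {e : ℕ} (p : Pos L)
    (hp : p.lab A = some e) : ∃ q, p ≠ q ∧ q.lab A = some e ∧
      (Finset.univ.filter fun p : Pos L => p.lab A = some e) = {p, q} := by
  have he := (Pos.lab_eq_some.1 hp).1
  have h := card_pos_lab (L := L) he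
  have h1 : e ∈ edgeLabels L := by
    rw [← List.count_pos_iff, ← h, Finset.card_pos]
    exact ⟨p, by simpa using hp⟩
  rw [hL e h1, Finset.card_eq_two] at h
  obtain ⟨a, b, hab, h⟩ := h
  have hpm : p ∈ ({a, b} : Finset (Pos L)) := by rw [← h]; simpa using hp
  have ha : a.lab A = some e := by
    have : a ∈ (Finset.univ.filter fun p : Pos L => p.lab A = some e) := by rw [h]; simp
    simpa using this
  have hb : b.lab A = some e := by
    have : b ∈ (Finset.univ.filter fun p : Pos L => p.lab A = some e) := by rw [h]; simp
    simpa using this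
  rcases Finset.mem_insert.1 hpm with rfl | hp'
  · exact ⟨b, hab, hb, h⟩
  · rw [Finset.mem_singleton] at hp'
    subst hp'
    exact ⟨a, hab.symm, ha, by rw [h, Finset.pair_comm]⟩

/-- A colouring of the arcs that satisfies `C` at every edge of `A` and is constant elsewhere. -/
structure Good (C : Bool → Fin 2 → Fin 2 → Bool → Fin 2 → Fin 2 → Prop) (A : Finset ℕ)
    {L : List (List Mark)} (g : ArcColouring L) : Prop where
  closed : ∀ i, g i 0 = g i (Fin.last _)
  free : ∀ p : Pos L, p.lab A = none → g p.1 p.2.castSucc = g p.1 p.2.succ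
  edge : ∀ (p q : Pos L) (e : ℕ), p ≠ q → p.lab A = some e → q.lab A = some e →
    C p.dir (g p.1 p.2.castSucc) (g p.1 p.2.succ) q.dir (g q.1 q.2.castSucc) (g q.1 q.2.succ)

/-- An edge has two ends, so its factor is the sum in `h1` and `h0`. If that sum is the indicator of
`C`, the state sum counts the admissible colourings. -/
theorem Z_eq_card (C : Bool → Fin 2 → Fin 2 → Bool → Fin 2 → Fin 2 → Prop)
    (h1 : ∀ d l r d' l' r', C d l r d' l' r' →
      ∑ x, m.w x * (m.val x d l r * m.val x d' l' r') = 1)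
    (h0 : ∀ d l r d' l' r', ¬ C d l r d' l' r' →
      ∑ x, m.w x * (m.val x d l r * m.val x d' l' r') = 0)
    {L : List (List Mark)} (hL : Twice (edgeLabels L)) :
    m.Z A L = Nat.card {g : ArcColouring L // Good C A g} := by
  classical
  have hsymm {d l r d' l' r'} (h : C d l r d' l' r') : C d' l' r' d l r := by
    by_contra hn
    have := h0 _ _ _ _ _ _ hn
    rw [Finset.sum_congr rfl fun x _ => by rw [mul_comm (m.val x d' l' r')], h1 _ _ _ _ _ _ h] at this
    exact one_ne_zero this
  rw [Z_eq_sum, Nat.card_eq_fintype_card, Fintype.card_subtype, Finset.card_filter, Nat.cast_sum]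
  refine Finset.sum_congr rfl fun g _ => ?_
  by_cases hcf : (∀ i, g i 0 = g i (Fin.last _)) ∧
        ∀ p : Pos L, p.lab A = none → g p.1 p.2.castSucc = g p.1 p.2.succ
  swap
  · rw [if_neg hcf, if_neg fun h => hcf ⟨h.closed, h.free⟩, Nat.cast_zero]
  rw [if_pos hcf]
  have hw {p q : Pos L} {e : ℕ} (hpq : p ≠ q)
      (h : (Finset.univ.filter fun p : Pos L => p.lab A = some e) = {p, q}) :
      ∑ x, m.w x * m.endWeight A g e x = ∑ x, m.w x *
        (m.val x p.dir (g p.1 p.2.castSucc) (g p.1 p.2.succ) *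
          m.val x q.dir (g q.1 q.2.castSucc) (g q.1 q.2.succ)) := by
    simp only [endWeight, h, Finset.prod_pair hpq]
    rfl
  by_cases hg : Good C A g
  · rw [if_pos hg, Nat.cast_one]
    refine Finset.prod_eq_one fun e he => ?_
    by_cases hp : ∃ p : Pos L, p.lab A = some e
    · obtain ⟨p, hp⟩ := hp
      obtain ⟨q, hpq, hq, h⟩ := exists_pair hL p hp
      rw [hw hpq h]
      exact h1 _ _ _ _ _ _ (hg.edge p q e hpq hp hq)
    · have : (Finset.univ.filter fun p : Pos L => p.lab A = some e) = ∅ := by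
        rw [Finset.filter_eq_empty_iff]
        exact fun p _ h => hp ⟨p, h⟩
      simp only [endWeight, this, Finset.prod_empty, mul_one, m.sum_w]
  · rw [if_neg hg, Nat.cast_zero]
    have : ∃ (p q : Pos L) (e : ℕ), p ≠ q ∧ p.lab A = some e ∧ q.lab A = some e ∧
      ¬ C p.dir (g p.1 p.2.castSucc) (g p.1 p.2.succ) q.dir (g q.1 q.2.castSucc)
        (g q.1 q.2.succ) := by
      by_contra hn
      push Not at hn
      exact hg ⟨hcf.1, hcf.2, hn⟩
    obtain ⟨p, q', e, hpq', hp, hq', hC⟩ := this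
    obtain ⟨q, hpq, hq, h⟩ := exists_pair hL p hp
    have : q' ∈ (Finset.univ.filter fun p : Pos L => p.lab A = some e) := by simpa using hq'
    rw [h] at this
    obtain rfl : q' = q := by simpa [hpq'.symm] using this
    exact Finset.prod_eq_zero (Pos.lab_eq_some.1 hp).1 (by rw [hw hpq h]; exact h0 _ _ _ _ _ _ hC)

end StateModel

/-- The end of an arrow at its tip. -/
def tipOf {α : Type*} (d : Bool) (l r : α) : α := if d then r else l

/-- The condition on the colours of the arcs at the two ends of a ribbon. -/
def SideCond (d : Bool) (l r : Fin 2) (d' : Bool) (l' r' : Fin 2) : Prop :=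
  tipOf d l r = tipOf d' r' l' ∧ tipOf d r l = tipOf d' l' r'

instance (d l r d' l' r') : Decidable (SideCond d l r d' l' r') := by
  unfold SideCond; infer_instance

theorem boundaryModel_sum (d : Bool) (l r : Fin 2) (d' : Bool) (l' r' : Fin 2) :
    ∑ x, boundaryModel.w x * (boundaryModel.val x d l r * boundaryModel.val x d' l' r') =
      if SideCond d l r d' l' r' then 1 else 0 := by
  change ∑ x : Fin 4, _ = _
  rw [Fin.sum_univ_four]
  fin_cases l <;> fin_cases r <;> fin_cases l' <;> fin_cases r' <;> cases d <;> cases d' <;>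
    simp [boundaryModel, StateModel.val, pauli, SideCond, tipOf] <;> norm_num

/-- The condition on the colours of the circles at the two ends of a ribbon. -/
def SignCond (b : Bool) (d : Bool) (l r : Fin 2) (d' : Bool) (l' r' : Fin 2) : Prop :=
  l = r ∧ l' = r' ∧ (((d && b) ^^ decide (l = 1)) = ((d' && b) ^^ decide (l' = 1)))

instance (b d l r d' l' r') : Decidable (SignCond b d l r d' l' r') := by
  unfold SignCond; infer_instance

theorem signModel_sum (b d : Bool) (l r : Fin 2) (d' : Bool) (l' r' : Fin 2) :
    ∑ x, (signModel b).w x * ((signModel b).val x d l r * (signModel b).val x d' l' r') =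
      if SignCond b d l r d' l' r' then 1 else 0 := by
  change ∑ x : Fin 2, _ = _
  rw [Fin.sum_univ_two]
  fin_cases l <;> fin_cases r <;> fin_cases l' <;> fin_cases r' <;> cases d <;> cases d' <;>
    cases b <;>
    simp [signModel, StateModel.val, signMatrix, SignCond] <;> norm_num

/-- The colour of an arc, given by its place. -/
def ArcColouring.at {L : List (List Mark)} (g : ArcColouring L) (i j : ℕ) : Fin 2 :=
  if h : ∃ hi : i < L.length, j < L[i].length + 1 then g ⟨i, h.1⟩ ⟨j, h.2⟩ else 0

theorem ArcColouring.at_eq {L : List (List Mark)} (g : ArcColouring L) (i : Fin L.length)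
    (j : Fin (L[i.1].length + 1)) : g.at i j = g i j := by
  unfold ArcColouring.at
  rw [dif_pos ⟨i.2, j.2⟩]

/-! ### Identification of the three state sums with topological invariants. -/

namespace HERG

variable (G : HERG)

theorem gap_lt (p : G.Gap) : ∃ hi : p.1.1 < G.circles.length, p.1.2 < G.circles[p.1.1].length + 1 := by
  obtain ⟨c, hc, hp⟩ := p.2
  obtain ⟨hi, rfl⟩ := List.getElem?_eq_some_iff.1 hc
  exact ⟨hi, by omega⟩

/-- Arcs as pairs of indices. -/
def gapEquiv : G.Gap ≃ (i : Fin G.circles.length) × Fin (G.circles[i.1].length + 1) where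
  toFun p := ⟨⟨p.1.1, (G.gap_lt p).1⟩, ⟨p.1.2, (G.gap_lt p).2⟩⟩
  invFun p := ⟨(p.1.1, p.2.1), _, List.getElem?_eq_getElem p.1.2, by omega⟩
  left_inv _ := rfl
  right_inv _ := rfl

instance : Finite G.Gap := .of_equiv _ G.gapEquiv.symm

instance (A : Finset ℕ) : Finite (G.BdryCircle A) := inferInstanceAs (Finite (Quot _))

/-- Colourings of the arcs. -/
def colouringEquiv : ArcColouring G.circles ≃ (G.Gap → Fin 2) :=
  (Equiv.piCurry fun (i : Fin G.circles.length) (_ : Fin (G.circles[i.1].length + 1)) => Fin 2).symm.trans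
    (Equiv.arrowCongr G.gapEquiv.symm (Equiv.refl _))

theorem colouringEquiv_apply (g : ArcColouring G.circles) (p : G.Gap) :
    G.colouringEquiv g p = g.at p.1.1 p.1.2 := by
  unfold ArcColouring.at
  rw [dif_pos (G.gap_lt p)]
  rfl

variable {G}

theorem markAt_iff {i j : ℕ} {k : Mark} : G.MarkAt i j k ↔
    ∃ p : Pos G.circles, p.1.1 = i ∧ p.2.1 = j ∧ p.mark = k := by
  constructor
  · rintro ⟨w, hw, hk⟩
    obtain ⟨hi, rfl⟩ := List.getElem?_eq_some_iff.1 hw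
    obtain ⟨hj, rfl⟩ := List.getElem?_eq_some_iff.1 hk
    exact ⟨⟨⟨i, hi⟩, ⟨j, hj⟩⟩, rfl, rfl, rfl⟩
  · rintro ⟨p, rfl, rfl, rfl⟩
    exact ⟨_, List.getElem?_eq_getElem p.1.2, List.getElem?_eq_getElem p.2.2⟩

theorem pos_ne_iff {p q : Pos G.circles} : p ≠ q ↔ (p.1.1, p.2.1) ≠ (q.1.1, q.2.1) := by
  rw [not_iff_not]
  constructor
  · rintro rfl; rfl
  · obtain ⟨⟨i, hi⟩, ⟨j, hj⟩⟩ := p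
    obtain ⟨⟨i', hi'⟩, ⟨j', hj'⟩⟩ := q
    intro h
    simp only [Prod.mk.injEq] at h
    obtain ⟨rfl, rfl⟩ := h
    rfl

theorem at_left (g : ArcColouring G.circles) (p : Pos G.circles) :
    g p.1 p.2.castSucc = g.at p.1.1 p.2.1 := (g.at_eq p.1 p.2.castSucc).symm

theorem at_right (g : ArcColouring G.circles) (p : Pos G.circles) :
    g p.1 p.2.succ = g.at p.1.1 (p.2.1 + 1) := (g.at_eq p.1 p.2.succ).symm

theorem apply_tipOf {α β : Type*} (f : α → β) (d : Bool) (l r : α) :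
    f (tipOf d l r) = tipOf d (f l) (f r) := by
  cases d <;> rfl

theorem at_tip (g : ArcColouring G.circles) (i j : ℕ) (d : Bool) :
    g.at (tip i j d).1 (tip i j d).2 = tipOf d (g.at i j) (g.at i (j + 1)) := by
  cases d <;> rfl

theorem at_tail (g : ArcColouring G.circles) (i j : ℕ) (d : Bool) :
    g.at (tail i j d).1 (tail i j d).2 = tipOf d (g.at i (j + 1)) (g.at i j) := by
  cases d <;> rfl

/-- The three clauses of `Good` match the three constructors of `BdryStep`, so admissible colourings
are those constant along boundary circles. -/
theorem good_iff (A : Finset ℕ) (g : ArcColouring G.circles) :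
    StateModel.Good SideCond A g ↔
      ∀ p q, G.BdryStep A p q → G.colouringEquiv g p = G.colouringEquiv g q := by
  constructor
  · intro h p q hpq
    rw [colouringEquiv_apply, colouringEquiv_apply]
    cases hpq with
    | close c hc hp hq =>
      obtain ⟨hi, rfl⟩ := List.getElem?_eq_some_iff.1 hc
      rw [hq, hp]
      have := h.closed ⟨p.1.1, hi⟩
      rwa [← g.at_eq, ← g.at_eq] at this
    | free k hm hfree hq =>
      obtain ⟨P, h1, h2, rfl⟩ := markAt_iff.1 hm
      have := h.free P (Pos.lab_eq_none.2 hfree)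
      rw [at_left g P, at_right g P] at this
      rw [hq, ← h1, ← h2]
      exact this
    | side e he i j d i' j' d' hne hm hm' hp hq =>
      obtain ⟨P, rfl, rfl, h3⟩ := markAt_iff.1 hm
      obtain ⟨Q, rfl, rfl, h3'⟩ := markAt_iff.1 hm'
      have hd : P.dir = d := by simp [Pos.dir, h3]
      have hd' : Q.dir = d' := by simp [Pos.dir, h3']
      have := (h.edge P Q e (pos_ne_iff.2 hne) (Pos.lab_eq_some.2 ⟨he, by rw [hd, h3]⟩)
        (Pos.lab_eq_some.2 ⟨he, by rw [hd', h3']⟩)).1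
      rw [at_left g P, at_right g P, at_left g Q, at_right g Q, hd, hd', ← at_tip, ← at_tail, ← hp, ← hq] at this
      exact this
  · intro h
    have step (a b : (i : Fin G.circles.length) × Fin (G.circles[i.1].length + 1))
        (hs : G.BdryStep A (G.gapEquiv.symm a) (G.gapEquiv.symm b)) : g a.1 a.2 = g b.1 b.2 := by
      have := h _ _ hs
      rw [colouringEquiv_apply, colouringEquiv_apply] at this
      rw [← g.at_eq, ← g.at_eq]
      exact this
    refine ⟨fun i => ?_, fun p hp => ?_, fun p q e hpq hp hq => ?_⟩
    · exact step ⟨i, 0⟩ ⟨i, Fin.last _⟩ (.close _ _ _ (List.getElem?_eq_getElem i.2) rfl rfl)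
    · exact step ⟨p.1, p.2.castSucc⟩ ⟨p.1, p.2.succ⟩ (.free _ _ p.mark (markAt_iff.2 ⟨p, rfl, rfl, rfl⟩)
        (Pos.lab_eq_none.1 hp) rfl)
    -- The two sides of a ribbon are the same step with its two ends interchanged.
    · have key (p q : Pos G.circles) (hpq : p ≠ q) (hp : p.lab A = some e) (hq : q.lab A = some e) :
          tipOf p.dir (g p.1 p.2.castSucc) (g p.1 p.2.succ) =
            tipOf q.dir (g q.1 q.2.succ) (g q.1 q.2.castSucc) := by
        rw [Pos.lab_eq_some] at hp hq
        have : g p.1 (tipOf p.dir p.2.castSucc p.2.succ) =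
            g q.1 (tipOf q.dir q.2.succ q.2.castSucc) := step ⟨p.1, tipOf p.dir p.2.castSucc p.2.succ⟩
          ⟨q.1, tipOf q.dir q.2.succ q.2.castSucc⟩ (.side _ _ e hp.1 p.1.1 p.2.1 p.dir q.1.1 q.2.1 q.dir
            (pos_ne_iff.1 hpq) (markAt_iff.2 ⟨p, rfl, rfl, hp.2⟩) (markAt_iff.2 ⟨q, rfl, rfl, hq.2⟩)
            (by cases p.dir <;> rfl) (by cases q.dir <;> rfl))
        rwa [apply_tipOf (g p.1), apply_tipOf (g q.1)] at this
      exact ⟨key p q hpq hp hq, (key q p hpq.symm hq hp).symm⟩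

theorem card_quot_fun {α : Type*} [Finite α] (r : α → α → Prop) :
    Nat.card {f : α → Fin 2 // ∀ p q, r p q → f p = f q} = 2 ^ Nat.card (Quot r) := by
  have h : Nat.card (Quot r → Fin 2) = 2 ^ Nat.card (Quot r) := by rw [Nat.card_fun]; simp
  rw [← h]
  exact Nat.card_congr
    { toFun := fun f => Quot.lift f.1 f.2
      invFun := fun f => ⟨fun p => f (Quot.mk _ p), fun p q h => congrArg f (Quot.sound h)⟩
      left_inv := fun f => rfl
      right_inv := fun f => funext fun x => by induction x using Quot.ind; rfl }

theorem Z_boundaryModel (G : HERG) (A : Finset ℕ) :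
    boundaryModel.Z A G.circles = 2 ^ G.numBdry A := by
  rw [StateModel.Z_eq_card SideCond
    (fun _ _ _ _ _ _ h => (boundaryModel_sum ..).trans (if_pos h))
    (fun _ _ _ _ _ _ h => (boundaryModel_sum ..).trans (if_neg h)) G.twice,
    Nat.card_congr (G.colouringEquiv.subtypeEquiv
      (q := fun f => ∀ p q, G.BdryStep A p q → f p = f q) fun g => good_iff A g), card_quot_fun]
  simp [numBdry, BdryCircle]

/-- The condition on the colours of the circles. -/
def CircleGood (b : Bool) (G : HERG) (A : Finset ℕ) (x : Fin G.circles.length → Fin 2) : Prop :=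
  ∀ (p q : Pos G.circles) (e : ℕ), p ≠ q → p.lab A = some e → q.lab A = some e →
    ((p.dir && b) ^^ decide (x p.1 = 1)) = ((q.dir && b) ^^ decide (x q.1 = 1))

/-- Diagonal matrices do not let the colour change at a mark, so a colouring of arcs amounts to one
of circles. -/
theorem good_eq {b : Bool} {A : Finset ℕ} {g : ArcColouring G.circles}
    (h : StateModel.Good (SignCond b) A g) (i : Fin G.circles.length)
    (j : Fin (G.circles[i.1].length + 1)) : g i j = g i 0 := by
  induction j using Fin.induction with
  | zero => rfl
  | succ j ih =>
    rw [← ih]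
    let p : Pos G.circles := ⟨i, j⟩
    rcases hl : p.lab A with _ | e
    · exact (h.free p hl).symm
    · obtain ⟨q, hpq, hq, -⟩ := StateModel.exists_pair G.twice p hl
      exact (h.edge p q e hpq hl hq).1.symm

theorem Z_signModel (b : Bool) (G : HERG) (A : Finset ℕ) :
    (signModel b).Z A G.circles = Nat.card {x // CircleGood b G A x} := by
  rw [StateModel.Z_eq_card (SignCond b)
    (fun _ _ _ _ _ _ h => (signModel_sum ..).trans (if_pos h))
    (fun _ _ _ _ _ _ h => (signModel_sum ..).trans (if_neg h)) G.twice]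
  congr 1
  refine Nat.card_congr
    { toFun := fun g => ⟨fun i => g.1 i 0, fun p q e hpq hp hq => ?_⟩
      invFun := fun x => ⟨fun i _ => x.1 i, fun _ => rfl, fun _ _ => rfl, fun p q e hpq hp hq =>
        ⟨rfl, rfl, x.2 p q e hpq hp hq⟩⟩
      left_inv := fun g => Subtype.ext (funext fun i => funext fun j => (good_eq g.2 i j).symm)
      right_inv := fun x => rfl }
  have := (g.2.edge p q e hpq hp hq).2.2
  rwa [good_eq g.2 p.1 p.2.castSucc, good_eq g.2 q.1 q.2.castSucc] at this

theorem decide_eq_one_inj {a b : Fin 2} : decide (a = 1) = decide (b = 1) ↔ a = b := by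
  revert a b; decide

theorem Z_comps (G : HERG) (A : Finset ℕ) :
    (signModel false).Z A G.circles = 2 ^ G.comps A := by
  rw [Z_signModel, comps, show ∀ n : ℕ, (2 : ℚ) ^ n = ((2 ^ n : ℕ) : ℚ) by simp, ← card_quot_fun]
  congr 1
  refine Nat.card_congr (Equiv.subtypeEquivRight fun x => ?_)
  simp only [CircleGood, Bool.and_false, Bool.false_xor, decide_eq_one_inj]
  constructor
  · rintro h u v ⟨e, he, ⟨d, hu⟩, ⟨d', hv⟩⟩
    obtain ⟨j, hj, hju⟩ := List.getElem_of_mem hu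
    obtain ⟨k, hk, hkv⟩ := List.getElem_of_mem hv
    by_cases huv : u = v
    · rw [huv]
    refine h ⟨u, ⟨j, hj⟩⟩ ⟨v, ⟨k, hk⟩⟩ e (fun h => huv (congrArg Sigma.fst h)) ?_ ?_
    · exact Pos.lab_eq_some.2 ⟨he, by
      have : Pos.mark (L := G.circles) ⟨u, ⟨j, hj⟩⟩ = some (e, d) := hju
      simp [Pos.dir, this]⟩
    · exact Pos.lab_eq_some.2 ⟨he, by
      have : Pos.mark (L := G.circles) ⟨v, ⟨k, hk⟩⟩ = some (e, d') := hkv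
      simp [Pos.dir, this]⟩
  · intro h p q e _ hp hq
    rw [Pos.lab_eq_some] at hp hq
    refine h _ _ ⟨e, hp.1, ⟨p.dir, ?_⟩, ⟨q.dir, ?_⟩⟩
    · rw [← hp.2]; exact List.getElem_mem p.2.2
    · rw [← hq.2]; exact List.getElem_mem q.2.2

theorem orientable_iff {A : Finset ℕ} : G.Orientable A ↔ ∃ x, CircleGood true G A x := by
  simp only [CircleGood, Bool.and_true]
  constructor
  · rintro ⟨o, ho⟩
    refine ⟨fun i => if o i then 1 else 0, fun p q e _ hp hq => ?_⟩
    rw [Pos.lab_eq_some] at hp hq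
    have := ho e hp.1 _ _ _ _ _ _ (markAt_iff.2 ⟨p, rfl, rfl, hp.2⟩) (markAt_iff.2 ⟨q, rfl, rfl, hq.2⟩)
    cases h1 : o p.1 <;> cases h2 : o q.1 <;> simpa [h1, h2] using this
  · rintro ⟨x, hx⟩
    -- No mark lies on a circle with index out of range, so the value `true` there is arbitrary.
    refine ⟨fun i => if h : i < G.circles.length then decide (x ⟨i, h⟩ = 1) else true, ?_⟩
    intro e he i j d i' j' d' hm hm'
    obtain ⟨p, rfl, rfl, hp⟩ := markAt_iff.1 hm
    obtain ⟨q, rfl, rfl, hq⟩ := markAt_iff.1 hm'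
    have hd : p.dir = d := by simp [Pos.dir, hp]
    have hd' : q.dir = d' := by simp [Pos.dir, hq]
    simp only [p.1.2, q.1.2, dif_pos]
    by_cases hpq : p = q
    · subst hpq
      rw [← hd, ← hd']
    · rw [← hd, ← hd']
      exact hx p q e hpq (Pos.lab_eq_some.2 ⟨he, by rw [hp, hd]⟩)
        (Pos.lab_eq_some.2 ⟨he, by rw [hq, hd']⟩)

theorem xor_shift (a b a' b' : Fin 2) (d d' : Bool)
    (h : (d ^^ decide (a' = 1)) = (d' ^^ decide (b' = 1))) :
    (d ^^ decide (a = 1)) = (d' ^^ decide (b = 1)) ↔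
      (false ^^ decide (a + a' = 1)) = (false ^^ decide (b + b' = 1)) := by
  revert a b a' b' d d'
  decide

theorem Z_orient (G : HERG) (A : Finset ℕ) :
    (signModel true).Z A G.circles = if G.nonor A = 0 then 2 ^ G.comps A else 0 := by
  unfold nonor
  by_cases h : G.Orientable A
  · rw [if_pos h, if_pos rfl, ← Z_comps, Z_signModel, Z_signModel]
    obtain ⟨y, hy⟩ := orientable_iff.1 h
    congr 1
    -- The orientations form a torsor under the colourings constant on components: adding one fixed
    -- orientation `y` removes the directions from the condition.
    refine Nat.card_congr (Equiv.subtypeEquiv (Equiv.addRight y) fun x => ?_)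
    refine forall_congr' fun p => forall_congr' fun q => forall_congr' fun e =>
      forall_congr' fun hpq => forall_congr' fun hp => forall_congr' fun hq => ?_
    have := hy p q e hpq hp hq
    simp only [Bool.and_true, Bool.and_false, Equiv.coe_addRight, Pi.add_apply] at this ⊢
    exact xor_shift _ _ _ _ _ _ this
  · rw [if_neg h, if_neg one_ne_zero, Z_signModel]
    have : IsEmpty {x // CircleGood true G A x} := ⟨fun x => h (orientable_iff.2 ⟨x.1, x.2⟩)⟩
    simp

end HERG

/-! ### Invariants from state sums -/

namespace HERG

theorem numFint_add_numBdryComps (G : HERG) (A : Finset ℕ) :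
    G.numFint A + G.numBdryComps A = G.numBdry A := by
  classical
  unfold numFint numBdryComps numBdry
  rw [← Nat.card_sum]
  exact Nat.card_congr ((Equiv.sumComm _ _).trans
    (Equiv.sumCompl fun f : G.BdryCircle A => f.IsOpen))

theorem nonor_le_one (G : HERG) (A : Finset ℕ) : G.nonor A ≤ 1 := by
  unfold nonor; split_ifs <;> simp

theorem two_pow_inj {a b : ℕ} (h : (2 : ℚ) ^ a = 2 ^ b) : a = b :=
  Nat.pow_right_injective le_rfl (by exact_mod_cast h)

/-- How the topological invariants behave if the state sums are multiplicative. -/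
theorem invariants_mul {G H K : HERG} {A B C : Finset ℕ} {n : ℕ}
    (h : ∀ m : StateModel, 2 ^ n * m.Z C K.circles = m.Z A G.circles * m.Z B H.circles) :
    n + K.comps C = G.comps A + H.comps B ∧ n + K.numBdry C = G.numBdry A + H.numBdry B ∧
      K.nonor C = max (G.nonor A) (H.nonor B) := by
  have h1 := h (signModel false)
  have h2 := h boundaryModel
  have h3 := h (signModel true)
  simp only [Z_comps, Z_boundaryModel, Z_orient, ← pow_add] at h1 h2 h3
  refine ⟨two_pow_inj h1, two_pow_inj h2, ?_⟩
  have hG := G.nonor_le_one A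
  have hH := H.nonor_le_one B
  have hK := K.nonor_le_one C
  have p1 : (2 : ℚ) ^ n * 2 ^ K.comps C ≠ 0 := by positivity
  have p2 : (2 : ℚ) ^ G.comps A * 2 ^ H.comps B ≠ 0 := by positivity
  by_cases a1 : G.nonor A = 0 <;> by_cases a2 : H.nonor B = 0 <;> by_cases a3 : K.nonor C = 0 <;>
    simp only [a1, a2, a3, if_true, if_false, mul_zero, zero_mul] at h3 p1 p2
  all_goals first
    | exact absurd h3 p1
    | exact absurd h3.symm p2
    | omega

theorem invariants_double {G H : HERG} {A B : Finset ℕ}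
    (h : ∀ m : StateModel, m.Z A G.circles = 2 * m.Z B H.circles) :
    G.comps A = H.comps B + 1 ∧ G.numBdry A = H.numBdry B + 1 ∧ G.nonor A = H.nonor B := by
  have h1 := h (signModel false)
  have h2 := h boundaryModel
  have h3 := h (signModel true)
  simp only [Z_comps, Z_boundaryModel, Z_orient] at h1 h2 h3
  refine ⟨two_pow_inj (by rw [h1, pow_succ']), two_pow_inj (by rw [h2, pow_succ']), ?_⟩
  have hG := G.nonor_le_one A
  have hH := H.nonor_le_one B
  have p1 : (2 : ℚ) ^ G.comps A ≠ 0 := by positivity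
  have p2 : (2 : ℚ) * 2 ^ H.comps B ≠ 0 := by positivity
  by_cases a1 : G.nonor A = 0 <;> by_cases a2 : H.nonor B = 0 <;>
    simp only [a1, a2, if_true, if_false, mul_zero] at h3
  all_goals first
    | omega
    | exact absurd h3 p1
    | exact absurd h3.symm p2

theorem invariants_eq {G H : HERG} {A B : Finset ℕ}
    (h : ∀ m : StateModel, m.Z A G.circles = m.Z B H.circles) :
    G.comps A = H.comps B ∧ G.numBdry A = H.numBdry B ∧ G.nonor A = H.nonor B := by
  have h1 := h (signModel false)
  have h2 := h boundaryModel
  have h3 := h (signModel true)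
  simp only [Z_comps, Z_boundaryModel, Z_orient] at h1 h2 h3
  refine ⟨two_pow_inj h1, two_pow_inj h2, ?_⟩
  have hG := G.nonor_le_one A
  have hH := H.nonor_le_one B
  have p1 : (2 : ℚ) ^ G.comps A ≠ 0 := by positivity
  have p2 : (2 : ℚ) ^ H.comps B ≠ 0 := by positivity
  by_cases a1 : G.nonor A = 0 <;> by_cases a2 : H.nonor B = 0 <;>
    simp only [a1, a2, if_true, if_false] at h3
  all_goals first
    | omega
    | exact absurd h3 p1
    | exact absurd h3.symm p2

end HERG

/-! ### Presentations of the same graph with the same edge labels -/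

/-- Moves between arrow presentations that preserve edge labels. -/
inductive PlainStep : List (List Mark) → List (List Mark) → Prop
  | perm {L L' : List (List Mark)} (h : L.Perm L') : PlainStep L L'
  | rotate (a b : List Mark) (L : List (List Mark)) : PlainStep ((a ++ b) :: L) ((b ++ a) :: L)
  | reverse (c : List Mark) (L : List (List Mark)) : PlainStep (c :: L) (flipWord c :: L)

theorem PlainStep.move {L L' : List (List Mark)} (h : PlainStep L L') : HERGMove L L' := by
  cases h with
  | perm h => exact .perm h
  | rotate a b L => exact .rotate a b L
  | reverse c L => exact .reverse c L

theorem PlainStep.edgeLabels_perm {L L' : List (List Mark)} (h : PlainStep L L') :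
    (edgeLabels L).Perm (edgeLabels L') := by
  cases h with
  | perm h => exact _root_.edgeLabels_perm h
  | rotate a b L => simpa using List.perm_append_comm_assoc _ _ _
  | reverse c L =>
    rw [edgeLabels_cons, edgeLabels_cons, labels_flipWord]
    exact (List.reverse_perm _).symm.append_right _

theorem PlainStep.Z_eq {L L' : List (List Mark)} (h : PlainStep L L') (m : StateModel)
    (A : Finset ℕ) : m.Z A L = m.Z A L' := by
  cases h with
  | perm h => exact StateModel.Z_perm h
  | rotate a b L => exact StateModel.Z_rotate a b L
  | reverse c L => exact StateModel.Z_reverse c L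

theorem PlainStep.length_eq {L L' : List (List Mark)} (h : PlainStep L L') :
    L.length = L'.length := by
  cases h with
  | perm h => exact h.length_eq
  | rotate a b L => rfl
  | reverse c L => rfl

/-- `H` is another presentation of `G` with the same edge labels. -/
structure SameGraph (G H : HERG) : Prop where
  cls : G.cls = H.cls
  labels : (edgeLabels G.circles).Perm (edgeLabels H.circles)
  Z : ∀ (m : StateModel) (A : Finset ℕ), m.Z A G.circles = m.Z A H.circles
  length : G.circles.length = H.circles.length

theorem SameGraph.trans {G H K : HERG} (h : SameGraph G H) (h' : SameGraph H K) : SameGraph G K :=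
  ⟨h.cls.trans h'.cls, h.labels.trans h'.labels, fun m A => (h.Z m A).trans (h'.Z m A),
    h.length.trans h'.length⟩

theorem SameGraph.step {G : HERG} {L : List (List Mark)} (h : PlainStep G.circles L) :
    ∃ H : HERG, SameGraph G H ∧ H.circles = L :=
  ⟨⟨L, h.move.twice G.twice⟩, ⟨HERG.cls_eq h.move, h.edgeLabels_perm, h.Z_eq, h.length_eq⟩, rfl⟩

namespace HERG

theorem mem_edges {G : HERG} {e : ℕ} : e ∈ G.edges ↔ e ∈ edgeLabels G.circles := List.mem_toFinset

/-- An end of `e` can be put first. -/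
theorem exists_first {G : HERG} {e : ℕ} {c : List Mark} {L : List (List Mark)}
    (h : G.circles.Perm (c :: L)) (he : e ∈ labels c) :
    ∃ (d : Bool) (a : List Mark) (H : HERG), SameGraph G H ∧ H.circles = (some (e, d) :: a) :: L ∧
      (e :: labels a).Perm (labels c) := by
  obtain ⟨H, hH, hc⟩ := SameGraph.step (.perm h)
  obtain ⟨d, x, y, rfl⟩ := exists_split he
  obtain ⟨K, hK, hk⟩ := SameGraph.step (G := H) (by rw [hc]; exact .rotate x (some (e, d) :: y) L)
  exact ⟨d, y ++ x, K, hH.trans hK, by simpa using hk, by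
    simpa using List.perm_append_comm (l₁ := e :: labels y) (l₂ := labels x)⟩

/-- Normal form of a presentation at a non-loop edge. -/
theorem exists_contractible {G : HERG} {e : ℕ} (he : e ∈ G.edges) (hl : ¬ G.IsLoop e) :
    ∃ (d : Bool) (a b : List Mark) (L : List (List Mark)) (H : HERG), SameGraph G H ∧
      H.circles = (some (e, d) :: a) :: (some (e, d) :: b) :: L := by
  obtain ⟨c, hc, hec⟩ := mem_edgeLabels.1 (mem_edges.1 he)
  obtain ⟨L, hL⟩ : ∃ L, G.circles.Perm (c :: L) := ⟨_, List.perm_cons_erase hc⟩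
  obtain ⟨d, a, H, hGH, hH, hp⟩ := exists_first hL hec
  have hcount : (labels c).count e = 1 := by
    have h2 := G.twice e (mem_edges.1 he)
    rw [(edgeLabels_perm hL).count_eq, edgeLabels_cons, List.count_append] at h2
    have h1 : (labels c).count e ≠ 2 := fun h => hl ⟨c, hc, by simpa using h⟩
    have := List.count_pos_iff.2 hec
    omega
  have heL : e ∈ edgeLabels L := by
    have h2 := G.twice e (mem_edges.1 he)
    rw [(edgeLabels_perm hL).count_eq, edgeLabels_cons, List.count_append] at h2
    rw [← List.count_pos_iff]; omega
  obtain ⟨c', hc', hec'⟩ := mem_edgeLabels.1 heL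
  have hL' : H.circles.Perm (c' :: (some (e, d) :: a) :: L.erase c') := by
    rw [hH]
    exact ((List.perm_cons_erase hc').cons _).trans (.swap _ _ _)
  obtain ⟨d', b, K, hHK, hK, hp'⟩ := exists_first hL' hec'
  have key : ∃ (b : List Mark) (K : HERG), SameGraph G K ∧
      K.circles = (some (e, d) :: b) :: (some (e, d) :: a) :: L.erase c' := by
    -- If the two arrows disagree, reversing the second circle turns its arrow but puts it last, and
    -- a rotation brings it back to the front.
    by_cases hd : d' = d
    · subst hd; exact ⟨b, K, hGH.trans hHK, hK⟩
    · obtain ⟨K', hK', hk'⟩ := SameGraph.step (G := K) (by rw [hK]; exact .reverse _ _)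
      obtain ⟨K'', hK'', hk''⟩ := SameGraph.step (G := K') (by
        rw [hk', flipWord_cons]; exact .rotate _ _ _)
      refine ⟨flipWord b, K'', (hGH.trans hHK).trans (hK'.trans hK''), ?_⟩
      have : (!d') = d := by cases d <;> cases d' <;> simp_all
      rw [hk'']
      simp [this]
  obtain ⟨b, K, hK, hk⟩ := key
  exact ⟨d, b, a, _, K, hK, hk⟩

/-- The labels at an end of a contractible edge. -/
theorem not_mem_of_contractible {G : HERG} {e : ℕ} {d d' : Bool} {a b : List Mark} {L : List (List Mark)}
    (h : G.circles = (some (e, d) :: a) :: (some (e, d') :: b) :: L) :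
    e ∉ labels a ∧ e ∉ labels b ∧ e ∉ edgeLabels L := by
  have h2 := G.twice e (by simp [h])
  rw [h] at h2
  simp only [edgeLabels_cons, labels_cons_some, List.count_append, List.count_cons_self] at h2
  refine ⟨?_, ?_, ?_⟩ <;> rw [← List.count_eq_zero] <;> omega

/-- The contraction of a contractible edge. -/
def contraction (G : HERG) {e : ℕ} {d : Bool} {a b : List Mark} {L : List (List Mark)}
    (h : G.circles = (some (e, d) :: a) :: (some (e, d) :: b) :: L) : HERG where
  circles := (a ++ b) :: L
  two := by
    obtain ⟨ha, hb, hL⟩ := not_mem_of_contractible h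
    have h2 := G.twice
    rw [h] at h2
    refine Twice.right (l := [e, e]) ?_ ?_
    · refine h2.of_perm ?_
      simp only [edgeLabels_cons, labels_cons_some, labels_append, List.cons_append,
        List.nil_append, List.append_assoc]
      exact List.Perm.cons _ List.perm_middle
    · intro f hf; simp at hf; simp [hf]

theorem edges_contraction (G : HERG) {e : ℕ} {d : Bool} {a b : List Mark} {L : List (List Mark)}
    (h : G.circles = (some (e, d) :: a) :: (some (e, d) :: b) :: L) :
    (G.contraction h).edges = G.edges.erase e := by
  obtain ⟨ha, hb, hL⟩ := not_mem_of_contractible h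
  ext f
  simp only [mem_edges, Finset.mem_erase, contraction, h, edgeLabels_cons, labels_append,
    labels_cons_some, List.mem_append, List.mem_cons]
  constructor
  · intro hf
    refine ⟨?_, by tauto⟩
    rintro rfl
    tauto
  · tauto

theorem Z_contraction (G : HERG) {e : ℕ} {d : Bool} {a b : List Mark} {L : List (List Mark)}
    (h : G.circles = (some (e, d) :: a) :: (some (e, d) :: b) :: L) (m : StateModel) {A : Finset ℕ}
    (he : e ∉ A) : m.Z (insert e A) G.circles = m.Z A (G.contraction h).circles := by
  obtain ⟨ha, hb, hL⟩ := not_mem_of_contractible h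
  rw [h]
  exact StateModel.Z_contract he d ha hb hL

/-! ### Bounds -/

theorem comps_le (G : HERG) (A : Finset ℕ) : G.comps A ≤ G.numVert := by
  unfold comps numVert
  exact (Nat.card_le_card_of_surjective _ Quot.mk_surjective).trans (by simp)

theorem comps_anti (G : HERG) {A B : Finset ℕ} (h : A ⊆ B) : G.comps B ≤ G.comps A :=
  Nat.card_le_card_of_surjective
    (Quot.map id fun _ _ ⟨e, he, h'⟩ => ⟨e, h he, h'⟩)
    (fun x => by induction x using Quot.ind with | mk a => exact ⟨Quot.mk _ a, rfl⟩)

theorem IsLoop.eq {G : HERG} {e : ℕ} (h : G.IsLoop e) {u v : Fin G.circles.length}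
    (hu : e ∈ labels G.circles[u]) (hv : e ∈ labels G.circles[v]) : u = v := by
  obtain ⟨c, hc, hcount⟩ := h
  rw [edgeLabels_cons, edgeLabels_nil, List.append_nil] at hcount
  obtain ⟨i, hi, rfl⟩ := List.getElem_of_mem hc
  have h2 := G.twice e (mem_edgeLabels.2 ⟨_, hc, List.count_pos_iff.1 (by omega)⟩)
  have h3 (L : List (List Mark)) : (edgeLabels L).count e =
      ∑ j : Fin L.length, (labels L[j.1]).count e := by
    rw [Fin.sum_univ_fun_getElem L fun c => (labels c).count e]
    induction L with
    | nil => rfl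
    | cons c L ih => simp [ih]
  rw [h3] at h2
  have key (j : Fin G.circles.length) (hj : e ∈ labels G.circles[j]) : j = ⟨i, hi⟩ := by
    by_contra hne
    have := Finset.sum_le_sum_of_subset (f := fun j : Fin G.circles.length =>
      (labels G.circles[j.1]).count e) (Finset.subset_univ {j, ⟨i, hi⟩})
    rw [Finset.sum_pair hne, h2] at this
    have h4 := List.count_pos_iff.2 hj
    have h5 : (labels G.circles[(⟨i, hi⟩ : Fin G.circles.length).1]).count e = 2 := hcount
    simp only [Fin.getElem_fin] at h4
    omega
  rw [key u hu, key v hv]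

theorem comps_of_loops {G : HERG} {A : Finset ℕ} (h : ∀ e ∈ A, e ∈ G.edges → G.IsLoop e) :
    G.comps A = G.numVert := by
  unfold comps numVert
  refine Eq.trans ?_ (Nat.card_fin G.circles.length)
  refine Nat.card_congr (Equiv.ofBijective (Quot.mk _) ⟨?_, Quot.mk_surjective⟩).symm
  intro u v huv
  refine congrArg (Quot.lift id ?_) huv
  rintro a b ⟨e, he, ⟨d, ha⟩, ⟨d', hb⟩⟩
  have ha := mem_labels.2 ⟨d, ha⟩
  have hb := mem_labels.2 ⟨d', hb⟩
  exact (h e he (mem_edges.2 (mem_edgeLabels.2 ⟨_, List.getElem_mem a.2, ha⟩))).eq ha hb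

/-- The four weights have absolute value one half, so each edge costs a factor two. -/
theorem abs_avg_le (A : Finset ℕ) {f : (ℕ → boundaryModel.Φ) → ℚ} {b : ℚ} (hf : ∀ φ, |f φ| ≤ b) :
    |boundaryModel.avg A f| ≤ 2 ^ A.card * b := by
  induction A using Finset.induction_on generalizing f with
  | empty => simpa [StateModel.avg_empty] using hf default
  | insert a A ha ih =>
    rw [StateModel.avg_insert _ ha, Finset.card_insert_of_notMem ha]
    refine (Finset.abs_sum_le_sum_abs _ _).trans ?_
    have : ∑ x, |boundaryModel.w x| = 2 := by
      change ∑ x : Fin 4, _ = _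
      simp [Fin.sum_univ_four, boundaryModel]; norm_num
    calc _ ≤ ∑ x, |boundaryModel.w x| * (2 ^ A.card * b) := by
          refine Finset.sum_le_sum fun x _ => ?_
          rw [abs_mul]
          exact mul_le_mul_of_nonneg_left (ih fun φ => hf _) (abs_nonneg _)
      _ = _ := by rw [← Finset.sum_mul, this]; ring

/-- All factors are signed permutation matrices, so rows keep absolute sum at most one and the trace
is at most two. -/
theorem abs_trace_word_le (A : Finset ℕ) (φ : ℕ → boundaryModel.Φ) (c : List Mark) :
    |(boundaryModel.word A φ c).trace| ≤ 2 := by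
  have key : ∀ i, |boundaryModel.word A φ c i 0| + |boundaryModel.word A φ c i 1| ≤ 1 := by
    induction c with
    | nil => intro i; fin_cases i <;> simp
    | cons k c ih =>
      have hk : ∀ i, |boundaryModel.mark A φ k i 0| + |boundaryModel.mark A φ k i 1| ≤ 1 := by
        rcases k with _ | ⟨e, d⟩
        · intro i; fin_cases i <;> simp
        · by_cases he : e ∈ A
          · simp only [StateModel.mark, he, if_true]
            generalize φ e = x
            change Fin 4 at x
            intro i
            fin_cases x <;> fin_cases i <;> cases d <;> simp [boundaryModel, pauli]
          · simp only [StateModel.mark, he, if_false]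
            intro i; fin_cases i <;> simp [Matrix.one_apply]
      intro i
      rw [StateModel.word_cons, Matrix.mul_apply, Matrix.mul_apply, Fin.sum_univ_two, Fin.sum_univ_two]
      generalize boundaryModel.word A φ c = w at *
      generalize boundaryModel.mark A φ k = p at *
      have h0 := mul_le_mul_of_nonneg_left (ih 0) (abs_nonneg (p i 0))
      have h1 := mul_le_mul_of_nonneg_left (ih 1) (abs_nonneg (p i 1))
      have a0 := abs_add_le (p i 0 * w 0 0) (p i 1 * w 1 0)
      have a1 := abs_add_le (p i 0 * w 0 1) (p i 1 * w 1 1)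
      simp only [abs_mul] at a0 a1
      linarith [hk i]
  rw [Matrix.trace_fin_two]
  have h0 := key 0
  have h1 := key 1
  have := abs_nonneg (boundaryModel.word A φ c 0 1)
  have := abs_nonneg (boundaryModel.word A φ c 1 0)
  linarith [abs_add_le (boundaryModel.word A φ c 0 0) (boundaryModel.word A φ c 1 1)]

theorem numBdry_le (G : HERG) (A : Finset ℕ) : G.numBdry A ≤ A.card + G.numVert := by
  have h : |boundaryModel.Z A G.circles| ≤ 2 ^ A.card * 2 ^ G.numVert := by
    refine abs_avg_le A fun φ => ?_
    unfold numVert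
    generalize G.circles = L
    induction L with
    | nil => simp
    | cons c L ih =>
      rw [StateModel.circ_cons, abs_mul, List.length_cons, pow_succ']
      exact mul_le_mul (abs_trace_word_le A φ c) ih (abs_nonneg _) (by norm_num)
  rw [Z_boundaryModel, abs_of_nonneg (by positivity), ← pow_add] at h
  exact (pow_le_pow_iff_right₀ (by norm_num)).1 h

/-- Together these show that the natural subtractions in rank, nullity and the exponent of `Z` never
truncate; the second expresses that the Euler genus is nonnegative. Contracting a non-loop lowers
`A.card` and the number of vertices by one and preserves the rest. Once only loops remain,
components are vertices and `numBdry_le` suffices. -/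
theorem bounds (n : ℕ) : ∀ (G : HERG) (A : Finset ℕ), A.card = n →
    G.numVert ≤ G.comps A + A.card ∧ G.numBdry A + G.numVert ≤ A.card + 2 * G.comps A := by
  induction n with
  | zero =>
    intro G A hA
    obtain rfl := Finset.card_eq_zero.1 hA
    have h1 := G.comps_of_loops (A := ∅) (by simp)
    have h2 := G.numBdry_le ∅
    simp only [Finset.card_empty] at *
    omega
  | succ n ih =>
    intro G A hA
    by_cases h : ∀ e ∈ A, e ∈ G.edges → G.IsLoop e
    · have h1 := comps_of_loops h
      have h2 := G.numBdry_le A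
      omega
    · push Not at h
      obtain ⟨e, heA, he, hl⟩ := h
      obtain ⟨d, a, b, L, H, hGH, hH⟩ := exists_contractible he hl
      obtain ⟨k1, k2, -⟩ := invariants_eq (A := A) (B := A) fun m => hGH.Z m A
      have hZ (m : StateModel) := H.Z_contraction hH m (A.notMem_erase e)
      obtain ⟨k3, k4, -⟩ := invariants_eq hZ
      rw [Finset.insert_erase heA] at k3 k4
      have hc := Finset.card_erase_of_mem heA
      obtain ⟨i1, i2⟩ := ih (H.contraction hH) (A.erase e) (by omega)
      have hv : G.numVert = (H.contraction hH).numVert + 1 := by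
        unfold numVert; rw [hGH.length, hH]; rfl
      omega

theorem rk_add_comps (G : HERG) (A : Finset ℕ) : G.rk A + G.comps A = G.numVert := by
  have := G.comps_le A
  unfold rk; omega

theorem nullity_add_rk (G : HERG) (A : Finset ℕ) : G.nullity A + G.rk A = A.card := by
  have := (bounds _ G A rfl).1
  have := G.rk_add_comps A
  unfold nullity; omega

theorem numBdry_le_comps_add_nullity (G : HERG) (A : Finset ℕ) :
    G.numBdry A ≤ G.comps A + G.nullity A := by
  have := (bounds _ G A rfl).2
  have := G.rk_add_comps A
  have := G.nullity_add_rk A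
  omega

theorem rk_mono (G : HERG) {A B : Finset ℕ} (h : A ⊆ B) : G.rk A ≤ G.rk B := by
  have := G.comps_anti h
  unfold rk; omega

end HERG

/-! ### The weighted polynomial -/

/-- Parameters of the weighted polynomial. -/
structure Params (R : Type*) where
  α : R
  T : R
  B : R
  σ : R
  C : R
  D : R
  Z : R
  W : R

namespace HERG

variable {R : Type*} [CommRing R] (c : Params R)

/-- The contribution of a spanning subgraph. -/
noncomputable def summand (G : HERG) (A : Finset ℕ) : R :=
  c.B ^ (G.rk G.edges - G.rk A) * c.σ ^ G.rk A * c.C ^ G.nullity A * c.D ^ (G.edges \ A).card *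
    c.Z ^ (G.comps A + G.nullity A - G.numBdry A) * c.W ^ G.nonor A

/-- A common generalization of the polynomials of Bollobás and Riordan. -/
noncomputable def poly (G : HERG) : R :=
  c.α ^ G.comps G.edges * c.T ^ G.numHR * ∑ A ∈ G.edges.powerset, G.summand c A

variable {c}

theorem summand_congr {G H : HERG} {A B : Finset ℕ} (hv : G.numVert = H.numVert)
    (hE : G.comps G.edges = H.comps H.edges)
    (hAB : A.card = B.card) (hd : (G.edges \ A).card = (H.edges \ B).card)
    (h : G.comps A = H.comps B ∧ G.numBdry A = H.numBdry B ∧ G.nonor A = H.nonor B) :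
    G.summand c A = H.summand c B := by
  obtain ⟨h1, h2, h3⟩ := h
  simp only [summand, nullity, rk, hv, hE, hAB, hd, h1, h2, h3]

theorem numHR_eq (G : HERG) : G.numHR = (G.circles.map (List.count none)).sum := by
  unfold numHR
  rw [List.count_flatten]

theorem count_none_map {f : Mark → Mark} (hf : ∀ k, f k = none ↔ k = none) (w : List Mark) :
    (w.map f).count none = w.count none := by
  induction w with
  | nil => rfl
  | cons k w ih => simp [List.count_cons, ih, hf]

theorem flip_eq_none (k : Mark) : k.flip = none ↔ k = none := by
  simp [Mark.flip]

theorem turn_eq_none (e : ℕ) (k : Mark) : k.turn e = none ↔ k = none := by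
  simp [Mark.turn]

theorem relabel_eq_none (f : ℕ → ℕ) (k : Mark) : k.relabel f = none ↔ k = none := by
  simp [Mark.relabel]

theorem count_none_flipWord (w : List Mark) : (flipWord w).count none = w.count none := by
  rw [flipWord, List.count_reverse, count_none_map flip_eq_none]

theorem _root_.HERGMove.count_none {L L' : List (List Mark)} (h : HERGMove L L') :
    (L.map (List.count none)).sum = (L'.map (List.count none)).sum := by
  cases h with
  | perm h => exact (h.map _).sum_eq
  | rotate a b L => simp [add_comm]
  | reverse c L => simp [count_none_flipWord]
  | turn e L =>
    rw [List.map_map]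
    congr 1
    exact List.map_congr_left fun w _ => (count_none_map (turn_eq_none e) w).symm
  | relabel f L =>
    rw [List.map_map]
    congr 1
    exact List.map_congr_left fun w _ => (count_none_map (relabel_eq_none f) w).symm
  | slide a b L => simp; omega

theorem _root_.HERGMove.length_eq {L L' : List (List Mark)} (h : HERGMove L L') :
    L.length = L'.length := by
  cases h with
  | perm h => exact h.length_eq
  | turn e L => simp
  | relabel f L => simp
  | _ => rfl

theorem _root_.HERGMove.exists_perm {L L' : List (List Mark)} (h : HERGMove L L')
    (hL : Twice (edgeLabels L)) :
    ∃ f : Equiv.Perm ℕ, (edgeLabels L').toFinset = (edgeLabels L).toFinset.map f.toEmbedding ∧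
      ∀ (m : StateModel) (A : Finset ℕ), m.Z (A.map f.toEmbedding) L' = m.Z A L := by
  have plain (hp : (edgeLabels L).Perm (edgeLabels L')) (hZ : ∀ (m : StateModel) (A : Finset ℕ),
      m.Z A L' = m.Z A L) : ∃ f : Equiv.Perm ℕ, (edgeLabels L').toFinset =
        (edgeLabels L).toFinset.map f.toEmbedding ∧
      ∀ (m : StateModel) (A : Finset ℕ), m.Z (A.map f.toEmbedding) L' = m.Z A L := by
    have h1 (A : Finset ℕ) : A.map (Equiv.toEmbedding 1) = A := by
      ext; simp; rfl
    exact ⟨1, by rw [h1, List.toFinset_eq_of_perm _ _ hp], fun m A => by rw [h1, hZ]⟩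
  cases h with
  | perm h => exact plain (edgeLabels_perm h) fun m A => (StateModel.Z_perm h).symm
  | rotate a b L =>
    exact plain (PlainStep.rotate a b L).edgeLabels_perm fun m A => (StateModel.Z_rotate a b L).symm
  | reverse c L =>
    exact plain (PlainStep.reverse c L).edgeLabels_perm fun m A => (StateModel.Z_reverse c L).symm
  | turn e L =>
    exact plain (by rw [edgeLabels_map_turn]) fun m A => StateModel.Z_turn e hL
  | slide a b L =>
    exact plain (by simp) fun m A => (StateModel.Z_slide a b L).symm
  | relabel f L =>
    refine ⟨f, ?_, fun m A => StateModel.Z_relabel f L⟩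
    rw [edgeLabels_map_relabel]
    ext x
    simp only [List.mem_toFinset, List.mem_map, Finset.mem_map_equiv]
    exact ⟨by rintro ⟨a, ha, rfl⟩; simpa, fun h => ⟨_, h, by simp⟩⟩

/-- A move induces a renaming of edges that preserves all state sums, so the summands match along
it. -/
theorem poly_eq_of_move {G H : HERG} (h : HERGMove G.circles H.circles) : G.poly c = H.poly c := by
  obtain ⟨f, hE, hZ⟩ := h.exists_perm G.twice
  have hE : H.edges = G.edges.map f.toEmbedding := hE
  have hv : G.numVert = H.numVert := h.length_eq
  have hinv (A) := invariants_eq (G := G) (H := H) (A := A) (B := A.map f.toEmbedding)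
    fun m => (hZ m A).symm
  unfold poly
  rw [numHR_eq, numHR_eq, h.count_none, hE, (hinv _).1]
  congr 1
  refine Finset.sum_bij (fun A _ => A.map f.toEmbedding) ?_ ?_ ?_ ?_
  · intro A hA
    rw [Finset.mem_powerset] at hA ⊢
    exact Finset.map_subset_map.2 hA
  · intro A _ B _ h
    exact Finset.map_injective _ h
  · intro B hB
    rw [Finset.mem_powerset] at hB
    obtain ⟨A, hA, rfl⟩ := Finset.subset_map_iff.1 hB
    exact ⟨A, Finset.mem_powerset.2 hA, rfl⟩
  · intro A hA
    refine summand_congr hv (by rw [hE, (hinv _).1]) (by simp) ?_ (hinv A)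
    rw [hE, ← Finset.map_sdiff, Finset.card_map]

/-! Deletion -/

theorem labels_filter (e : ℕ) (w : List Mark) :
    labels (w.filter fun k => k.map Prod.fst ≠ some e) = (labels w).filter (fun f => f ≠ e) := by
  induction w with
  | nil => rfl
  | cons k w ih =>
    rcases k with _ | ⟨f, d⟩
    · simpa using ih
    · by_cases h : f = e
      · simpa [h] using ih
      · simpa [h] using ih

theorem labels_cut (e : ℕ) (w : List Mark) :
    labels (w.map fun k => if k.map Prod.fst = some e then none else k) =
      (labels w).filter (fun f => f ≠ e) := by
  induction w with
  | nil => rfl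
  | cons k w ih =>
    rcases k with _ | ⟨f, d⟩
    · simpa using ih
    · by_cases h : f = e
      · simpa [h] using ih
      · simpa [h] using ih

theorem edges_del (G : HERG) (e : ℕ) : (G.del e).edges = G.edges.erase e := by
  ext f
  simp only [mem_edges, del, Finset.mem_erase, mem_edgeLabels, List.mem_map]
  constructor
  · rintro ⟨_, ⟨w, hw, rfl⟩, hf⟩
    rw [labels_filter, List.mem_filter] at hf
    exact ⟨by simpa using hf.2, w, hw, hf.1⟩
  · rintro ⟨hne, w, hw, hf⟩
    exact ⟨_, ⟨w, hw, rfl⟩, by rw [labels_filter, List.mem_filter]; simpa using ⟨hf, hne⟩⟩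

theorem edges_cut (G : HERG) (e : ℕ) : (G.cut e).edges = G.edges.erase e := by
  ext f
  simp only [mem_edges, cut, Finset.mem_erase, mem_edgeLabels, List.mem_map]
  constructor
  · rintro ⟨_, ⟨w, hw, rfl⟩, hf⟩
    rw [labels_cut, List.mem_filter] at hf
    exact ⟨by simpa using hf.2, w, hw, hf.1⟩
  · rintro ⟨hne, w, hw, hf⟩
    exact ⟨_, ⟨w, hw, rfl⟩, by rw [labels_cut, List.mem_filter]; simpa using ⟨hf, hne⟩⟩

/-- An edge outside `A` is represented by identity matrices, so erasing its marks does no harm;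
`Z_cut` rests on the same fact. -/
theorem Z_del (G : HERG) {e : ℕ} {A : Finset ℕ} (he : e ∉ A) (m : StateModel) :
    m.Z A (G.del e).circles = m.Z A G.circles := by
  refine m.avg_congr fun φ => ?_
  simp only [StateModel.circ, del, List.map_map]
  congr 1
  refine List.map_congr_left fun w hw => ?_
  clear hw
  simp only [Function.comp_apply]
  congr 1
  induction w with
  | nil => rfl
  | cons k w ih =>
    by_cases h : k.map Prod.fst = some e
    · rw [List.filter_cons_of_neg (by simp [h]), ih, StateModel.word_cons]
      obtain ⟨⟨f, d⟩, rfl, rfl⟩ := Option.map_eq_some_iff.1 h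
      simp [StateModel.mark, he]
    · rw [List.filter_cons_of_pos (by simpa using h), StateModel.word_cons, ih, StateModel.word_cons]

theorem Z_cut (G : HERG) {e : ℕ} {A : Finset ℕ} (he : e ∉ A) (m : StateModel) :
    m.Z A (G.cut e).circles = m.Z A G.circles := by
  refine m.avg_congr fun φ => ?_
  simp only [StateModel.circ, cut, List.map_map]
  congr 1
  refine List.map_congr_left fun w _ => ?_
  simp only [Function.comp_apply, StateModel.word, List.map_map]
  congr 2
  refine List.map_congr_left fun k _ => ?_
  simp only [Function.comp_apply]
  split_ifs with h
  · obtain ⟨⟨f, d⟩, rfl, rfl⟩ := Option.map_eq_some_iff.1 h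
    simp [StateModel.mark, he]
  · rfl

theorem numVert_del (G : HERG) (e : ℕ) : (G.del e).numVert = G.numVert := by
  simp [numVert, del]

theorem numVert_cut (G : HERG) (e : ℕ) : (G.cut e).numVert = G.numVert := by
  simp [numVert, cut]

theorem numHR_del (G : HERG) (e : ℕ) : (G.del e).numHR = G.numHR := by
  rw [numHR_eq, numHR_eq, del, List.map_map]
  congr 1
  refine List.map_congr_left fun w _ => ?_
  rw [Function.comp_apply, List.count_filter (by simp)]

theorem numHR_cut (G : HERG) {e : ℕ} (he : e ∈ G.edges) : (G.cut e).numHR = G.numHR + 2 := by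
  -- The `2` is rewritten as the number of ends of `e`, which can be counted circle by circle.
  rw [← G.twice e (mem_edges.1 he), numHR_eq, numHR_eq, cut]
  dsimp only
  generalize G.circles = L
  induction L with
  | nil => rfl
  | cons w L ih =>
    have : (w.map fun k => if k.map Prod.fst = some e then none else k).count none =
        w.count none + (labels w).count e := by
      induction w with
      | nil => rfl
      | cons k w ih =>
        rcases k with _ | ⟨f, d⟩
        · simp only [List.map_cons, List.count_cons, ih, labels_cons_none]; simp; omega
        · by_cases h : f = e
          · simp only [List.map_cons, List.count_cons, ih, labels_cons_some]; simp [h]; omega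
          · simp only [List.map_cons, List.count_cons, ih, labels_cons_some]; simp [h]
    simp only [List.map_cons, List.sum_cons, ih, this, edgeLabels_cons, List.count_append]
    omega

/-- Cut and deletion have the same summands and differ only by two half-ribbons. -/
theorem poly_cut (G : HERG) {e : ℕ} (he : e ∈ G.edges) :
    (G.cut e).poly c = c.T ^ 2 * (G.del e).poly c := by
  have hinv {A : Finset ℕ} (hA : e ∉ A) := invariants_eq (G := G.cut e) (H := G.del e)
    (A := A) (B := A) fun m => (G.Z_cut hA m).trans (G.Z_del hA m).symm
  unfold poly
  rw [edges_cut, edges_del, (hinv (G.edges.notMem_erase e)).1, numHR_cut _ he, numHR_del,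
    Finset.sum_congr rfl fun A hA => summand_congr (B := A) (H := G.del e)
      ((G.numVert_cut e).trans (G.numVert_del e).symm) _ rfl _
      (hinv fun h => G.edges.notMem_erase e (Finset.mem_powerset.1 hA h))]
  · ring
  · rw [edges_cut, edges_del, (hinv (G.edges.notMem_erase e)).1]
    exact fun _ _ => rfl
  · intro A hA
    rw [edges_cut, edges_del]

/-- Splitting the sum according to the presence of an edge that is not a bridge. -/
theorem poly_split (G : HERG) {e : ℕ} (he : e ∈ G.edges) (hb : ¬ G.IsBridge e) :
    G.poly c = c.D * (G.del e).poly c + c.α ^ G.comps G.edges * c.T ^ G.numHR *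
      ∑ A ∈ (G.edges.erase e).powerset, G.summand c (insert e A) := by
  have hinv {A : Finset ℕ} (hA : e ∉ A) := invariants_eq (G := G) (H := G.del e)
    (A := A) (B := A) fun m => (G.Z_del hA m).symm
  have hk : G.comps G.edges = G.comps (G.edges.erase e) := by
    have h1 := G.comps_anti (G.edges.erase_subset e)
    have h2 : ¬ G.comps G.edges < G.comps (G.edges.erase e) := fun h => hb ⟨he, h⟩
    omega
  have hsum : ∑ A ∈ G.edges.powerset, G.summand c A =
      ∑ A ∈ (G.edges.erase e).powerset, G.summand c A +
        ∑ A ∈ (G.edges.erase e).powerset, G.summand c (insert e A) := by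
    conv_lhs => rw [← Finset.insert_erase he]
    exact Finset.sum_powerset_insert (G.edges.notMem_erase e) _
  have hterm : ∀ A ∈ (G.edges.erase e).powerset, G.summand c A = c.D * (G.del e).summand c A := by
    intro A hA
    have hA := Finset.mem_powerset.1 hA
    have heA : e ∉ A := fun h => G.edges.notMem_erase e (hA h)
    obtain ⟨h1, h2, h3⟩ := hinv heA
    have hd : (G.edges \ A).card = (G.edges.erase e \ A).card + 1 := by
      rw [Finset.erase_sdiff_comm, Finset.card_erase_add_one (by simp [he, heA])]
    have hr : G.rk G.edges = (G.del e).rk (G.edges.erase e) := by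
      unfold rk
      rw [hk, (hinv (G.edges.notMem_erase e)).1, numVert_del]
    have hrA : G.rk A = (G.del e).rk A := by
      unfold rk
      rw [h1, numVert_del]
    have hn : G.nullity A = (G.del e).nullity A := by
      unfold nullity; rw [hrA]
    unfold summand
    rw [edges_del, hd, hr, hrA, hn, h1, h2, h3, pow_succ]
    ring
  unfold poly
  rw [hsum, Finset.sum_congr rfl hterm, ← Finset.mul_sum, numHR_del, edges_del,
    ← (hinv (G.edges.notMem_erase e)).1, ← hk]
  ring

end HERG

/-! ### Recursive properties of the weighted polynomial -/

namespace HERG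

variable {R : Type*} [CommRing R] {c : Params R}

theorem numVert_contraction (G : HERG) {e : ℕ} {d : Bool} {a b : List Mark} {L : List (List Mark)}
    (h : G.circles = (some (e, d) :: a) :: (some (e, d) :: b) :: L) :
    G.numVert = (G.contraction h).numVert + 1 := by
  unfold numVert; rw [h]; rfl

theorem numHR_contraction (G : HERG) {e : ℕ} {d : Bool} {a b : List Mark} {L : List (List Mark)}
    (h : G.circles = (some (e, d) :: a) :: (some (e, d) :: b) :: L) :
    (G.contraction h).numHR = G.numHR := by
  rw [numHR_eq, numHR_eq, h]
  simp [contraction, add_assoc]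

theorem mem_edges_of_contractible {G : HERG} {e : ℕ} {d : Bool} {a b : List Mark}
    {L : List (List Mark)} (h : G.circles = (some (e, d) :: a) :: (some (e, d) :: b) :: L) :
    e ∈ G.edges := by
  simp [mem_edges, h]

/-- Contracting an edge of the subgraph preserves components, boundary, orientability and nullity,
and lowers its rank and the rank of the graph by one, whence one factor `σ`. -/
theorem summand_contraction (G : HERG) {e : ℕ} {d : Bool} {a b : List Mark} {L : List (List Mark)}
    (h : G.circles = (some (e, d) :: a) :: (some (e, d) :: b) :: L) {A : Finset ℕ}
    (hA : A ⊆ G.edges.erase e) :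
    G.summand c (insert e A) = c.σ * (G.contraction h).summand c A := by
  have he := mem_edges_of_contractible h
  have heA : e ∉ A := fun h => G.edges.notMem_erase e (hA h)
  have hv := G.numVert_contraction h
  obtain ⟨h1, h2, h3⟩ := invariants_eq fun m => G.Z_contraction h m heA
  obtain ⟨k1, -, -⟩ := invariants_eq fun m => G.Z_contraction h m (G.edges.notMem_erase e)
  rw [Finset.insert_erase he] at k1
  have hr : G.rk (insert e A) = (G.contraction h).rk A + 1 := by
    have := G.rk_add_comps (insert e A)
    have := (G.contraction h).rk_add_comps A
    omega
  have hrE : G.rk G.edges = (G.contraction h).rk (G.edges.erase e) + 1 := by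
    have := G.rk_add_comps G.edges
    have := (G.contraction h).rk_add_comps (G.edges.erase e)
    omega
  have hn : G.nullity (insert e A) = (G.contraction h).nullity A := by
    unfold nullity
    rw [hr, Finset.card_insert_of_notMem heA]
    omega
  unfold summand
  rw [hr, hrE, hn, h1, h2, h3, edges_contraction, Finset.sdiff_insert, Finset.erase_sdiff_comm,
    Nat.add_sub_add_right, pow_succ]
  ring

theorem sum_insert_contraction (G : HERG) {e : ℕ} {d : Bool} {a b : List Mark}
    {L : List (List Mark)} (h : G.circles = (some (e, d) :: a) :: (some (e, d) :: b) :: L) :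
    c.α ^ G.comps G.edges * c.T ^ G.numHR *
      ∑ A ∈ (G.edges.erase e).powerset, G.summand c (insert e A) =
    c.σ * (G.contraction h).poly c := by
  have he := mem_edges_of_contractible h
  obtain ⟨k1, -, -⟩ := invariants_eq fun m => G.Z_contraction h m (G.edges.notMem_erase e)
  rw [Finset.insert_erase he] at k1
  rw [Finset.sum_congr rfl fun A hA => G.summand_contraction h (Finset.mem_powerset.1 hA),
    ← Finset.mul_sum, poly, edges_contraction, numHR_contraction, ← k1]
  ring

theorem poly_regular (G : HERG) {e : ℕ} {d : Bool} {a b : List Mark} {L : List (List Mark)}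
    (h : G.circles = (some (e, d) :: a) :: (some (e, d) :: b) :: L) (hb : ¬ G.IsBridge e) :
    G.poly c = c.D * (G.del e).poly c + c.σ * (G.contraction h).poly c := by
  rw [poly_split G (mem_edges_of_contractible h) hb, G.sum_insert_contraction h]

/-- Without the bridge the circles `a` and `b` lie in different components, so `Z_join` applies once
the remaining circles are sorted by whether they belong to the component of `a`. -/
theorem Z_bridge (G : HERG) {e : ℕ} {d : Bool} {a b : List Mark} {L : List (List Mark)}
    (h : G.circles = (some (e, d) :: a) :: (some (e, d) :: b) :: L) (hb : G.IsBridge e)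
    {A : Finset ℕ} (hA : A ⊆ G.edges.erase e) (m : StateModel) :
    m.Z A G.circles = 2 * m.Z A (G.contraction h).circles := by
  classical
  have heA : e ∉ A := fun h => G.edges.notMem_erase e (hA h)
  obtain ⟨-, hb⟩ := hb
  have hlen : 1 < G.circles.length := by simp [h]
  let rel : Fin G.circles.length → Fin G.circles.length → Prop := fun u v =>
    ∃ f ∈ G.edges.erase e, (∃ d, some (f, d) ∈ G.circles[u]) ∧ ∃ d, some (f, d) ∈ G.circles[v]
  let u₀ : Fin G.circles.length := ⟨0, by omega⟩
  let u₁ : Fin G.circles.length := ⟨1, by omega⟩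
  have hc0 : G.circles[u₀] = some (e, d) :: a := by simp [u₀, h]
  have hc1 : G.circles[u₁] = some (e, d) :: b := by simp [u₁, h]
  have hother : ∀ u : Fin G.circles.length, e ∈ labels G.circles[u] → u = u₀ ∨ u = u₁ := by
    intro u hu
    obtain ⟨-, -, hL⟩ := not_mem_of_contractible h
    obtain ⟨i, hi⟩ := u
    rcases i with _ | _ | i
    · exact .inl rfl
    · exact .inr rfl
    · refine absurd (mem_edgeLabels.2 ⟨_, ?_, hu⟩) hL
      simp [h]
  -- Were the ends of `e` still connected without `e`, the components with `e` would map onto those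
  -- without it, and `e` would not be a bridge.
  have hne : Quot.mk rel u₀ ≠ Quot.mk rel u₁ := by
    intro heq
    refine absurd hb (not_lt.2 ?_)
    refine Nat.card_le_card_of_surjective (Quot.lift (Quot.mk rel) ?_) ?_
    · rintro u v ⟨f, hf, hu, hv⟩
      by_cases hfe : f = e
      · subst hfe
        rcases hother u (mem_labels.2 hu) with rfl | rfl <;>
          rcases hother v (mem_labels.2 hv) with rfl | rfl
        · rfl
        · exact heq
        · exact heq.symm
        · rfl
      · exact Quot.sound ⟨f, Finset.mem_erase.2 ⟨hfe, hf⟩, hu, hv⟩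
    · intro x
      induction x using Quot.ind with
      | mk u => exact ⟨Quot.mk _ u, rfl⟩
  let P : Fin G.circles.length → Prop := fun u => Quot.mk rel u = Quot.mk rel u₀
  have hP {f : ℕ} (hf : f ∈ G.edges.erase e) {u v : Fin G.circles.length}
      (hu : f ∈ labels G.circles[u]) (hv : f ∈ labels G.circles[v]) (h : P u) : P v :=
    (Quot.sound ⟨f, hf, mem_labels.1 hv, mem_labels.1 hu⟩ : Quot.mk rel v = Quot.mk rel u).trans h
  let Q : ℕ → Prop := fun f => ∃ u, P u ∧ f ∈ labels G.circles[u]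
  have hQ {f g : ℕ} (hf : f ∈ G.edges.erase e) {w : List Mark}
      (hw : w ∈ L) (hfw : f ∈ labels w) (hgw : g ∈ labels w) (h' : Q f) : Q g := by
    obtain ⟨u, hu, hfu⟩ := h'
    obtain ⟨i, hi, rfl⟩ := List.getElem_of_mem (l := G.circles) (a := w) (by simp [h, hw])
    exact ⟨⟨i, hi⟩, hP hf hfu hfw hu, hgw⟩
  have hmem {g : ℕ} {w : List Mark} (hw : w ∈ L) (hg : g ∈ labels w) : g ∈ G.edges.erase e := by
    have hgL := mem_edgeLabels.2 ⟨w, hw, hg⟩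
    refine Finset.mem_erase.2 ⟨?_, mem_edges.2 (by simp [h, hgL])⟩
    rintro rfl
    exact (not_mem_of_contractible h).2.2 hgL
  -- `L₁` collects the circles reached from `u₀` without using `e`. An edge with an end on `a` or on
  -- `L₁` has both ends there.
  set L₁ := L.filter fun w => decide (∃ f ∈ labels w, Q f) with hL₁
  set L₂ := L.filter fun w => !decide (∃ f ∈ labels w, Q f) with hL₂
  have hp : L.Perm (L₁ ++ L₂) := (List.filter_append_perm _ _).symm
  have heven : ∀ f ∈ A, Even ((edgeLabels (a :: L₁)).count f) := by
    intro f hfA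
    have hf := hA hfA
    obtain ⟨hfe, hfE⟩ := Finset.mem_erase.1 hf
    have h2 := G.twice f (mem_edges.1 hfE)
    rw [h, edgeLabels_cons, edgeLabels_cons] at h2
    have h3 := (edgeLabels_perm hp).count_eq f
    simp only [labels_cons_some, List.count_append, edgeLabels_append,
      List.count_cons_of_ne (Ne.symm hfe)] at h2 h3
    rw [edgeLabels_cons, List.count_append]
    by_cases hq : Q f
    · have hb0 : (labels b).count f = 0 := by
        rw [List.count_eq_zero]
        intro hfb
        obtain ⟨u, hu, hfu⟩ := hq
        have : P u₁ := hP hf hfu (by rw [hc1]; simp [hfb]) hu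
        exact hne this.symm
      have h20 : (edgeLabels L₂).count f = 0 := by
        rw [List.count_eq_zero]
        intro hfL
        obtain ⟨w, hw, hfw⟩ := mem_edgeLabels.1 hfL
        obtain ⟨-, hw⟩ := List.mem_filter.1 hw
        simp only [Bool.not_eq_true', decide_eq_false_iff_not] at hw
        exact hw ⟨f, hfw, hq⟩
      exact ⟨1, by omega⟩
    · have ha0 : (labels a).count f = 0 := by
        rw [List.count_eq_zero]
        intro hfa
        exact hq ⟨u₀, rfl, by rw [hc0]; simp [hfa]⟩
      have h10 : (edgeLabels L₁).count f = 0 := by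
        rw [List.count_eq_zero]
        intro hfL
        obtain ⟨w, hw, hfw⟩ := mem_edgeLabels.1 hfL
        obtain ⟨hwL, hw⟩ := List.mem_filter.1 hw
        obtain ⟨g, hgw, hg⟩ := of_decide_eq_true hw
        exact hq (hQ (hmem hwL hgw) hwL hgw hfw hg)
      exact ⟨0, by omega⟩
  rw [contraction, ← StateModel.Z_join hp heven, h]
  exact m.avg_congr fun φ => by simp [StateModel.mark, heA]

/-- Subgraphs containing the bridge give `σ`. For the others the component count and the boundary
count exceed those of the contraction by one, so only the rank defect grows: the extra factor is `D
* B`. -/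
theorem poly_bridge (G : HERG) {e : ℕ} {d : Bool} {a b : List Mark} {L : List (List Mark)}
    (h : G.circles = (some (e, d) :: a) :: (some (e, d) :: b) :: L) (hb : G.IsBridge e) :
    G.poly c = (c.D * c.B + c.σ) * (G.contraction h).poly c := by
  have he := mem_edges_of_contractible h
  have hv := G.numVert_contraction h
  obtain ⟨k1, -, -⟩ := invariants_eq fun m => G.Z_contraction h m (G.edges.notMem_erase e)
  rw [Finset.insert_erase he] at k1
  have hrE : G.rk G.edges = (G.contraction h).rk (G.edges.erase e) + 1 := by
    have := G.rk_add_comps G.edges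
    have := (G.contraction h).rk_add_comps (G.edges.erase e)
    omega
  have hterm : ∀ A ∈ (G.edges.erase e).powerset,
      G.summand c A = c.D * c.B * (G.contraction h).summand c A := by
    intro A hA
    have hA := Finset.mem_powerset.1 hA
    have heA : e ∉ A := fun h => G.edges.notMem_erase e (hA h)
    obtain ⟨h1, h2, h3⟩ := invariants_double fun m => G.Z_bridge h hb hA m
    have hd : (G.edges \ A).card = (G.edges.erase e \ A).card + 1 := by
      rw [Finset.erase_sdiff_comm, Finset.card_erase_add_one (by simp [he, heA])]
    have hr : G.rk A = (G.contraction h).rk A := by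
      have := G.rk_add_comps A
      have := (G.contraction h).rk_add_comps A
      omega
    have hn : G.nullity A = (G.contraction h).nullity A := by
      unfold nullity; rw [hr]
    have hrA := (G.contraction h).rk_mono hA
    unfold summand
    rw [hr, hrE, hn, h1, h2, h3, edges_contraction, hd, Nat.sub_add_comm hrA, add_right_comm,
      Nat.add_sub_add_right, pow_succ, pow_succ]
    ring
  have hsum : ∑ A ∈ G.edges.powerset, G.summand c A =
      ∑ A ∈ (G.edges.erase e).powerset, G.summand c A +
        ∑ A ∈ (G.edges.erase e).powerset, G.summand c (insert e A) := by
    conv_lhs => rw [← Finset.insert_erase he]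
    exact Finset.sum_powerset_insert (G.edges.notMem_erase e) _
  rw [poly, hsum, mul_add, G.sum_insert_contraction h, Finset.sum_congr rfl hterm, ← Finset.mul_sum,
    poly, edges_contraction, numHR_contraction, k1]
  ring

end HERG

/-! ### Chord operations and products -/

namespace HERG

variable {R : Type*} [CommRing R] {c : Params R}

theorem isLoop_of_single {G : HERG} {w : List Mark} (h : G.circles = [w]) {e : ℕ} (he : e ∈ G.edges) :
    G.IsLoop e :=
  ⟨w, by simp [h], by have := G.twice e (mem_edges.1 he); rwa [h] at this⟩

theorem not_isBridge_of_single {G : HERG} {w : List Mark} (h : G.circles = [w]) {e : ℕ} :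
    ¬ G.IsBridge e := by
  rintro ⟨-, hb⟩
  rw [comps_of_loops fun _ _ hf => isLoop_of_single h hf,
    comps_of_loops fun _ _ hf => isLoop_of_single h hf] at hb
  exact lt_irrefl _ hb

/-- Two bouquets with the same state sums for the edge sets containing a common edge. -/
theorem poly_sub_del_eq {G H : HERG} {w w' : List Mark} {e : ℕ} (hG : G.circles = [w])
    (hH : H.circles = [w']) (hw : (labels w).Perm (labels w')) (hn : w.count none = w'.count none)
    (he : e ∈ G.edges)
    (hZ : ∀ (m : StateModel) (A : Finset ℕ), e ∉ A → m.Z (insert e A) [w] = m.Z (insert e A) [w']) :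
    G.poly c - c.D * (G.del e).poly c = H.poly c - c.D * (H.del e).poly c := by
  have hE : G.edges = H.edges := List.toFinset_eq_of_perm _ _ (by simpa [hG, hH] using hw)
  have hinv {A : Finset ℕ} (hA : e ∉ A) := invariants_eq (G := G) (H := H) (A := insert e A)
    (B := insert e A) fun m => by rw [hG, hH, hZ m A hA]
  have hk : G.comps G.edges = H.comps G.edges := by
    rw [← Finset.insert_erase he, (hinv (G.edges.notMem_erase e)).1]
  rw [poly_split G he (not_isBridge_of_single hG), poly_split H (hE ▸ he) (not_isBridge_of_single hH),
    add_sub_cancel_left, add_sub_cancel_left, ← hE, numHR_eq, numHR_eq, hG, hH, hk]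
  simp only [List.map_cons, List.map_nil, hn]
  congr 1
  refine Finset.sum_congr rfl fun A hA => summand_congr (by simp [numVert, hG, hH])
    (by rw [← hE, hk]) rfl (by rw [hE])
    (hinv fun h => G.edges.notMem_erase e (Finset.mem_powerset.1 hA h))

/-- Two bouquets with the same state sums for the edge sets not containing a common edge. -/
theorem poly_del_eq {G H : HERG} {w w' : List Mark} {e : ℕ} (hG : G.circles = [w])
    (hH : H.circles = [w']) (hw : (labels w).Perm (labels w')) (hn : w.count none = w'.count none)
    (hZ : ∀ (m : StateModel) (A : Finset ℕ), A ⊆ G.edges.erase e → m.Z A [w] = m.Z A [w']) :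
    (G.del e).poly c = (H.del e).poly c := by
  have hE : G.edges = H.edges := List.toFinset_eq_of_perm _ _ (by simpa [hG, hH] using hw)
  have hinv {A : Finset ℕ} (hA : A ⊆ G.edges.erase e) := invariants_eq (G := G.del e)
    (H := H.del e) (A := A) (B := A) fun m => by
      have heA : e ∉ A := fun h => G.edges.notMem_erase e (hA h)
      rw [G.Z_del heA, H.Z_del heA, hG, hH, hZ m A hA]
  rw [poly, poly, numHR_del, numHR_del, edges_del, edges_del, ← hE, (hinv subset_rfl).1, numHR_eq,
    numHR_eq, hG, hH]
  simp only [List.map_cons, List.map_nil, hn]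
  congr 1
  refine Finset.sum_congr rfl fun A hA => summand_congr
    (by rw [numVert_del, numVert_del]; simp [numVert, hG, hH])
    (by rw [edges_del, edges_del, ← hE, (hinv subset_rfl).1]) rfl (by rw [edges_del, edges_del, hE])
    (hinv (Finset.mem_powerset.1 hA))

theorem Z_strip (m : StateModel) {A : Finset ℕ} {e : ℕ} (he : e ∉ A) (s s' : Bool)
    (a b u v : List Mark) : m.Z A [a ++ [some (e, s)] ++ b ++ u ++ [some (e, s')] ++ v] =
      m.Z A [(a ++ b) ++ (u ++ v)] :=
  m.avg_congr fun φ => by simp [StateModel.mark, he]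

theorem not_mem_of_chord {G : HERG} {e : ℕ} {s s' : Bool} {a b u v : List Mark}
    (h : G.circles = [a ++ [some (e, s)] ++ b ++ u ++ [some (e, s')] ++ v]) :
    e ∉ labels a ∧ e ∉ labels b ∧ e ∉ labels u ∧ e ∉ labels v := by
  have h2 := G.twice e (by simp [h])
  rw [h] at h2
  simp only [edgeLabels_cons, edgeLabels_nil, labels_append, labels_cons_some, labels_nil,
    List.count_append, List.count_cons_self, List.count_nil] at h2
  refine ⟨?_, ?_, ?_, ?_⟩ <;> rw [← List.count_eq_zero] <;> omega

theorem Z_unlinked {G : HERG} {e : ℕ} {s s' : Bool} {a b u v : List Mark}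
    (h : G.circles = [a ++ [some (e, s)] ++ b ++ u ++ [some (e, s')] ++ v])
    (hl : ¬ Linked a b u v) {A : Finset ℕ} (hA : A ⊆ G.edges.erase e) (m : StateModel) :
    m.Z A [a ++ b, u ++ v] = 2 * m.Z A [(a ++ b) ++ (u ++ v)] := by
  refine StateModel.Z_join (L₁ := []) (L₂ := []) (.refl _) fun f hf => ?_
  obtain ⟨hfe, hfE⟩ := Finset.mem_erase.1 (hA hf)
  have h2 := G.twice f (mem_edges.1 hfE)
  rw [h] at h2
  simp only [edgeLabels_cons, edgeLabels_nil, labels_append, labels_cons_some, labels_nil,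
    List.count_append, List.count_cons_of_ne (Ne.symm hfe), List.count_nil] at h2 ⊢
  by_cases hab : f ∈ edgeLabels [a, b]
  · have huv : f ∉ edgeLabels [u, v] := fun h => hl ⟨f, hab, h⟩
    rw [← List.count_eq_zero] at huv
    simp only [edgeLabels_cons, edgeLabels_nil, List.count_append, List.count_nil] at huv
    exact ⟨1, by omega⟩
  · rw [← List.count_eq_zero] at hab
    simp only [edgeLabels_cons, edgeLabels_nil, List.count_append, List.count_nil] at hab
    exact ⟨0, by omega⟩

theorem mem_edges_of_chord {G : HERG} {e : ℕ} {s s' : Bool} {a b u v : List Mark}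
    (h : G.circles = [a ++ [some (e, s)] ++ b ++ u ++ [some (e, s')] ++ v]) : e ∈ G.edges := by
  simp [mem_edges, h]

/-- Rotations and twists in one format: only the replacements `p`, `q` of `u`, `v` differ. The last
clause compares the circles formed by `a`, `b` and by the other two segments, which are merely
rotated or reversed. -/
theorem exists_chord {G H : HERG} {e : ℕ} {a b u v : List Mark}
    (h : G.IsRotation H e a b u v ∨ G.IsTwist H e a b u v) :
    ∃ (s s' : Bool) (p q : List Mark),
      G.circles = [a ++ [some (e, s)] ++ b ++ u ++ [some (e, s')] ++ v] ∧
      H.circles = [b ++ [some (e, s)] ++ a ++ p ++ [some (e, s')] ++ q] ∧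
      (labels p ++ labels q).Perm (labels u ++ labels v) ∧
      p.count none + q.count none = u.count none + v.count none ∧
      (∀ (m : StateModel) (A : Finset ℕ), e ∉ A →
        m.Z (insert e A) [a ++ [some (e, s)] ++ b ++ u ++ [some (e, s')] ++ v] =
          m.Z (insert e A) [b ++ [some (e, s)] ++ a ++ p ++ [some (e, s')] ++ q]) ∧
      ∀ (m : StateModel) (A : Finset ℕ), m.Z A [a ++ b, u ++ v] = m.Z A [b ++ a, p ++ q] := by
  have swap (m : StateModel) (A : Finset ℕ) (x y : List Mark) : m.Z A [x, y] = m.Z A [y, x] :=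
    StateModel.Z_perm (.swap _ _ _)
  rcases h with ⟨s, hG, hH⟩ | ⟨s, hG, hH⟩ <;> obtain ⟨ha, hb, hu, hv⟩ := not_mem_of_chord hG
  · refine ⟨s, s, v, u, hG, hH, List.perm_append_comm, add_comm _ _,
      fun m A he => StateModel.Z_rotation he s ha hb hu hv, fun m A => ?_⟩
    rw [StateModel.Z_rotate, swap, StateModel.Z_rotate, swap]
  · refine ⟨s, !s, flipWord u, flipWord v, hG, hH, ?_, ?_,
      fun m A he => StateModel.Z_twist he s ha hb hu hv, fun m A => ?_⟩
    · simpa using (List.reverse_perm _).append (List.reverse_perm _)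
    · rw [count_none_flipWord, count_none_flipWord]
    · rw [StateModel.Z_rotate, swap, StateModel.Z_reverse, flipWord_append, StateModel.Z_rotate, swap]

/-- Subgraphs containing `e` have equal state sums in both diagrams, which is the first identity. In
the unlinked case removing `e` leaves a joint of two closed words whose state sum is half that of
the separate circles, so the deletions agree. The unlinked rule then holds for the polynomial with
any coefficient. -/
theorem poly_chord {G H : HERG} {e : ℕ} {a b u v : List Mark}
    (h : G.IsRotation H e a b u v ∨ G.IsTwist H e a b u v) :
    G.poly c - c.D * (G.del e).poly c = H.poly c - c.D * (H.del e).poly c ∧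
      (¬ Linked a b u v → (G.del e).poly c = (H.del e).poly c) := by
  obtain ⟨s, s', p, q, hG, hH, hp, hn, hZ, hZ'⟩ := exists_chord h
  have hlab : (labels (a ++ [some (e, s)] ++ b ++ u ++ [some (e, s')] ++ v)).Perm
      (labels (b ++ [some (e, s)] ++ a ++ p ++ [some (e, s')] ++ q)) := by
    rw [List.perm_iff_count] at hp ⊢
    intro f
    have := hp f
    simp only [labels_append, labels_cons_some, labels_nil, List.count_append] at this ⊢
    omega
  have hnone : (a ++ [some (e, s)] ++ b ++ u ++ [some (e, s')] ++ v).count none =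
      (b ++ [some (e, s)] ++ a ++ p ++ [some (e, s')] ++ q).count none := by
    simp only [List.count_append] at hn ⊢
    omega
  refine ⟨poly_sub_del_eq hG hH hlab hnone (mem_edges_of_chord hG) hZ, fun hl => ?_⟩
  have hl' : ¬ Linked b a p q := by
    rintro ⟨f, h1, h2⟩
    have h3 := hp.mem_iff (a := f)
    simp only [edgeLabels_cons, edgeLabels_nil, List.append_nil, List.mem_append] at h1 h2 h3
    exact hl ⟨f, by simpa using h1.symm, by simpa using h3.1 h2⟩
  have hE : G.edges = H.edges := List.toFinset_eq_of_perm _ _ (by simpa [hG, hH] using hlab)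
  refine poly_del_eq hG hH hlab hnone fun m A hA => ?_
  have heA : e ∉ A := fun h => G.edges.notMem_erase e (hA h)
  have h1 := Z_unlinked hG hl hA m
  have h2 := Z_unlinked hH hl' (hE ▸ hA) m
  rw [Z_strip m heA, Z_strip m heA]
  linarith [hZ' m A]

/-- Multiplicativity. -/
theorem poly_mul {G H K : HERG} {n : ℕ} (hE : K.edges = G.edges ∪ H.edges)
    (hd : Disjoint G.edges H.edges) (hv : n + K.numVert = G.numVert + H.numVert)
    (hhr : K.numHR = G.numHR + H.numHR) (hW : c.W = c.W ^ 2)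
    (hZ : ∀ (m : StateModel) (A B : Finset ℕ), A ⊆ G.edges → B ⊆ H.edges →
      2 ^ n * m.Z (A ∪ B) K.circles = m.Z A G.circles * m.Z B H.circles) :
    c.α ^ n * K.poly c = G.poly c * H.poly c := by
  have hinv {A B : Finset ℕ} (hA : A ⊆ G.edges) (hB : B ⊆ H.edges) :=
    invariants_mul fun m => hZ m A B hA hB
  have hsum : ∑ A ∈ K.edges.powerset, K.summand c A =
      (∑ A ∈ G.edges.powerset, G.summand c A) * ∑ B ∈ H.edges.powerset, H.summand c B := by
    rw [Finset.sum_mul_sum, ← Finset.sum_product']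
    symm
    refine Finset.sum_nbij' (fun p => p.1 ∪ p.2) (fun C => (C ∩ G.edges, C ∩ H.edges)) ?_ ?_ ?_ ?_ ?_
    · rintro ⟨A, B⟩ h
      simp only [Finset.mem_product, Finset.mem_powerset, hE] at h ⊢
      exact Finset.union_subset_union h.1 h.2
    · intro C _
      simp only [Finset.mem_product, Finset.mem_powerset]
      exact ⟨Finset.inter_subset_right, Finset.inter_subset_right⟩
    · rintro ⟨A, B⟩ h
      simp only [Finset.mem_product, Finset.mem_powerset] at h
      have h1 := hd.symm.mono_left h.2
      have h2 := hd.mono_left h.1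
      rw [Finset.disjoint_iff_inter_eq_empty] at h1 h2
      simp only [Finset.union_inter_distrib_right, h1, h2, Finset.inter_eq_left.2 h.1,
        Finset.inter_eq_left.2 h.2, Finset.union_empty, Finset.empty_union]
    · intro C hC
      rw [Finset.mem_powerset, hE] at hC
      rw [← Finset.inter_union_distrib_left, Finset.inter_eq_left.2 hC]
    · rintro ⟨A, B⟩ h
      simp only [Finset.mem_product, Finset.mem_powerset] at h
      obtain ⟨h1, h2, h3⟩ := hinv h.1 h.2
      obtain ⟨k1, -, -⟩ := hinv (subset_refl G.edges) (subset_refl H.edges)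
      rw [← hE] at k1
      have hcard := Finset.card_union_of_disjoint (hd.mono h.1 h.2)
      have hcd : (K.edges \ (A ∪ B)).card = (G.edges \ A).card + (H.edges \ B).card := by
        rw [Finset.card_sdiff_of_subset (by rw [hE]; exact Finset.union_subset_union h.1 h.2),
          Finset.card_sdiff_of_subset h.1, Finset.card_sdiff_of_subset h.2, hcard, hE,
          Finset.card_union_of_disjoint hd]
        have := Finset.card_le_card h.1
        have := Finset.card_le_card h.2
        omega
      have r1 := G.rk_add_comps A
      have r2 := H.rk_add_comps B
      have r3 := K.rk_add_comps (A ∪ B)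
      have r4 := G.rk_add_comps G.edges
      have r5 := H.rk_add_comps H.edges
      have r6 := K.rk_add_comps K.edges
      have r7 := G.rk_mono h.1
      have r8 := H.rk_mono h.2
      have n1 := G.nullity_add_rk A
      have n2 := H.nullity_add_rk B
      have n3 := K.nullity_add_rk (A ∪ B)
      have b1 := G.numBdry_le_comps_add_nullity A
      have b2 := H.numBdry_le_comps_add_nullity B
      have e1 : K.rk K.edges - K.rk (A ∪ B) =
          (G.rk G.edges - G.rk A) + (H.rk H.edges - H.rk B) := by omega
      have e2 : K.rk (A ∪ B) = G.rk A + H.rk B := by omega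
      have e3 : K.nullity (A ∪ B) = G.nullity A + H.nullity B := by omega
      have e4 : K.comps (A ∪ B) + K.nullity (A ∪ B) - K.numBdry (A ∪ B) =
          (G.comps A + G.nullity A - G.numBdry A) + (H.comps B + H.nullity B - H.numBdry B) := by
        omega
      -- Non-orientability combines by maximum, not by sum; idempotence of `W` makes up for this.
      have e5 : c.W ^ K.nonor (A ∪ B) = c.W ^ G.nonor A * c.W ^ H.nonor B := by
        have a1 := G.nonor_le_one A
        have a2 := H.nonor_le_one B
        rw [h3]
        interval_cases G.nonor A <;> interval_cases H.nonor B <;> simp [← sq, ← hW]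
      simp only [summand, e1, e4, hcd, e5]
      rw [e2, e3]
      simp only [pow_add]
      ring
  obtain ⟨k1, -, -⟩ := hinv (subset_refl G.edges) (subset_refl H.edges)
  rw [← hE] at k1
  simp only [poly]
  have k2 : c.α ^ n * c.α ^ K.comps K.edges = c.α ^ G.comps G.edges * c.α ^ H.comps H.edges := by
    rw [← pow_add, k1, pow_add]
  rw [hsum, hhr, pow_add]
  linear_combination (c.T ^ G.numHR * c.T ^ H.numHR * (∑ A ∈ G.edges.powerset, G.summand c A) *
    ∑ B ∈ H.edges.powerset, H.summand c B) * k2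

theorem disjoint_of_twice {G H : HERG} (h : Twice (edgeLabels G.circles ++ edgeLabels H.circles)) :
    Disjoint G.edges H.edges :=
  Finset.disjoint_left.2 fun _ he he' => h.disjoint G.twice _ (mem_edges.1 he) (mem_edges.1 he')

theorem Z_union_edges {G H : HERG} (hd : Disjoint G.edges H.edges) (m : StateModel) {A B : Finset ℕ}
    (hA : A ⊆ G.edges) (hB : B ⊆ H.edges) :
    m.Z (A ∪ B) (G.circles ++ H.circles) = m.Z A G.circles * m.Z B H.circles := by
  have hd := Finset.disjoint_left.1 hd
  rw [StateModel.Z_append fun e he he' => hd (mem_edges.2 he) (mem_edges.2 he')]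
  congr 1 <;> refine StateModel.Z_congr fun e he => ?_ <;> rw [Finset.mem_union]
  · exact or_iff_left fun h => absurd (hB h) (hd (mem_edges.2 he))
  · exact or_iff_right fun h => absurd (mem_edges.2 he) (hd (hA h))

theorem poly_union {G H K : HERG} (h : G.IsUnion H K) (hW : c.W = c.W ^ 2) :
    K.poly c = G.poly c * H.poly c := by
  have h : K.circles = G.circles ++ H.circles := h
  have hd : Disjoint G.edges H.edges := disjoint_of_twice (by
    rw [← edgeLabels_append, ← h]; exact K.twice)
  have := poly_mul (c := c) (n := 0) (G := G) (H := H) (K := K)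
    (by simp only [edges, h, edgeLabels_append, List.toFinset_append]) hd
    (by simp [numVert, h]) (by simp [numHR, h]) hW
    (fun m A B hA hB => by rw [h, Z_union_edges hd m hA hB]; simp)
  simpa using this

theorem poly_joint {G H K : HERG} (h : G.IsJoint H K) (hW : c.W = c.W ^ 2) :
    c.α * K.poly c = G.poly c * H.poly c := by
  obtain ⟨a, b, hG, hH, hK⟩ := h
  have hd : Disjoint G.edges H.edges := disjoint_of_twice (by
    have := K.twice
    rw [hK] at this
    simpa [hG, hH] using this)
  have := poly_mul (c := c) (n := 1) (G := G) (H := H) (K := K)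
    (by simp [edges, hG, hH, hK]) hd
    (by simp [numVert, hG, hH, hK]) (by simp [numHR, hG, hH, hK]) hW
    (fun m A B hA hB => by
      rw [← Z_union_edges hd m hA hB, hG, hH, hK, pow_one]
      refine (StateModel.Z_join (L₁ := []) (L₂ := []) (.refl _) fun f hf => ?_).symm
      by_cases hfa : f ∈ edgeLabels [a]
      · have := G.twice f (by rwa [hG])
        rw [hG] at this
        rw [this]
        exact even_two
      · rw [List.count_eq_zero.2 hfa]
        exact .zero)
  simpa using this

theorem Z_empty (m : StateModel) (L : List (List Mark)) : m.Z ∅ L = 2 ^ L.length := by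
  have hmark (φ : ℕ → m.Φ) (k : Mark) : m.mark ∅ φ k = 1 := by
    rcases k with _ | ⟨e, d⟩ <;> simp [StateModel.mark]
  have hword (φ : ℕ → m.Φ) (w : List Mark) : m.word ∅ φ w = 1 := by
    induction w with
    | nil => rfl
    | cons k w ih => rw [StateModel.word_cons, ih, hmark, one_mul]
  rw [StateModel.Z, StateModel.avg_empty]
  induction L with
  | nil => rfl
  | cons w L ih => rw [StateModel.circ_cons, ih, hword, List.length_cons, pow_succ']; simp

theorem invariants_empty (G : HERG) :
    G.comps ∅ = G.numVert ∧ G.numBdry ∅ = G.numVert ∧ G.nonor ∅ = 0 := by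
  have h1 := G.Z_comps ∅
  have h2 := G.Z_boundaryModel ∅
  have h3 := G.Z_orient ∅
  rw [Z_empty] at h1 h2 h3
  refine ⟨(two_pow_inj h1).symm, (two_pow_inj h2).symm, ?_⟩
  by_contra h
  rw [if_neg h] at h3
  exact pow_ne_zero _ two_ne_zero h3

theorem poly_edgeless {G : HERG} (h : G.edges = ∅) : G.poly c = c.α ^ G.numVert * c.T ^ G.numHR := by
  obtain ⟨h1, h2, h3⟩ := G.invariants_empty
  have hr : G.rk ∅ = 0 := by simp [rk, h1]
  simp [poly, h, summand, nullity, h1, h2, h3, hr]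

/-! Bouquets. -/

theorem summand_of_single {G : HERG} {w : List Mark} (h : G.circles = [w]) (A : Finset ℕ) : G.summand c A = c.C ^ A.card * c.D ^ (G.edges \ A).card *
      c.Z ^ (1 + A.card - G.numBdry A) * c.W ^ G.nonor A := by
  have hk {B : Finset ℕ} : G.comps B = 1 := by
    rw [comps_of_loops fun _ _ hf => isLoop_of_single h hf]; simp [numVert, h]
  have hr {B : Finset ℕ} : G.rk B = 0 := by simp [rk, hk, numVert, h]
  simp [summand, hr, nullity, hk]

theorem poly_of_single {G : HERG} {w : List Mark} (h : G.circles = [w]) :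
    G.poly c = c.α * c.T ^ w.count none * ∑ A ∈ G.edges.powerset, G.summand c A := by
  have hk : G.comps G.edges = 1 := by
    rw [comps_of_loops fun _ _ hf => isLoop_of_single h hf]; simp [numVert, h]
  rw [poly, hk, numHR_eq, h]
  simp

theorem invariants_of_Z {G : HERG} {A : Finset ℕ} {n : ℕ}
    (hb : boundaryModel.Z A G.circles = 2 ^ n) : G.numBdry A = n :=
  two_pow_inj ((G.Z_boundaryModel A).symm.trans hb)

theorem nonor_of_Z_ne {G : HERG} {A : Finset ℕ} (h : (signModel true).Z A G.circles ≠ 0) :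
    G.nonor A = 0 := by
  by_contra hn
  exact h (by rw [Z_orient, if_neg hn])

theorem nonor_of_Z {G : HERG} {A : Finset ℕ} (h : (signModel true).Z A G.circles = 0) :
    G.nonor A = 1 := by
  have := G.nonor_le_one A
  by_contra hn
  rw [Z_orient, if_pos (by omega)] at h
  exact pow_ne_zero _ two_ne_zero h

end HERG

/-! ### Values on the smallest bouquets -/

namespace HERG

variable {R : Type*} [CommRing R] {c : Params R}

theorem Z_singleton (m : StateModel) (e : ℕ) (w : List Mark) :
    m.Z {e} [w] = ∑ x, m.w x * (m.word {e} (fun _ => x) w).trace := by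
  rw [StateModel.Z, ← insert_empty_eq, StateModel.avg_insert _ (by simp)]
  refine Finset.sum_congr rfl fun x _ => ?_
  rw [StateModel.avg_empty, StateModel.circ_cons, StateModel.circ_nil, mul_one]
  congr 2
  refine StateModel.word_congr fun f _ => ⟨Iff.rfl, fun hf => ?_⟩
  simp at hf
  simp [hf]

theorem Z_pair (m : StateModel) {e f : ℕ} (hef : e ≠ f) :
    m.Z {e, f} [[some (e, true), some (f, true), some (e, true), some (f, true)]] =
      ∑ x, m.w x * ∑ y, m.w y * (m.P x * (m.P y * (m.P x * m.P y))).trace := by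
  rw [StateModel.Z, StateModel.avg_insert _ (by simpa using hef)]
  refine Finset.sum_congr rfl fun x _ => ?_
  rw [← insert_empty_eq, StateModel.avg_insert _ (by simp)]
  congr 1
  refine Finset.sum_congr rfl fun y _ => ?_
  rw [StateModel.avg_empty]
  simp [StateModel.mark, hef, hef.symm]

/-- Covers every subgraph with a single positive chord: an annulus, with two boundary circles and
orientable. -/
theorem Z_pos_boundary {e : ℕ} {w : List Mark} (hw : ∀ (m : StateModel) (φ : ℕ → m.Φ),
    m.word {e} φ w = m.P (φ e) * m.P (φ e)) :
    boundaryModel.Z {e} [w] = 2 ^ 2 ∧ (signModel true).Z {e} [w] ≠ 0 := by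
  simp only [Z_singleton, hw]
  constructor
  · change ∑ x : Fin 4, _ = _
    simp [Fin.sum_univ_four, boundaryModel, pauli, Matrix.trace, Fin.sum_univ_two]
    norm_num
  · change ∑ x : Fin 2, _ ≠ _
    simp [Fin.sum_univ_two, signModel, signMatrix, Matrix.trace]

theorem poly_pos : (canon 1 0 0 0).poly c = c.α * (c.D + c.C) := by
  have hc : (canon 1 0 0 0).circles = [[some (0, true), some (0, true)]] := rfl
  have hE : (canon 1 0 0 0).edges = insert 0 ∅ := rfl
  obtain ⟨-, h2, h3⟩ := (canon 1 0 0 0).invariants_empty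
  obtain ⟨z1, z2⟩ := Z_pos_boundary (e := 0) (w := [some (0, true), some (0, true)])
    fun m φ => by simp [StateModel.mark]
  have h4 : (canon 1 0 0 0).numBdry {0} = 2 := invariants_of_Z (by rw [hc, z1])
  have h5 : (canon 1 0 0 0).nonor {0} = 0 := nonor_of_Z_ne (by rwa [hc])
  rw [poly_of_single hc, hE, Finset.sum_powerset_insert (by simp)]
  simp only [Finset.powerset_empty, Finset.sum_singleton, summand_of_single hc, hE, h2, h3,
    insert_empty_eq, h4, h5]
  simp [numVert, hc]

theorem poly_neg : (canon 1 0 1 0).poly c = c.α * (c.D + c.C * c.Z * c.W) := by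
  -- The labels of negative chords start at `i + 2 * j`, here `1`.
  have hc : (canon 1 0 1 0).circles = [[some (1, true), some (1, false)]] := rfl
  have hE : (canon 1 0 1 0).edges = insert 1 ∅ := rfl
  obtain ⟨-, h2, h3⟩ := (canon 1 0 1 0).invariants_empty
  have h4 : (canon 1 0 1 0).numBdry {1} = 1 := invariants_of_Z (by
    rw [hc, Z_singleton]
    change ∑ x : Fin 4, _ = _
    simp [Fin.sum_univ_four, boundaryModel, pauli, Matrix.trace, Fin.sum_univ_two, StateModel.mark]
    norm_num)
  have h5 : (canon 1 0 1 0).nonor {1} = 1 := nonor_of_Z (by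
    rw [hc, Z_singleton]
    change ∑ x : Fin 2, _ = _
    simp [Fin.sum_univ_two, signModel, signMatrix, Matrix.trace, StateModel.mark]
    norm_num)
  rw [poly_of_single hc, hE, Finset.sum_powerset_insert (by simp)]
  simp only [Finset.powerset_empty, Finset.sum_singleton, summand_of_single hc, hE, h2, h3,
    insert_empty_eq, h4, h5]
  simp [numVert, hc]

theorem poly_handle :
    (canon 2 1 0 0).poly c = c.α * (c.D ^ 2 + 2 * c.C * c.D + c.C ^ 2 * c.Z ^ 2) := by
  have hc : (canon 2 1 0 0).circles =
    [[some (2, true), some (3, true), some (2, true), some (3, true)]] := rfl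
  have hE : (canon 2 1 0 0).edges = insert 2 (insert 3 ∅) := rfl
  obtain ⟨-, h2, h3⟩ := (canon 2 1 0 0).invariants_empty
  obtain ⟨z1, z2⟩ := Z_pos_boundary (e := 2)
    (w := [some (2, true), some (3, true), some (2, true), some (3, true)])
    fun m φ => by simp [StateModel.mark]
  have h4 : (canon 2 1 0 0).numBdry {2} = 2 := invariants_of_Z (by rw [hc, z1])
  have h5 : (canon 2 1 0 0).nonor {2} = 0 := nonor_of_Z_ne (by rwa [hc])
  obtain ⟨z1, z2⟩ := Z_pos_boundary (e := 3)
    (w := [some (2, true), some (3, true), some (2, true), some (3, true)])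
    fun m φ => by simp [StateModel.mark]
  have h6 : (canon 2 1 0 0).numBdry {3} = 2 := invariants_of_Z (by rw [hc, z1])
  have h7 : (canon 2 1 0 0).nonor {3} = 0 := nonor_of_Z_ne (by rwa [hc])
  have h8 : (canon 2 1 0 0).numBdry {2, 3} = 1 := invariants_of_Z (by
    rw [hc, Z_pair _ (by decide)]
    change ∑ x : Fin 4, _ * ∑ y : Fin 4, _ = _
    simp [Fin.sum_univ_four, boundaryModel, pauli, Matrix.trace, Fin.sum_univ_two]
    norm_num)
  have h9 : (canon 2 1 0 0).nonor {2, 3} = 0 := nonor_of_Z_ne (by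
    rw [hc, Z_pair _ (by decide)]
    change ∑ x : Fin 2, _ * ∑ y : Fin 2, _ ≠ _
    simp [Fin.sum_univ_two, signModel, signMatrix, Matrix.trace])
  rw [poly_of_single hc, hE, Finset.sum_powerset_insert (by simp),
    Finset.sum_powerset_insert (by simp), Finset.sum_powerset_insert (by simp)]
  simp only [Finset.powerset_empty, Finset.sum_singleton, summand_of_single hc, hE, h2, h3,
    insert_empty_eq, h4, h5, h6, h7]
  have c1 : ({2, 3} : Finset ℕ).card = 2 := rfl
  have c2 : ({2, 3} \ {2, 3} : Finset ℕ).card = 0 := rfl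
  have c3 : ({2, 3} \ {2} : Finset ℕ).card = 1 := rfl
  have c4 : ({2, 3} \ {3} : Finset ℕ).card = 1 := rfl
  simp only [h8, h9, c1, c2, c3, c4, numVert, hc, List.length_singleton, Finset.card_singleton,
    Finset.card_empty, Finset.sdiff_empty]
  have hn : ([some (2, true), some (3, true), some (2, true), some (3, true)] : List Mark).count
    none = 0 := rfl
  rw [hn]
  ring

end HERG

/-! ### Membership in minor closed sets -/

namespace MinorClosed

variable {M : Set PinchedGraph}

theorem del_mem (hM : MinorClosed M) {G : HERG} (hG : G.cls ∈ M) (e : ℕ) : (G.del e).cls ∈ M := by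
  by_cases he : e ∈ G.edges
  · exact hM.del G e hG he
  · have : G.del e = G := by
      refine HERG.ext_circles ?_
      refine (List.map_congr_left fun w hw => ?_).trans (List.map_id _)
      refine List.filter_eq_self.2 fun k hk => decide_eq_true fun hke => he ?_
      obtain ⟨⟨f, d⟩, rfl, rfl⟩ := Option.map_eq_some_iff.1 hke
      exact HERG.mem_edges.2 (mem_edgeLabels.2 ⟨w, hw, mem_labels.2 ⟨d, hk⟩⟩)
    rwa [this]

theorem filter_mem (hM : MinorClosed M) (S : List ℕ) {G H : HERG} (hG : G.cls ∈ M)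
    (hH : H.circles = G.circles.map (List.filter fun k => (k.map Prod.fst).all (· ∉ S))) :
    H.cls ∈ M := by
  induction S generalizing G with
  | nil =>
    have : H = G := by
      refine HERG.ext_circles (hH.trans ?_)
      refine (List.map_congr_left fun w _ => ?_).trans (List.map_id _)
      exact List.filter_eq_self.2 fun k _ => by rcases k with _ | k <;> simp
    rwa [this]
  | cons e S ih =>
    refine ih (hM.del_mem hG e) (hH.trans ?_)
    simp only [HERG.del, List.map_map]
    refine List.map_congr_left fun w _ => ?_
    rw [Function.comp_apply, List.filter_filter]
    refine List.filter_congr fun k _ => ?_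
    rcases k with _ | ⟨f, d⟩
    · simp
    · by_cases h : f = e <;> simp [h]

theorem filter_disjoint {w v : List Mark} (h : ∀ e ∈ labels w, e ∉ labels v) :
    v.filter (fun k => (k.map Prod.fst).all (· ∉ labels w)) = v := by
  refine List.filter_eq_self.2 fun k hk => ?_
  rcases k with _ | ⟨f, d⟩
  · simp
  · have hf := mem_labels.2 ⟨d, hk⟩
    simpa using fun hfw => h f hfw hf

/-- Removal of a closed component with one vertex. -/
theorem tail_mem (hM : MinorClosed M) {G H : HERG} {w : List Mark} {L : List (List Mark)}
    (hG : G.cls ∈ M) (hc : G.circles.Perm (w :: L)) (hw : Twice (labels w)) (hH : H.circles = L) :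
    H.cls ∈ M := by
  obtain ⟨G', hGG', hc'⟩ := SameGraph.step (.perm hc)
  rw [hGG'.cls] at hG
  have ht := G'.twice
  rw [hc', edgeLabels_cons] at ht
  have hd := ht.disjoint hw
  set p : Mark → Bool := fun k => (k.map Prod.fst).all (· ∉ labels w) with hp
  have hL : L.map (List.filter p) = L := by
    refine (List.map_congr_left fun v hv => ?_).trans (List.map_id _)
    exact filter_disjoint fun e he hev => hd e he (mem_edgeLabels.2 ⟨v, hv, hev⟩)
  have hnone : ∀ k ∈ w.filter p, k = none := by
    intro k hk
    obtain ⟨hk, hkp⟩ := List.mem_filter.1 hk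
    rcases k with _ | ⟨f, d⟩
    · rfl
    · simp [hp, mem_labels.2 ⟨d, hk⟩] at hkp
  have hlab : labels (w.filter p) = [] := by
    rw [List.eq_nil_iff_forall_not_mem]
    intro f hf
    obtain ⟨d, hd⟩ := mem_labels.1 hf
    cases hnone _ hd
  -- `K` arises by deleting the edges on `w`. What is left of that circle carries only half-ribbons,
  -- so vertex deletion removes it.
  let K : HERG := ⟨w.filter p :: L, by rw [edgeLabels_cons, hlab]; exact ht.right hw⟩
  have hK : K.cls ∈ M := hM.filter_mem (labels w) hG (by rw [hc', List.map_cons, hL])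
  exact hM.vertex K H hK ⟨w.filter p, hnone, by rw [hH]⟩

/-- A closed component with one vertex is a minor. -/
theorem single_mem (hM : MinorClosed M) {w : List Mark} (hw : Twice (labels w))
    {L : List (List Mark)} (hL : ∀ v ∈ L, Twice (labels v)) {G : HERG} (hG : G.cls ∈ M)
    (hc : G.circles = w :: L) : (bouquet w hw).cls ∈ M := by
  induction L generalizing G with
  | nil => rwa [HERG.ext_circles (G := bouquet w hw) (H := G) hc.symm]
  | cons v L ih =>
    have hp : G.circles.Perm (v :: w :: L) := hc ▸ .swap _ _ _
    have ht := G.twice.of_perm (edgeLabels_perm hp)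
    rw [edgeLabels_cons] at ht
    have hv := hL v (by simp)
    exact ih (fun v hv => hL v (by simp [hv])) (G := ⟨w :: L, ht.right hv⟩)
      (hM.tail_mem hG hp hv rfl) rfl

end MinorClosed

/-! ### Sums of pieces -/

/-- Words that are concatenations of pieces and half-chords. -/
inductive PieceSum : List Mark → Prop
  | none (l : ℕ) : PieceSum (List.replicate l none)
  | cons {p w : List Mark} (hp : IsPiece p) (hw : PieceSum w) : PieceSum (p ++ w)

theorem PieceSum.flatMap {α : Type*} {w : List Mark} (hw : PieceSum w) (f : α → List Mark)
    (l : List α) (h : ∀ a ∈ l, IsPiece (f a)) : PieceSum (l.flatMap f ++ w) := by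
  induction l with
  | nil => exact hw
  | cons a l ih =>
    rw [List.flatMap_cons, List.append_assoc]
    exact .cons (h a (by simp)) (ih fun b hb => h b (by simp [hb]))

theorem pieceSum_canonWord (i j k l : ℕ) : PieceSum (HERG.canonWord i j k l) := by
  unfold HERG.canonWord
  simp only [List.append_assoc]
  exact (((PieceSum.none l).flatMap _ _ fun m _ => .neg _).flatMap _ _ fun m _ =>
    .handle _ _ (by omega)).flatMap _ _ fun m _ => .pos _

theorem PieceSum.twice_tail {p w : List Mark} (hp : IsPiece p) (h : Twice (labels (p ++ w))) :
    Twice (labels w) := by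
  rw [labels_append] at h
  exact h.right hp.twice

theorem MinorClosed.tail_word_mem {M : Set PinchedGraph} (hM : MinorClosed M) {p w : List Mark}
    (hp : IsPiece p) (h : Twice (labels (p ++ w))) (hmem : (bouquet (p ++ w) h).cls ∈ M) :
    (bouquet w (PieceSum.twice_tail hp h)).cls ∈ M := by
  refine hM.filter_mem (labels p) hmem ?_
  have h1 : p.filter (fun k => (k.map Prod.fst).all (· ∉ labels p)) = [] := by
    rw [List.filter_eq_nil_iff]
    intro k hk
    rcases k with _ | ⟨f, d⟩
    · cases hp <;> simp at hk
    · simp [mem_labels.2 ⟨d, hk⟩]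
  have h2 := MinorClosed.filter_disjoint (w := p) (v := w)
    (Twice.disjoint (by rwa [labels_append] at h) hp.twice)
  simp only [bouquet, List.map_cons, List.map_nil, List.filter_append, h1, h2, List.nil_append]

theorem IsPiece.cls_eq {p : List Mark} (hp : IsPiece p) :
    (bouquet p hp.twice).cls = (HERG.canon 1 0 0 0).cls ∨
    (bouquet p hp.twice).cls = (HERG.canon 1 0 1 0).cls ∨
    (bouquet p hp.twice).cls = (HERG.canon 2 1 0 0).cls := by
  cases hp with
  | pos e =>
    refine .inl (HERG.cls_eq ?_).symm
    have := HERGMove.relabel (Equiv.swap 0 e) [[some (0, true), some (0, true)]]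
    simp only [List.map_cons, List.map_nil, relabel_some, Equiv.swap_apply_left] at this
    exact this
  | neg e =>
    refine .inr (.inl (HERG.cls_eq ?_).symm)
    have := HERGMove.relabel (Equiv.swap 1 e) [[some (1, true), some (1, false)]]
    simp only [List.map_cons, List.map_nil, relabel_some, Equiv.swap_apply_left] at this
    exact this
  | handle e f h =>
    refine .inr (.inr (HERG.cls_eq ?_).symm)
    -- The first transposition sends 2 to `e` and the second sends the current image of 3 to `f`;
    -- the latter must not move `e` again.
    have h2 : Equiv.swap (Equiv.swap 2 e 3) f e = e := by
      refine Equiv.swap_apply_of_ne_of_ne ?_ h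
      intro h'
      have := (Equiv.swap 2 e).injective (h'.symm.trans (Equiv.swap_apply_left 2 e).symm)
      omega
    have := HERGMove.relabel ((Equiv.swap 2 e).trans (Equiv.swap (Equiv.swap 2 e 3) f))
      [[some (2, true), some (3, true), some (2, true), some (3, true)]]
    simp only [List.map_cons, List.map_nil, relabel_some, Equiv.trans_apply,
      Equiv.swap_apply_left, h2] at this
    exact this

/-! ### Uniqueness -/

namespace PinchedGraph

variable {R : Type*} [CommRing R]

/-- The weighted polynomial of a class. -/
noncomputable def poly (c : Params R) : PinchedGraph → R :=
  Quot.lift (fun G : HERG => G.poly c) fun _ _ => HERG.poly_eq_of_move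

/-- The number of edges and vertices. -/
def size : PinchedGraph → ℕ :=
  Quot.lift (fun G : HERG => G.edges.card + G.numVert) fun G H h => by
    obtain ⟨f, hE, -⟩ := h.exists_perm G.twice
    have hE : H.edges = G.edges.map f.toEmbedding := hE
    have hv : G.numVert = H.numVert := h.length_eq
    rw [hE, Finset.card_map, hv]

end PinchedGraph

/-- The recursive rules that determine the weighted polynomial on `M`; `op` is deletion or cut. -/
structure Recursive {R : Type*} [CommRing R] (M : Set PinchedGraph) (c : Params R)
    (op : HERG → ℕ → HERG) (δ κ : R) (F : PinchedGraph → R) : Prop where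
  union : ∀ G H K : HERG, G.cls ∈ M → H.cls ∈ M → K.cls ∈ M →
    G.IsBouquetUnion → H.IsBouquetUnion → G.IsUnion H K → F K.cls = F G.cls * F H.cls
  joint : ∀ G H K : HERG, G.cls ∈ M → H.cls ∈ M → K.cls ∈ M →
    G.IsJoint H K → c.α * F K.cls = F G.cls * F H.cls
  linked : ∀ (G H : HERG) (e : ℕ) (a b u v : List Mark), G.cls ∈ M → H.cls ∈ M →
    G.IsRotation H e a b u v ∨ G.IsTwist H e a b u v → HERG.Linked a b u v →
      F G.cls - δ * F (op G e).cls = F H.cls - δ * F (op H e).cls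
  unlinked : ∀ (G H : HERG) (e : ℕ) (a b u v : List Mark), G.cls ∈ M → H.cls ∈ M →
    G.IsRotation H e a b u v ∨ G.IsTwist H e a b u v → ¬ HERG.Linked a b u v →
      F G.cls - κ * F (op G e).cls = F H.cls - κ * F (op H e).cls
  regular : ∀ (G : HERG) (e : ℕ) (G' : HERG), G.cls ∈ M → G.IsContraction e G' → G.IsRegular e →
    F G.cls = δ * F (op G e).cls + c.σ * F G'.cls
  bridge : ∀ (G : HERG) (e : ℕ) (G' : HERG), G.cls ∈ M → G.IsContraction e G' → G.IsBridge e →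
    F G.cls = (c.D * c.B + c.σ) * F G'.cls
  edgeless : ∀ G : HERG, G.cls ∈ M → G.edges = ∅ → F G.cls = c.α ^ G.numVert * c.T ^ G.numHR
  pos : F (HERG.canon 1 0 0 0).cls = c.α * (c.D + c.C)
  neg : F (HERG.canon 1 0 1 0).cls = c.α * (c.D + c.C * c.Z * c.W)
  handle : F (HERG.canon 2 1 0 0).cls = c.α * (c.D ^ 2 + 2 * c.C * c.D + c.C ^ 2 * c.Z ^ 2)

/-- An operation removing an edge that is compatible with the weighted polynomial. -/
structure RemovesEdge {R : Type*} [CommRing R] (M : Set PinchedGraph) (c : Params R)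
    (op : HERG → ℕ → HERG) (δ θ : R) : Prop where
  mem : ∀ (G : HERG) (e : ℕ), G.cls ∈ M → e ∈ G.edges → (op G e).cls ∈ M
  edges : ∀ (G : HERG) (e : ℕ), (op G e).edges = G.edges.erase e
  numVert : ∀ (G : HERG) (e : ℕ), (op G e).numVert = G.numVert
  poly : ∀ (G : HERG) (e : ℕ), e ∈ G.edges → (op G e).poly c = θ * (G.del e).poly c
  mul_eq : δ * θ = c.D

namespace HERG

theorem not_isLoop_of_contractible {G : HERG} {e : ℕ} {d : Bool} {a b : List Mark}
    {L : List (List Mark)} (h : G.circles = (some (e, d) :: a) :: (some (e, d) :: b) :: L) :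
    ¬ G.IsLoop e := by
  intro hl
  have := hl.eq (u := ⟨0, by simp [h]⟩) (v := ⟨1, by simp [h]⟩) (by simp [h]) (by simp [h])
  simp at this

theorem IsLoop.count_eq {G : HERG} {e : ℕ} (hl : G.IsLoop e) {w : List Mark}
    (hw : w ∈ G.circles) (he : e ∈ labels w) : (labels w).count e = 2 := by
  obtain ⟨v, hv, h2⟩ := hl
  rw [edgeLabels_cons, edgeLabels_nil, List.append_nil] at h2
  by_cases hwv : w = v
  · rwa [hwv]
  · exfalso
    have hp := List.perm_cons_erase hw
    have hv' : v ∈ G.circles.erase w := (List.mem_erase_of_ne (Ne.symm hwv)).2 hv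
    have hp' := hp.trans ((List.perm_cons_erase hv').cons w)
    have h := G.twice e (mem_edgeLabels.2 ⟨w, hw, he⟩)
    rw [(edgeLabels_perm hp').count_eq, edgeLabels_cons, edgeLabels_cons, List.count_append,
      List.count_append] at h
    have := List.count_pos_iff.2 he
    omega

end HERG

namespace Recursive

variable {R : Type*} [CommRing R] {M : Set PinchedGraph} {c : Params R} {op : HERG → ℕ → HERG}
  {δ κ θ : R} {F : PinchedGraph → R}

theorem eq_poly_piece (hF : Recursive M c op δ κ F) {p : List Mark} (hp : IsPiece p) :
    F (bouquet p hp.twice).cls = (bouquet p hp.twice).cls.poly c := by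
  rcases hp.cls_eq with h | h | h <;> rw [h]
  · exact hF.pos.trans HERG.poly_pos.symm
  · exact hF.neg.trans HERG.poly_neg.symm
  · exact hF.handle.trans HERG.poly_handle.symm

/-- Pieces are peeled off by the joint rule, which determines the value because `α` is a unit. Each
piece is one of three given bouquets up to renaming, and the remainder stays in `M` as a minor. -/
theorem eq_poly_pieceSum (hF : Recursive M c op δ κ F) (hM : MinorClosed M) (hα : IsUnit c.α)
    (hW : c.W = c.W ^ 2) (h1 : (HERG.canon 1 0 0 0).cls ∈ M) (h2 : (HERG.canon 1 0 1 0).cls ∈ M)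
    (h3 : (HERG.canon 2 1 0 0).cls ∈ M) {w : List Mark} (h : PieceSum w) (hw : Twice (labels w))
    (hmem : (bouquet w hw).cls ∈ M) : F (bouquet w hw).cls = (bouquet w hw).cls.poly c := by
  induction h with
  | none l =>
    have hE : (bouquet (List.replicate l none) hw).edges = ∅ := by
      ext e
      simp [HERG.mem_edges, bouquet, mem_labels]
    exact (hF.edgeless _ hmem hE).trans (HERG.poly_edgeless hE).symm
  | @cons p w hp h ih =>
    have hpM : (bouquet p hp.twice).cls ∈ M := by
      rcases hp.cls_eq with h | h | h <;> rwa [h]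
    have hwM := hM.tail_word_mem hp hw hmem
    have hj : (bouquet p hp.twice).IsJoint (bouquet w (PieceSum.twice_tail hp hw))
      (bouquet (p ++ w) hw) := ⟨p, w, rfl, rfl, rfl⟩
    refine hα.mul_left_cancel ?_
    rw [hF.joint _ _ _ hpM hwM hmem hj, hF.eq_poly_piece hp, ih _ hwM]
    exact (HERG.poly_joint hj hW).symm

/-- Chord steps preserve the size. By induction the correction terms of `F` are already values of
the polynomial, so its own chord relation transfers the equality from `y` to `x`. -/
theorem eq_poly_step (hF : Recursive M c op δ κ F) (hop : RemovesEdge M c op δ θ) {n : ℕ}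
    (ih : ∀ x ∈ M, x.size < n → F x = x.poly c) {x y : PinchedGraph} (hx : x ∈ M) (hy : y ∈ M)
    (h : ChordStep x y) (hn : x.size = n) : y.size = n ∧ (F y = y.poly c → F x = x.poly c) := by
  obtain ⟨G, H, e, a, b, u, v, rfl, rfl, h⟩ := h
  obtain ⟨s, s', p, q, hG, hH, hp, -, -, -⟩ := HERG.exists_chord h
  have hE : G.edges = H.edges := List.toFinset_eq_of_perm _ _ (by
    rw [List.perm_iff_count] at hp ⊢
    intro f
    have := hp f
    simp only [hG, hH, edgeLabels_cons, edgeLabels_nil, labels_append, labels_cons_some, labels_nil,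
      List.count_append, List.count_nil] at this ⊢
    omega)
  have hv : G.numVert = H.numVert := by simp [HERG.numVert, hG, hH]
  have heG := HERG.mem_edges_of_chord hG
  have heH : e ∈ H.edges := hE ▸ heG
  have hn : G.edges.card + G.numVert = n := hn
  have hpos := Finset.card_pos.2 ⟨e, heG⟩
  have good {K : HERG} (hK : K.cls ∈ M) (he : e ∈ K.edges)
      (hnK : K.edges.card + K.numVert = n) : F (op K e).cls = θ * (K.del e).poly c := by
    refine (ih _ (hop.mem K e hK he) ?_).trans (hop.poly K e he)
    change (op K e).edges.card + (op K e).numVert < n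
    rw [hop.edges, hop.numVert, Finset.card_erase_of_mem he]
    have := Finset.card_pos.2 ⟨e, he⟩
    omega
  have hnH : H.edges.card + H.numVert = n := by rw [← hE, ← hv, hn]
  refine ⟨hnH, fun hy' => ?_⟩
  have hy' : F H.cls = H.poly c := hy'
  change F G.cls = G.poly c
  obtain ⟨k1, k2⟩ := HERG.poly_chord (c := c) h
  have g1 := good hx heG hn
  have g2 := good hy heH hnH
  by_cases hl : HERG.Linked a b u v
  · have := hF.linked G H e a b u v hx hy h hl
    rw [g1, g2, hy', ← mul_assoc, ← mul_assoc, hop.mul_eq] at this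
    linear_combination this - k1
  · have := hF.unlinked G H e a b u v hx hy h hl
    rw [g1, g2, hy', k2 hl] at this
    rw [k2 hl] at k1
    linear_combination this - k1

theorem eq_poly (hF : Recursive M c op δ κ F) (hop : RemovesEdge M c op δ θ) (hM : MinorClosed M)
    (hchord : ChordClosed M) (hα : IsUnit c.α)
    (hW : c.W = c.W ^ 2) (h1 : (HERG.canon 1 0 0 0).cls ∈ M) (h2 : (HERG.canon 1 0 1 0).cls ∈ M)
    (h3 : (HERG.canon 2 1 0 0).cls ∈ M) (n : ℕ) :
    ∀ x ∈ M, x.size = n → F x = x.poly c := by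
  induction n using Nat.strong_induction_on with
  | _ n ih =>
  have ih : ∀ x ∈ M, x.size < n → F x = x.poly c := fun x hx h => ih _ h x hx rfl
  intro x hx hn
  obtain ⟨G, rfl⟩ : ∃ G : HERG, G.cls = x := Quot.exists_rep x
  by_cases hloop : G.IsBouquetUnion
  · by_cases hE : G.edges = ∅
    · exact (hF.edgeless G hx hE).trans (HERG.poly_edgeless hE).symm
    have htw {w : List Mark} (hw : w ∈ G.circles) : Twice (labels w) := fun e he =>
      (hloop e (HERG.mem_edges.2 (mem_edgeLabels.2 ⟨w, hw, he⟩))).count_eq hw he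
    match hc : G.circles with
    | [] => exact absurd (by simp [HERG.edges, hc]) hE
    | [w] =>
      have hw := htw (w := w) (by simp [hc])
      obtain rfl : G = bouquet w hw := HERG.ext_circles hc
      obtain ⟨i, j, k, l, hij, hk, hR⟩ := exists_rEquivalent_canon w hw
      have path := hchord _ hx i j k l hij hk hR
      clear hR
      generalize (bouquet w hw).cls = x at *
      -- The equality starts at the canonical end and is carried back to the given diagram. The size
      -- stays `n` along the path, so the outer induction hypothesis remains applicable at every
      -- step.
      induction path using Relation.ReflTransGen.head_induction_on with
      | refl =>
        have ht := (HERG.canon i j k l).twice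
        rw [HERG.canon, edgeLabels_cons, edgeLabels_nil, List.append_nil] at ht
        exact hF.eq_poly_pieceSum hM hα hW h1 h2 h3 (pieceSum_canonWord i j k l) ht hx
      | head hstep _ ih' =>
        obtain ⟨hx, hy, hstep⟩ := hstep
        obtain ⟨hn', hgood⟩ := hF.eq_poly_step hop ih hx hy hstep hn
        exact hgood (ih' hy hn')
    | w :: v :: L =>
      have hw := htw (w := w) (by simp [hc])
      have ht := G.twice
      rw [hc, edgeLabels_cons] at ht
      let H : HERG := ⟨v :: L, ht.right hw⟩
      have hwM : (bouquet w hw).cls ∈ M := hM.single_mem hw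
        (fun u hu => htw (by simp only [hc]; exact List.mem_cons_of_mem _ hu)) hx hc
      have hHM : H.cls ∈ M := hM.tail_mem hx (by rw [hc]) hw rfl
      have hU : (bouquet w hw).IsUnion H G := hc
      have hd : Disjoint (bouquet w hw).edges H.edges := HERG.disjoint_of_twice (by
        simpa [bouquet, H] using ht)
      have hcard : G.edges.card = (bouquet w hw).edges.card + H.edges.card := by
        rw [← Finset.card_union_of_disjoint hd]
        simp only [HERG.edges, bouquet, H, hc, ← List.toFinset_append, ← edgeLabels_append]
        rfl
      have hv1 : G.numVert = L.length + 2 := by simp [HERG.numVert, hc]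
      have hv2 : (bouquet w hw).numVert = 1 := rfl
      have hv3 : H.numVert = L.length + 1 := rfl
      have hn : G.edges.card + G.numVert = n := hn
      have g1 := ih _ hwM (by
        change (bouquet w hw).edges.card + (bouquet w hw).numVert < n; omega)
      have g2 := ih _ hHM (by
        change H.edges.card + H.numVert < n; omega)
      have hHl : H.IsBouquetUnion := by
        intro e he
        obtain ⟨u, hu, heu⟩ := mem_edgeLabels.1 (HERG.mem_edges.1 he)
        refine ⟨u, hu, ?_⟩
        have huG : u ∈ G.circles := hc ▸ List.mem_cons_of_mem _ hu
        simpa using htw huG e heu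
      rw [hF.union _ _ _ hwM hHM hx (fun e he => HERG.isLoop_of_single rfl he) hHl hU, g1, g2]
      exact (HERG.poly_union hU hW).symm
  · obtain ⟨e, he, hl⟩ : ∃ e, e ∈ G.edges ∧ ¬ G.IsLoop e := by
      simpa [HERG.IsBouquetUnion] using hloop
    obtain ⟨d, a, b, L, H, hGH, hc⟩ := HERG.exists_contractible he hl
    rw [hGH.cls] at hx hn ⊢
    have heH := HERG.mem_edges_of_contractible hc
    have hcon : H.IsContraction e (H.contraction hc) := ⟨d, a, b, L, hc, rfl⟩
    have hconM := hM.contract H e _ hx hcon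
    have hn : H.edges.card + H.numVert = n := hn
    have hpos := Finset.card_pos.2 ⟨e, heH⟩
    have g1 : F (H.contraction hc).cls = (H.contraction hc).poly c := ih _ hconM (by
      change (H.contraction hc).edges.card + (H.contraction hc).numVert < n
      rw [HERG.edges_contraction, Finset.card_erase_of_mem heH]
      have := H.numVert_contraction hc
      omega)
    change F H.cls = H.poly c
    by_cases hb : H.IsBridge e
    · rw [hF.bridge H e _ hx hcon hb, g1, H.poly_bridge hc hb]
    · have g2 : F (op H e).cls = (op H e).poly c := ih _ (hop.mem H e hx heH) (by
        change (op H e).edges.card + (op H e).numVert < n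
        rw [hop.edges, hop.numVert, Finset.card_erase_of_mem heH]
        omega)
      rw [hF.regular H e _ hx hcon ⟨heH, HERG.not_isLoop_of_contractible hc, hb⟩, g1, g2,
        hop.poly H e heH, H.poly_regular hc hb, ← mul_assoc, hop.mul_eq]

end Recursive

/-! ### Specializations -/

namespace HERG

variable {R : Type*} [CommRing R]

/-- Both sides are the number of edges minus the rank of `A`. This exchange of exponents underlies
the rescalings below. -/
theorem nullity_add_card_sdiff (G : HERG) {A : Finset ℕ} (hA : A ⊆ G.edges) :
    G.nullity A + (G.edges \ A).card =
      G.nullity G.edges + (G.rk G.edges - G.rk A) := by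
  have h1 := G.nullity_add_rk A
  have h2 := G.nullity_add_rk G.edges
  have h3 := G.rk_mono hA
  have h4 := Finset.card_sdiff_add_card_eq_card hA
  omega

/-- Each edge outside `A` accounts for two half-ribbons, hence the weight `T ^ 2` in place of `D`.
-/
theorem poly_eq_polyR' (G : HERG) (α T X Y Z W : R) :
    G.poly ⟨α, T, X - 1, 1, Y - 1, T ^ 2, Z, W⟩ = α ^ G.comps G.edges * G.polyR' X Y Z W T := by
  simp only [poly, polyR', summand, mul_assoc, Finset.mul_sum]
  refine Finset.sum_congr rfl fun A _ => ?_
  rw [numFint_add_numBdryComps, numFree, pow_add, pow_mul, one_pow]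
  ring

/-- The powers of `τ` from nullity and missing edges combine to `n(G)` plus the rank defect of `A`;
the latter share completes `B` to `σ * (X - 1)`. -/
theorem poly_eq_polyBR (G : HERG) {α T B σ C τ X Y Z W : R} (hX : B * τ = σ * (X - 1))
    (hY : C = τ * (Y - 1)) : G.poly ⟨α, T, B, σ, C, τ, Z, W⟩ =
      σ ^ G.rk G.edges * τ ^ G.nullity G.edges *
        (T ^ G.numHR * α ^ G.comps G.edges * G.polyBR X Y Z W) := by
  simp only [poly, polyBR, summand, Finset.mul_sum]
  refine Finset.sum_congr rfl fun A hA => ?_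
  have hA := Finset.mem_powerset.1 hA
  have h1 : σ ^ G.rk G.edges = σ ^ G.rk A * σ ^ (G.rk G.edges - G.rk A) := by
    rw [← pow_add, Nat.add_sub_cancel' (G.rk_mono hA)]
  have h2 : τ ^ G.nullity A * τ ^ (G.edges \ A).card =
      τ ^ G.nullity G.edges * τ ^ (G.rk G.edges - G.rk A) := by
    rw [← pow_add, ← pow_add, G.nullity_add_card_sdiff hA]
  have h3 := congrArg (· ^ (G.rk G.edges - G.rk A)) hX
  simp only [mul_pow] at h3
  rw [hY, mul_pow, h1]
  generalize Z ^ _ = z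
  generalize W ^ _ = w
  generalize (Y - 1) ^ _ = y at *
  linear_combination α ^ G.comps G.edges * T ^ G.numHR * σ ^ G.rk A * y * z * w *
    (B ^ (G.rk G.edges - G.rk A) * h2 + τ ^ G.nullity G.edges * h3)

theorem polyR'_eq_polyBR (G : HERG) {S X Y X' Y' Z W : R} (hX : (X' - 1) * S ^ 2 = X - 1)
    (hY : Y' - 1 = S ^ 2 * (Y - 1)) :
    G.polyR' X' Y' Z W S = S ^ (G.numHR + 2 * G.nullity G.edges) * G.polyBR X Y Z W := by
  simp only [polyR', polyBR, Finset.mul_sum]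
  refine Finset.sum_congr rfl fun A hA => ?_
  have hA := Finset.mem_powerset.1 hA
  have h2 : (S ^ 2) ^ G.nullity A * (S ^ 2) ^ (G.edges \ A).card =
      (S ^ 2) ^ G.nullity G.edges * (S ^ 2) ^ (G.rk G.edges - G.rk A) := by
    rw [← pow_add, ← pow_add, G.nullity_add_card_sdiff hA]
  rw [numFint_add_numBdryComps, numFree, hY, ← hX, mul_pow, mul_pow, pow_add, pow_add,
    pow_mul S 2 (G.edges \ A).card, pow_mul S 2 (G.nullity G.edges)]
  generalize Z ^ _ = z
  generalize W ^ _ = w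
  linear_combination (X' - 1) ^ (G.rk G.edges - G.rk A) * (Y - 1) ^ G.nullity A * z * w *
    S ^ G.numHR * h2

end HERG

theorem removesEdge_del {R : Type*} [CommRing R] {M : Set PinchedGraph} (hM : MinorClosed M)
    (c : Params R) : RemovesEdge M c HERG.del c.D 1 where
  mem := hM.del
  edges := HERG.edges_del
  numVert := HERG.numVert_del
  poly _ _ _ := (one_mul _).symm
  mul_eq := mul_one _

/-- The cut rule has coefficient one because the two new half-ribbons already supply the weight `D`.
-/
theorem removesEdge_cut {R : Type*} [CommRing R] {M : Set PinchedGraph} (hM : MinorClosed M)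
    {c : Params R} (hc : c.D = c.T ^ 2) : RemovesEdge M c HERG.cut 1 c.D where
  mem := hM.cut
  edges := HERG.edges_cut
  numVert := HERG.numVert_cut
  poly G _ he := hc ▸ G.poly_cut he
  mul_eq := one_mul _

theorem eq_one_of_isUnit_mul {R : Type*} [CommRing R] {a v b : R} (hv : v = v ^ 2)
    (h : a * v = b) (hb : IsUnit b) : v = 1 := by
  have hu : IsUnit v := isUnit_of_mul_isUnit_right (h ▸ hb)
  refine hu.mul_left_cancel ?_
  rw [mul_one, ← sq, ← hv]

/-! ### The recipe theorems. -/

theorem mainTheorem10 {R : Type*} [CommRing R]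
    -- only the restriction of `F` to `M` plays a role
    (M : Set PinchedGraph) (F : PinchedGraph → R)
    (hM : MinorClosed M) (hchord : ChordClosed M)
    (h1000 : (HERG.canon 1 0 0 0).cls ∈ M) (h1010 : (HERG.canon 1 0 1 0).cls ∈ M)
    (h2100 : (HERG.canon 2 1 0 0).cls ∈ M)
    (s q r : R) (hs : s = F (HERG.canon 2 1 0 0).cls) (hq : q = F (HERG.canon 1 0 0 0).cls)
    (hr : r = F (HERG.canon 1 0 1 0).cls)
    (α : Rˣ) (x u v : R)
    -- multiplicativity
    (hunion : ∀ G H K : HERG, G.cls ∈ M → H.cls ∈ M → K.cls ∈ M →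
      G.IsBouquetUnion → H.IsBouquetUnion → G.IsUnion H K → F K.cls = F G.cls * F H.cls)
    (hjoint : ∀ G H K : HERG, G.cls ∈ M → H.cls ∈ M → K.cls ∈ M →
      G.IsJoint H K → α * F K.cls = F G.cls * F H.cls)
    (hv : v = v ^ 2) :
    -- first low fat recipe theorem and its corollary
    (∀ s₁ t : R, (HERG.canon 0 0 0 1).cls ∈ M → s₁ = F (HERG.canon 0 0 0 1).cls →
      -- rotation and twist relations
      (∀ (D₁ D₂ : HERG) (e : ℕ) (a b c d : List Mark), D₁.cls ∈ M → D₂.cls ∈ M →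
        D₁.IsRotation D₂ e a b c d ∨ D₁.IsTwist D₂ e a b c d →
        (HERG.Linked a b c d →
          F D₁.cls - F (D₁.cut e).cls = F D₂.cls - F (D₂.cut e).cls) ∧
        (¬ HERG.Linked a b c d →
          F D₁.cls - ((x - 1) * (↑α⁻¹ * s₁) ^ 2 + 1) * F (D₁.cut e).cls =
            F D₂.cls - ((x - 1) * (↑α⁻¹ * s₁) ^ 2 + 1) * F (D₂.cut e).cls)) →
      -- contraction and cut
      (∀ (G : HERG) (e : ℕ) (G' : HERG), G.cls ∈ M → G.IsContraction e G' →
        (G.IsRegular e → F G.cls = F (G.cut e).cls + F G'.cls) ∧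
        (G.IsBridge e → F G.cls = ((x - 1) * (↑α⁻¹ * s₁) ^ 2 + 1) * F G'.cls)) →
      -- edgeless graphs
      (∀ G : HERG, G.cls ∈ M → G.edges = ∅ → F G.cls = α ^ G.numVert * t ^ G.numHR) →
      (q - ↑α⁻¹ * s₁ ^ 2) ^ 2 * u ^ 2 =
        α * (s - 2 * ↑α⁻¹ ^ 2 * (q - ↑α⁻¹ * s₁ ^ 2) * s₁ ^ 2 - ↑α⁻¹ ^ 3 * s₁ ^ 4) →
      (q - ↑α⁻¹ * s₁ ^ 2) * u * v = r - ↑α⁻¹ * s₁ ^ 2 →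
      (∀ G : HERG, G.cls ∈ M →
        F G.cls = α ^ G.comps G.edges *
          G.polyR' x (↑α⁻¹ * (q - ↑α⁻¹ * s₁ ^ 2 + α)) u v (↑α⁻¹ * s₁)) ∧
      (IsUnit (q - ↑α⁻¹ * s₁ ^ 2) → IsUnit (r - ↑α⁻¹ * s₁ ^ 2) →
        v = 1 ∧ ∀ G : HERG, G.cls ∈ M →
          F G.cls = α ^ G.comps G.edges *
            G.polyR' x (↑α⁻¹ * (q - ↑α⁻¹ * s₁ ^ 2 + α)) u 1 (↑α⁻¹ * s₁))) ∧
    -- second (weighted) low fat recipe theorem and its corollary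
    (∀ (σ τ : Rˣ) (T : R),
      -- weighted rotation and twist relations
      (∀ (D₁ D₂ : HERG) (e : ℕ) (a b c d : List Mark), D₁.cls ∈ M → D₂.cls ∈ M →
        D₁.IsRotation D₂ e a b c d ∨ D₁.IsTwist D₂ e a b c d →
        (HERG.Linked a b c d →
          σ * F D₁.cls - σ * τ * F (D₁.del e).cls = σ * F D₂.cls - σ * τ * F (D₂.del e).cls) ∧
        (¬ HERG.Linked a b c d →
          σ * F D₁.cls - x * τ * F (D₁.del e).cls =
            σ * F D₂.cls - x * τ * F (D₂.del e).cls)) →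
      -- weighted contraction and deletion
      (∀ (G : HERG) (e : ℕ) (G' : HERG), G.cls ∈ M → G.IsContraction e G' →
        (G.IsRegular e → F G.cls = τ * F (G.del e).cls + σ * F G'.cls) ∧
        (G.IsBridge e → F G.cls = x * F G'.cls)) →
      -- edgeless graphs
      (∀ G : HERG, G.cls ∈ M → G.edges = ∅ → F G.cls = α ^ G.numVert * T ^ G.numHR) →
      (q - α * τ) ^ 2 * u ^ 2 = α * (s - 2 * τ * q + α * τ ^ 2) →
      (q - α * τ) * u * v = r - α * τ →
      (∀ G : HERG, G.cls ∈ M →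
        ↑σ⁻¹ ^ G.rk G.edges * ↑τ⁻¹ ^ G.nullity G.edges * F G.cls =
          T ^ G.numHR * α ^ G.comps G.edges *
            G.polyBR (↑σ⁻¹ * x) (↑α⁻¹ * ↑τ⁻¹ * q) u v ∧
        ∀ S : Rˣ,
          ↑σ⁻¹ ^ G.rk G.edges * ↑τ⁻¹ ^ G.nullity G.edges * F G.cls =
            T ^ G.numHR * ↑S⁻¹ ^ (G.numHR + 2 * G.nullity G.edges) * α ^ G.comps G.edges *
              G.polyR' (↑σ⁻¹ * ((x - σ) * ↑S⁻¹ ^ 2 + σ))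
                (S ^ 2 * (↑α⁻¹ * ↑τ⁻¹ * q) - S ^ 2 + 1) u v S) ∧
      (IsUnit (q - α * τ) → IsUnit (r - α * τ) →
        v = 1 ∧ ∀ G : HERG, G.cls ∈ M →
          ↑σ⁻¹ ^ G.rk G.edges * ↑τ⁻¹ ^ G.nullity G.edges * F G.cls =
            T ^ G.numHR * α ^ G.comps G.edges *
              G.polyBR (↑σ⁻¹ * x) (↑α⁻¹ * ↑τ⁻¹ * q) u 1)) := by
  refine ⟨fun s₁ t hmem hs₁ hchords hcontr hedge hu hvr => ?_,
    fun σ τ T hchords hcontr hedge hu hvr => ?_⟩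
  · have hα : (α : R) * ↑α⁻¹ = 1 := α.mul_inv
    generalize hY : q - ↑α⁻¹ * s₁ ^ 2 = y at *
    -- `D₀₀₀₁` is edgeless with one vertex and one half-ribbon, so `s₁ = α * t`.
    have ht : t = ↑α⁻¹ * s₁ := by
      have h := hedge (HERG.canon 0 0 0 1) hmem rfl
      have hHR : (HERG.canon 0 0 0 1).numHR = 1 := rfl
      have hV : (HERG.canon 0 0 0 1).numVert = 1 := rfl
      rw [← hs₁, hHR, hV, pow_one, pow_one] at h
      rw [h, ← mul_assoc, α.inv_mul, one_mul]
    -- These are the weights of `poly_eq_polyR'`. The bridge factor `D * B + σ` becomes `β`, and `C`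
    -- equals `α⁻¹ * y`.
    let c : Params R := ⟨α, ↑α⁻¹ * s₁, x - 1, 1, ↑α⁻¹ * (y + α) - 1, (↑α⁻¹ * s₁) ^ 2, u, v⟩
    have hF : Recursive M c HERG.cut 1 ((x - 1) * (↑α⁻¹ * s₁) ^ 2 + 1) F :=
      { union := hunion
        joint := hjoint
        linked := fun G H e a b u v hG hH h hl => by
          rw [one_mul, one_mul]; exact (hchords G H e a b u v hG hH h).1 hl
        unlinked := fun G H e a b u v hG hH h hl => (hchords G H e a b u v hG hH h).2 hl
        regular := fun G e G' hG h hr => by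
          rw [one_mul, one_mul]; exact (hcontr G e G' hG h).1 hr
        bridge := fun G e G' hG h hb => by
          rw [(hcontr G e G' hG h).2 hb, mul_comm (x - 1)]
        edgeless := fun G hG hE => (hedge G hG hE).trans (by simp only [c, ht])
        pos := by
          rw [← hq]
          simp only [c]
          linear_combination hY - (y + α + ↑α⁻¹ * s₁ ^ 2 ) * hα
        neg := by
          rw [← hr]
          simp only [c]
          linear_combination -hvr - (y * u * v + α * u * v + ↑α⁻¹ * s₁ ^ 2) * hα
        handle := by
          rw [← hs]
          simp only [c]
          -- This value is the condition on `u ^ 2` divided by `α`; the remaining terms only cancel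
          -- `α * α⁻¹`.
          linear_combination -↑α⁻¹ * hu - (s + ↑α⁻¹ * y ^ 2 * u ^ 2 +
            α * (2 * (↑α⁻¹ * s₁) ^ 2 + (2 * ↑α⁻¹ * y + (α * ↑α⁻¹ - 1)) * u ^ 2)) * hα }
    have main : ∀ G : HERG, G.cls ∈ M → F G.cls = α ^ G.comps G.edges *
        G.polyR' x (↑α⁻¹ * (y + α)) u v (↑α⁻¹ * s₁) := fun G hG =>
      (hF.eq_poly (removesEdge_cut hM rfl) hM hchord α.isUnit hv h1000 h1010 h2100 _ _ hG rfl).trans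
        (G.poly_eq_polyR' _ _ _ _ _ _)
    refine ⟨main, fun _ hr => ?_⟩
    have hv1 := eq_one_of_isUnit_mul hv hvr hr
    exact ⟨hv1, fun G hG => by rw [main G hG, hv1]⟩
  · have hα : (α : R) * ↑α⁻¹ = 1 := α.mul_inv
    have hσ : (σ : R) * ↑σ⁻¹ = 1 := σ.mul_inv
    have hτ : (τ : R) * ↑τ⁻¹ = 1 := τ.mul_inv
    -- `B` solves `D * B + σ = x` and `C` solves `α * (D + C) = q`.
    let c : Params R := ⟨α, T, ↑τ⁻¹ * (x - σ), σ, ↑α⁻¹ * q - τ, τ, u, v⟩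
    -- Dividing the weighted chord relations by `σ` gives the coefficients `τ` and `σ⁻¹ * x * τ`.
    have hF : Recursive M c HERG.del τ (↑σ⁻¹ * x * τ) F :=
      { union := hunion
        joint := hjoint
        linked := fun G H e a b u v hG hH h hl => by
          have := (hchords G H e a b u v hG hH h).1 hl
          refine σ.isUnit.mul_left_cancel ?_
          linear_combination this
        unlinked := fun G H e a b u v hG hH h hl => by
          have := (hchords G H e a b u v hG hH h).2 hl
          refine σ.isUnit.mul_left_cancel ?_
          linear_combination this - x * τ * (F (G.del e).cls - F (H.del e).cls) * hσ
        regular := fun G e G' hG h hr => (hcontr G e G' hG h).1 hr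
        bridge := fun G e G' hG h hb => by
          rw [(hcontr G e G' hG h).2 hb]
          simp only [c]
          linear_combination -(x - σ) * F G'.cls * hτ
        edgeless := hedge
        pos := by
          rw [← hq]
          simp only [c]
          linear_combination -q * hα
        neg := by
          rw [← hr]
          simp only [c]
          linear_combination -hvr - q * u * v * hα
        handle := by
          rw [← hs]
          simp only [c]
          linear_combination -↑α⁻¹ * hu -
            (s + α * τ ^ 2 + u ^ 2 * (↑α⁻¹ * q ^ 2 - α * τ ^ 2)) * hα }
    have main : ∀ G : HERG, G.cls ∈ M →
        ↑σ⁻¹ ^ G.rk G.edges * ↑τ⁻¹ ^ G.nullity G.edges * F G.cls =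
          T ^ G.numHR * α ^ G.comps G.edges * G.polyBR (↑σ⁻¹ * x) (↑α⁻¹ * ↑τ⁻¹ * q) u v := by
      intro G hG
      have h1 : F G.cls = G.poly c :=
        hF.eq_poly (removesEdge_del hM c) hM hchord α.isUnit hv h1000 h1010 h2100 _ _ hG rfl
      have g1 : (↑σ⁻¹ : R) ^ G.rk G.edges * σ ^ G.rk G.edges = 1 := by
        rw [← mul_pow, σ.inv_mul, one_pow]
      have g2 : (↑τ⁻¹ : R) ^ G.nullity G.edges * τ ^ G.nullity G.edges = 1 := by
        rw [← mul_pow, τ.inv_mul, one_pow]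
      rw [h1, G.poly_eq_polyBR (X := ↑σ⁻¹ * x) (Y := ↑α⁻¹ * ↑τ⁻¹ * q)
        (by linear_combination (x - σ) * hτ - x * hσ) (by linear_combination -↑α⁻¹ * q * hτ)]
      linear_combination (T ^ G.numHR * α ^ G.comps G.edges *
        G.polyBR (↑σ⁻¹ * x) (↑α⁻¹ * ↑τ⁻¹ * q) u v) *
        (↑τ⁻¹ ^ G.nullity G.edges * τ ^ G.nullity G.edges * g1 + g2)
    refine ⟨fun G hG => ⟨main G hG, fun S => ?_⟩, fun _ hr => ?_⟩
    · have hS : (S : R) * ↑S⁻¹ = 1 := S.mul_inv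
      rw [main G hG, G.polyR'_eq_polyBR (X := ↑σ⁻¹ * x) (Y := ↑α⁻¹ * ↑τ⁻¹ * q)
        (by linear_combination (↑σ⁻¹ * x - σ * ↑σ⁻¹) * (S * ↑S⁻¹ + 1) * hS + (S ^ 2 - 1) * hσ) (by ring)]
      have h1 : (S : R) ^ (G.numHR + 2 * G.nullity G.edges) *
          ↑S⁻¹ ^ (G.numHR + 2 * G.nullity G.edges) = 1 := by rw [← mul_pow, hS, one_pow]
      linear_combination -(T ^ G.numHR * α ^ G.comps G.edges *
        G.polyBR (↑σ⁻¹ * x) (↑α⁻¹ * ↑τ⁻¹ * q) u v) * h1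
    · have hv1 := eq_one_of_isUnit_mul hv hvr hr
      exact ⟨hv1, fun G hG => by rw [main G hG, hv1]⟩
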